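/- Let $m\ge 3$ be an odd integer. Let $X=(X_t)_{t\ge 0}$ be a measurable centered Gaussian process with $X_0=0$ a.s. (only times in $[0,1]$ and increments starting in $[0,1]$ matter; a process given on $[0,1]$ only is extended by $X_t=X_1$ for $t\ge 1$). Write $Q(s,t)=\mathbf E[X_sX_t]$, $Q_u=Q(u,u)=\operatorname{Var}[X_u]$ and $\delta^2(s,t)=\mathbf E[(X_t-X_s)^2]$. Assume the following. * There is a function $\delta:[0,1]\to[0,\infty)$ such that $r\mapsto\delta^2(r):=\delta(r)^2$ is increasing and concave on $[0,1]$, $\delta(r)=o(r^{1/(2m)})$ as $r\to0^+$, and $\delta^2(s,s+r)\le\delta^2(r)$ for all $s,r\in[0,1]$. * In the sense of distributions off the diagonal, $\partial^2\delta^2(s,t)/\partial s\,\partial t$ is a signed measure $\mu$ on $\{(s,t)\in[0,1]^2: s\ne t\}$ that is finite on compact sets avoiding the diagonal. For some constant $C$ and all small $\varepsilon>0$, its total variation satisfies $$|\mu|\big(\{(s,t): 0\le s\le t-\varepsilon,\ t\le 1\}\big)\le C\,\varepsilon^{-(m-1)/m}.$$ * The function $u\mapsto Q_u$ is increasing and concave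 on $[0,1]$. For each $u\in[0,1]$, the function $v\mapsto\delta^2(u,v)$ is increasing and concave on $[u,1]$. For each $v\in[0,1]$, the function $u\mapsto\delta^2(u,v)$ is decreasing on $[0,v]$, and it is either concave or convex on $[0,v]$. * There are constants $a>1$, $0<b<1/2$, $c>1/4$ and $c'>0$ such that (i) $c\,\delta^2(u)\le Q_u$ for all $0<u<1$; (ii) $c'\,\delta^2(u)\,\delta^2(v-u)\le Q_uQ_v-Q(u,v)^2$ for all $0<u<v\le1$; (iii) $\dfrac{\delta(au)-\delta(u)}{(a-1)u}<b\,\dfrac{\delta(u)}{u}$ for all $u>0$ with $au\le1$. (Increasing and decreasing are meant in the weak sense.) Then for every bounded measurable $g:\mathbf R\to\mathbf R$ and every $\varepsilon\in(0,1]$, the function $u\mapsto(X_{u+\varepsilon}-X_u)^m g\big(\tfrac{X_{u+\varepsilon}+X_u}{2}\big)$ is a.s. integrable on $[0,1]$, its integral is in $L^2(\Omega)$, and $$\lim_{\varepsilon\to0^+}\frac1{\varepsilon^2}\,\mathbf E\left[\left(\int_0^1 (X_{u+\varepsilon}-X_u)^m\, g\Big(\frac{X_{u+\varepsilon}+X_u}{2}\Big)\,du\right)^2\right]=0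 .$$ -/

import Mathlib

open MeasureTheory ProbabilityTheory Filter Set Topology

/-- The function `Q(s,t) = E[X_s X_t]`; it is the covariance function when `X` is centered, and
then `Q(u,u) = Var[X_u]`. -/
noncomputable def covFn {Ω : Type*} [MeasurableSpace Ω] (P : Measure Ω) (X : ℝ → Ω → ℝ)
    (s t : ℝ) : ℝ :=
  ∫ ω, X s ω * X t ω ∂P

/-- The squared canonical metric `δ²(s,t) = E[(X_t - X_s)²]`. -/
noncomputable def canonMetricSq {Ω : Type*} [MeasurableSpace Ω] (P : Measure Ω) (X : ℝ → Ω → ℝ)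
    (s t : ℝ) : ℝ :=
  ∫ ω, (X t ω - X s ω) ^ 2 ∂P

/-- The unit square without its diagonal. -/
def offDiagSquare : Set (ℝ × ℝ) :=
  {p | p.1 ∈ Icc (0 : ℝ) 1 ∧ p.2 ∈ Icc (0 : ℝ) 1 ∧ p.1 ≠ p.2}

/-- The open unit square without its diagonal. -/
def openOffDiagSquare : Set (ℝ × ℝ) :=
  {p | p.1 ∈ Ioo (0 : ℝ) 1 ∧ p.2 ∈ Ioo (0 : ℝ) 1 ∧ p.1 ≠ p.2}

/-- The off-diagonal simplex `{(s,t) : 0 ≤ s ≤ t - ε, t ≤ 1}`. -/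
def offDiagSimplex (ε : ℝ) : Set (ℝ × ℝ) :=
  {p | 0 ≤ p.1 ∧ p.1 ≤ p.2 - ε ∧ p.2 ≤ 1}

/-- The mixed derivative `∂²φ/∂s∂t` of a function of `(s,t)`. -/
noncomputable def mixedDeriv (φ : ℝ × ℝ → ℝ) (p : ℝ × ℝ) : ℝ :=
  deriv (fun s => deriv (fun t => φ (s, t)) p.2) p.1

/-- In the sense of distributions off the diagonal, `∂²f/∂s∂t` is the signed measure
`μ = μp - μn` on the unit square without its diagonal. The measure may have infinite mass near the
diagonal, and so it is given by its Jordan decomposition: `μp` and `μn` are mutually singular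
positive measures, finite on every compact set that avoids the diagonal (hence σ-finite). The total
variation measure of `μ` is `|μ| = μp + μn`. -/
structure HasMixedDerivMeasure (f : ℝ → ℝ → ℝ) (μp μn : Measure (ℝ × ℝ)) : Prop where
  mutuallySingular : μp ⟂ₘ μn
  pos_compl : μp offDiagSquareᶜ = 0
  neg_compl : μn offDiagSquareᶜ = 0
  pos_compact : ∀ K : Set (ℝ × ℝ), IsCompact K → K ⊆ offDiagSquare → μp K < ⊤
  neg_compact : ∀ K : Set (ℝ × ℝ), IsCompact K → K ⊆ offDiagSquare → μn K < ⊤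
  integral_eq : ∀ φ : ℝ × ℝ → ℝ, ContDiff ℝ ((⊤ : ℕ∞) : WithTop ℕ∞) φ → HasCompactSupport φ →
    tsupport φ ⊆ openOffDiagSquare →
    ∫ p, f p.1 p.2 * mixedDeriv φ p = ∫ p, φ p ∂μp - ∫ p, φ p ∂μn

/-- The integrand `(X_{u+ε} - X_u)^m g((X_{u+ε} + X_u)/2)`. -/
noncomputable def weightedIncr {Ω : Type*} (X : ℝ → Ω → ℝ) (m : ℕ) (g : ℝ → ℝ) (ε : ℝ)
    (ω : Ω) (u : ℝ) : ℝ :=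
  (X (u + ε) ω - X u ω) ^ m * g ((X (u + ε) ω + X u ω) / 2)

/-! Write f(u) for the weighted increment at scale ε. By Fubini the second moment is at most the
integral of |E[f(u)f(v)]| over the unit square (`second_moment_integral`), and by symmetry one may
take u ≤ v. Where u, v-u or 1-v is at most Kε, the area is O(ε) and the integrand is O(δ(ε)^(2m)) =
o(ε), so this region contributes o(ε²).

Elsewhere, regress the increments at u and v on the two midpoints that enter g. The residuals are
independent of the midpoints, hence of both weights and of the regressions α, β. Expand the two m-th
powers: since m is odd, parity leaves only terms carrying either the covariance of the residuals or
the product ‖α‖‖β‖, times δ(ε)^(2m-2) (`abs_integral_weighted_le`). Two estimates remain.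

The covariance of the increments is half a rectangular increment of δ²(s,t) up to sign, hence
dominated by |μ| of a rectangle of side 2ε (`abs_rect_incr_le`). Integrating over the corner gives
O(ε²)|μ|(simplex) = O(ε² ε^(-(m-1)/m)), and δ(ε)^(2m-2) = o(ε^((m-1)/m)) turns this into o(ε²).

With y = min(u, v-u), the regressions satisfy ‖α‖, ‖β‖ ≤ Cεδ(y)/y (`exists_regression`), and the
square of this bound, at most a multiple of ε² y^(1/m-2), integrates over y > ε to O(ε²
ε^(-(m-1)/m)) again. The numerators, covariances of increments with midpoints, are differences of
squared metrics and so are O(ε) by concavity. The denominator is the hard point: the determinant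
condition concerns X_u and X_v, not the midpoints, which could degenerate if the values at time
shift ε were nearly opposite to those at shift 0. This is excluded in `exists_le_norm_midpoints`: by
concavity and monotonicity such an opposition would persist among many geometrically spaced earlier
shifts, but many vectors of bounded norm cannot be pairwise strongly negatively correlated
(`neg_sq_le_of_inner_le`). -/

/-- A curve in a real inner product space whose squared canonical metric is controlled by the
univariate function `δ`, with the monotonicity and concavity of the main theorem and the lower
bound `κ` on the Gram determinants. -/
structure ConcaveCurve {H : Type*} [NormedAddCommGroup H] [InnerProductSpace ℝ H]
    (x : ℝ → H) (δ : ℝ → ℝ) (κ : ℝ) : Prop where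
  zero : x 0 = 0
  nonneg : ∀ r ∈ Icc (0 : ℝ) 1, 0 ≤ δ r
  pos : ∀ r, 0 < r → r ≤ 1 → 0 < δ r
  sq_mono : MonotoneOn (fun r => δ r ^ 2) (Icc 0 1)
  sq_concave : ConcaveOn ℝ (Icc 0 1) (fun r => δ r ^ 2)
  dom : ∀ s ∈ Icc (0 : ℝ) 1, ∀ r ∈ Icc (0 : ℝ) 1, ‖x (s + r) - x s‖ ≤ δ r
  mono_right : ∀ u ∈ Icc (0 : ℝ) 1, MonotoneOn (fun v => ‖x v - x u‖ ^ 2) (Icc u 1)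
  concave_right : ∀ u ∈ Icc (0 : ℝ) 1, ConcaveOn ℝ (Icc u 1) (fun v => ‖x v - x u‖ ^ 2)
  anti_left : ∀ v ∈ Icc (0 : ℝ) 1, MonotoneOn (fun u => -‖x v - x u‖ ^ 2) (Icc 0 v)
  convex_or_concave_left : ∀ v ∈ Icc (0 : ℝ) 1,
    ConcaveOn ℝ (Icc 0 v) (fun u => -‖x v - x u‖ ^ 2) ∨
      ConcaveOn ℝ (Icc 0 v) (fun u => ‖x v - x u‖ ^ 2)
  det_pos : 0 < κ
  det : ∀ u v, 0 < u → u < v → v ≤ 1 →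
    κ * δ u ^ 2 * δ (v - u) ^ 2 ≤ ‖x u‖ ^ 2 * ‖x v‖ ^ 2 - (inner ℝ (x u) (x v)) ^ 2

/-! ### Increments of the squared metric bounded through monotonicity and concavity -/

namespace ConcaveCurve

variable {H : Type*} [NormedAddCommGroup H] [InnerProductSpace ℝ H]
  {x : ℝ → H} {δ : ℝ → ℝ} {κ : ℝ}

lemma mono (h : ConcaveCurve x δ κ) {r s : ℝ} (hr : 0 ≤ r) (hrs : r ≤ s) (hs : s ≤ 1) :
    δ r ≤ δ s := by
  have h1 := h.sq_mono ⟨hr, hrs.trans hs⟩ ⟨hr.trans hrs, hs⟩ hrs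
  exact (abs_le_of_sq_le_sq' h1 (h.nonneg s ⟨hr.trans hrs, hs⟩)).2

/-- Concavity along the chord from 0 to s; only δ(0)² ≥ 0 is needed, not δ(0) = 0. -/
lemma sq_div_anti (h : ConcaveCurve x δ κ) {r s : ℝ} (hr : 0 < r) (hrs : r ≤ s) (hs : s ≤ 1) :
    δ s / s * δ s ≤ δ r / r * δ r := by
  have hs0 : 0 < s := hr.trans_le hrs
  have h1 : r / s * δ s ^ 2 + (1 - r / s) * δ 0 ^ 2 ≤ δ (r / s * s + (1 - r / s) * 0) ^ 2 :=
    h.sq_concave.2 ⟨hs0.le, hs⟩ ⟨le_rfl, zero_le_one⟩ (by positivity)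
      (by rw [sub_nonneg, div_le_one hs0]; exact hrs) (by ring)
  simp only [mul_zero, add_zero] at h1
  rw [div_mul_cancel₀ _ hs0.ne'] at h1
  have h2 : r / s * δ s ^ 2 ≤ δ r ^ 2 := by
    have : 0 ≤ (1 - r / s) * δ 0 ^ 2 := by
      have : r / s ≤ 1 := (div_le_one hs0).2 hrs
      have := sub_nonneg.2 this
      positivity
    linarith
  rw [div_mul_eq_mul_div, div_mul_eq_mul_div, le_div_iff₀ hr]
  calc _ = r / s * δ s ^ 2 := by ring
    _ ≤ δ r ^ 2 := h2
    _ = _ := by ring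

lemma div_anti (h : ConcaveCurve x δ κ) {r s : ℝ} (hr : 0 < r) (hrs : r ≤ s) (hs : s ≤ 1) :
    δ s / s ≤ δ r / r := by
  have hps := h.pos s (hr.trans_le hrs) hs
  refine le_of_mul_le_mul_right ((h.sq_div_anti hr hrs hs).trans ?_) hps
  have := h.mono hr.le hrs hs
  have := h.pos r hr (hrs.trans hs)
  gcongr

lemma norm_sub_le (h : ConcaveCurve x δ κ) {s t : ℝ} (hs : 0 ≤ s) (hst : s ≤ t) (ht : t ≤ 1) :
    ‖x t - x s‖ ≤ δ (t - s) := by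
  simpa using h.dom s ⟨hs, hst.trans ht⟩ (t - s) ⟨by linarith, by linarith⟩

lemma norm_le (h : ConcaveCurve x δ κ) {t : ℝ} (ht0 : 0 ≤ t) (ht : t ≤ 1) : ‖x t‖ ≤ δ t := by
  simpa [h.zero] using h.norm_sub_le le_rfl ht0 ht

lemma two_mul_le (h : ConcaveCurve x δ κ) {r s : ℝ} (hr : 0 < r) (hs0 : 0 < s) (hs : s ≤ 1)
    (hsr : s ≤ 2 * r) (hr1 : r ≤ 1) : δ s ≤ 2 * δ r := by
  rcases le_total s r with hle | hle
  · have := h.mono hs0.le hle hr1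
    have := h.pos r hr hr1
    linarith
  · have h1 := h.div_anti hr hle hs
    have hp := h.pos r hr hr1
    rw [div_le_div_iff₀ hs0 hr] at h1
    have h2 : δ s * r ≤ (2 * δ r) * r := by nlinarith
    exact le_of_mul_le_mul_right h2 hr

/-- By concavity in the right argument, the slope over [t, t'] is at most that of the chord from s,
where the metric vanishes, to t. -/
lemma incr_right (h : ConcaveCurve x δ κ) {s t t' : ℝ} (hs : 0 ≤ s) (hst : s < t) (htt : t ≤ t')
    (ht : t' ≤ 1) :
    |‖x t' - x s‖ ^ 2 - ‖x t - x s‖ ^ 2| ≤ (t' - t) * (δ (t - s) / (t - s) * δ (t - s)) := by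
  have hsm : s ∈ Icc (0 : ℝ) 1 := ⟨hs, by linarith⟩
  have hmono := h.mono_right s hsm (a := t) (b := t') ⟨hst.le, by linarith⟩ ⟨by linarith, ht⟩ htt
  simp only at hmono
  rw [abs_of_nonneg (by linarith)]
  rcases htt.eq_or_lt with rfl | hlt
  · simp
  have h1 := (h.concave_right s hsm).slope_anti_adjacent (x := s) (y := t) (z := t')
    ⟨le_rfl, hsm.2⟩ ⟨by linarith, ht⟩ hst hlt
  simp only [sub_self, norm_zero] at h1
  rw [div_le_iff₀ (by linarith)] at h1
  have h2 : ‖x t - x s‖ ^ 2 ≤ δ (t - s) ^ 2 := by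
    have := h.norm_sub_le hs hst.le (by linarith)
    gcongr
  have h3 : 0 < t - s := by linarith
  calc _ ≤ _ := h1
    _ ≤ (δ (t - s) ^ 2) / (t - s) * (t' - t) := by
        have : 0 ≤ t' - t := by linarith
        gcongr
        linarith
    _ = _ := by ring

lemma incr_norm (h : ConcaveCurve x δ κ) {t t' : ℝ} (hst : 0 < t) (htt : t ≤ t') (ht : t' ≤ 1) :
    |‖x t'‖ ^ 2 - ‖x t‖ ^ 2| ≤ (t' - t) * (δ t / t * δ t) := by
  simpa [h.zero] using h.incr_right le_rfl hst htt ht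

lemma abs_sq_sub_sq_le {E : Type*} [NormedAddCommGroup E] (p q r : E) :
    |‖p - q‖ ^ 2 - ‖p - r‖ ^ 2| ≤ ‖r - q‖ * (‖p - q‖ + ‖p - r‖) := by
  have : |‖p - q‖ - ‖p - r‖| ≤ ‖r - q‖ := by
    have := abs_norm_sub_norm_le (p - q) (p - r)
    simpa using this
  calc _ = |(‖p - q‖ - ‖p - r‖) * (‖p - q‖ + ‖p - r‖)| := by congr 1; ring
    _ = |‖p - q‖ - ‖p - r‖| * (‖p - q‖ + ‖p - r‖) := by
        rw [abs_mul, abs_of_nonneg (by positivity : 0 ≤ ‖p - q‖ + ‖p - r‖)]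
    _ ≤ _ := by gcongr

/-- If the squared metric is convex in its left argument, it falls over [s, s'] no faster than over
[s-y, s], where the triangle inequality bounds the drop by 3δ(y)δ(t-s); y ≤ s keeps this interval
inside [0, t]. If it is concave, it falls no faster than over [s', t], where it drops to zero; `hst`
keeps t-s' at least (t-s)/2. -/
lemma incr_left (h : ConcaveCurve x δ κ) {s s' t y : ℝ} (hs : 0 < s) (hss : s ≤ s')
    (hst : s' - s ≤ (t - s) / 2) (hlt : s < t) (ht : t ≤ 1) (hy : y = min s (t - s)) :
    |‖x t - x s'‖ ^ 2 - ‖x t - x s‖ ^ 2| ≤ 3 * (s' - s) * (δ y / y * δ (t - s)) := by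
  have htm : t ∈ Icc (0 : ℝ) 1 := ⟨by linarith, ht⟩
  have hmono := h.anti_left t htm (a := s) (b := s') ⟨hs.le, hlt.le⟩ ⟨by linarith, by linarith⟩ hss
  simp only at hmono
  rw [abs_sub_comm, abs_of_nonneg (by linarith)]
  rcases hss.eq_or_lt with rfl | hlt'
  · simp
  have hy0 : 0 < y := by rw [hy]; exact lt_min hs (by linarith)
  have hys : y ≤ s := hy ▸ min_le_left _ _
  have hyt : y ≤ t - s := hy ▸ min_le_right _ _
  have hδ := h.pos y hy0 (by linarith)
  have hδt := h.pos (t - s) (by linarith) (by linarith)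
  have hd : 0 < s' - s := by linarith
  rcases h.convex_or_concave_left t htm with hc | hc
  · have h1 := hc.slope_anti_adjacent (x := s - y) (y := s) (z := s')
      ⟨by linarith, by linarith⟩ ⟨by linarith, by linarith⟩ (by linarith) hlt'
    have h2 := abs_sq_sub_sq_le (x t) (x (s - y)) (x s)
    have h3 : ‖x s - x (s - y)‖ ≤ δ y := by
      simpa using h.norm_sub_le (s := s - y) (t := s) (by linarith) (by linarith) (by linarith)
    have h4 : ‖x t - x s‖ ≤ δ (t - s) := h.norm_sub_le hs.le hlt.le ht
    have h5 : ‖x t - x (s - y)‖ ≤ 2 * δ (t - s) := by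
      calc ‖x t - x (s - y)‖ = ‖(x t - x s) + (x s - x (s - y))‖ := by congr 1; abel
        _ ≤ ‖x t - x s‖ + ‖x s - x (s - y)‖ := norm_add_le _ _
        _ ≤ δ (t - s) + δ y := by gcongr
        _ ≤ _ := by have := h.mono hy0.le hyt (by linarith); linarith
    have h6 : ‖x t - x (s - y)‖ ^ 2 - ‖x t - x s‖ ^ 2 ≤ δ y * (3 * δ (t - s)) := by
      refine (le_abs_self _).trans (h2.trans ?_)
      gcongr
      linarith
    rw [div_le_iff₀ hd, sub_sub_cancel] at h1
    calc _ ≤ (‖x t - x (s - y)‖ ^ 2 - ‖x t - x s‖ ^ 2) / y * (s' - s) := by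
          rw [neg_sub_neg, neg_sub_neg] at h1
          exact h1
      _ ≤ (δ y * (3 * δ (t - s))) / y * (s' - s) := by gcongr
      _ = _ := by ring
  · have h1 := hc.slope_anti_adjacent (x := s) (y := s') (z := t)
      ⟨by linarith, by linarith⟩ ⟨by linarith, by linarith⟩ hlt' (by linarith)
    simp only [sub_self, norm_zero] at h1
    have ht' : 0 < t - s' := by linarith
    have h2 : ‖x t - x s'‖ ^ 2 ≤ δ (t - s) ^ 2 := by
      have := h.norm_sub_le (s := s') (t := t) (by linarith) (by linarith) ht
      have := h.mono (r := t - s') (s := t - s) (by linarith) (by linarith) (by linarith)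
      gcongr
      linarith
    have h3 := h.div_anti hy0 hyt (by linarith)
    have h4 : (‖x t - x s‖ ^ 2 - ‖x t - x s'‖ ^ 2) / (s' - s) ≤ ‖x t - x s'‖ ^ 2 / (t - s') := by
      have e1 : (0 ^ 2 - ‖x t - x s'‖ ^ 2) / (t - s') = - (‖x t - x s'‖ ^ 2 / (t - s')) := by ring
      have e2 : (‖x t - x s'‖ ^ 2 - ‖x t - x s‖ ^ 2) / (s' - s) =
        - ((‖x t - x s‖ ^ 2 - ‖x t - x s'‖ ^ 2) / (s' - s)) := by ring
      rw [e1, e2] at h1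
      linarith
    rw [div_le_iff₀ hd] at h4
    have h5 : ‖x t - x s'‖ ^ 2 / (t - s') ≤ 2 * (δ (t - s) ^ 2 / (t - s)) := by
      calc _ ≤ δ (t - s) ^ 2 / ((t - s) / 2) := by
            gcongr
            linarith
        _ = _ := by field_simp
    have h6 : δ (t - s) ^ 2 / (t - s) ≤ δ y / y * δ (t - s) := by
      calc _ = δ (t - s) / (t - s) * δ (t - s) := by ring
        _ ≤ _ := by gcongr
    have h7 : 0 ≤ (δ y / y * δ (t - s)) := by positivity
    calc _ ≤ _ := h4
      _ ≤ 2 * (δ y / y * δ (t - s)) * (s' - s) := by gcongr; linarith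
      _ ≤ _ := by nlinarith

end ConcaveCurve

/-! ### Comparison of inner products across small time shifts -/

namespace ConcaveCurve

variable {H : Type*} [NormedAddCommGroup H] [InnerProductSpace ℝ H]
  {x : ℝ → H} {δ : ℝ → ℝ} {κ : ℝ}

/-- Increments of `‖x ·‖²` over a window around `u` that is small with respect to `min u w`. -/
lemma window_norm (h : ConcaveCurve x δ κ) {u w y q v s s' : ℝ} (hu : 0 < u) (hw : 0 < w)
    (hy : y = min u w) (hq : 0 < q) (hq8 : q ≤ 1 / 8) (hu1 : u ≤ 1) (hv : u ≤ v)
    (hs : v - q * y ≤ s) (hs1 : s ≤ v + q * y) (hs2 : s ≤ 1)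
    (hs' : v - q * y ≤ s') (hs1' : s' ≤ v + q * y) (hs2' : s' ≤ 1) :
    |‖x s‖ ^ 2 - ‖x s'‖ ^ 2| ≤ 4 * q * δ u * δ y := by
  wlog hss : s' ≤ s generalizing s s'
  · rw [abs_sub_comm]
    exact this hs' hs1' hs2' hs hs1 hs2 (le_of_not_ge hss)
  have hy0 : 0 < y := by rw [hy]; exact lt_min hu hw
  have hyu : y ≤ u := hy ▸ min_le_left _ _
  have hqy : q * y ≤ u / 8 := by nlinarith
  have hs0 : u / 2 ≤ s' := by linarith
  refine (h.incr_norm (t := s') (t' := s) (by linarith) hss hs2).trans ?_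
  have hδu := h.pos u hu hu1
  have hδy := h.pos y hy0 (by linarith)
  have hδs := h.pos s' (by linarith) hs2'
  have h1 : δ s' / s' * δ s' ≤ 2 * (δ y / y * δ u) := by
    have h3 : δ (u / 2) ≤ δ u := h.mono (by linarith) (by linarith) hu1
    have h4 := h.div_anti hy0 hyu hu1
    have := h.pos (u / 2) (by linarith) (by linarith)
    calc δ s' / s' * δ s' ≤ δ (u / 2) / (u / 2) * δ (u / 2) := h.sq_div_anti (by linarith) hs0 hs2'
      _ ≤ δ u / (u / 2) * δ u := by gcongr
      _ = 2 * (δ u / u * δ u) := by field_simp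
      _ ≤ _ := by gcongr
  have hnn : 0 ≤ δ s' / s' * δ s' := by
    have : 0 < s' := by linarith
    positivity
  calc (s - s') * (δ s' / s' * δ s') ≤ (2 * q * y) * (2 * (δ y / y * δ u)) :=
        mul_le_mul (by linarith) h1 hnn (by positivity)
    _ = _ := by field_simp; ring

/-- Increments of the squared metric over a window around `(u, u + w)` that is small with respect
to `min u w`. -/
lemma window_metric (h : ConcaveCurve x δ κ) {u w y q s s' t t' : ℝ} (hu : 0 < u) (hw : 0 < w)
    (hy : y = min u w) (hq : 0 < q) (hq8 : q ≤ 1 / 8) (hw1 : w ≤ 1)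
    (hs : |s - u| ≤ q * y) (hs' : |s' - u| ≤ q * y) (ht : |t - (u + w)| ≤ q * y)
    (ht' : |t' - (u + w)| ≤ q * y) (ht1 : t ≤ 1) (ht1' : t' ≤ 1) :
    |‖x t - x s‖ ^ 2 - ‖x t' - x s'‖ ^ 2| ≤ 32 * q * δ y * δ w := by
  have hy0 : 0 < y := by rw [hy]; exact lt_min hu hw
  have hyu : y ≤ u := hy ▸ min_le_left _ _
  have hyw : y ≤ w := hy ▸ min_le_right _ _
  have hqy : q * y ≤ y / 8 := by nlinarith
  have hδy := h.pos y hy0 (by linarith)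
  have hδw := h.pos w hw hw1
  -- The window radius is at most y/8, so all perturbed distances stay comparable to y or w, and
  -- δ(r)/r and δ(r) change by a factor of at most 2.
  have hG : ∀ r, y / 2 ≤ r → r ≤ 1 → δ r / r ≤ 2 * (δ y / y) := by
    intro r hr hr1
    calc δ r / r ≤ δ (y / 2) / (y / 2) := h.div_anti (by linarith) hr hr1
      _ ≤ δ y / (y / 2) := by
          have := h.mono (r := y / 2) (s := y) (by linarith) (by linarith) (by linarith)
          gcongr
      _ = _ := by field_simp
  have hD : ∀ r, w / 2 ≤ r → r ≤ 2 * w → r ≤ 1 → δ r ≤ 2 * δ w := fun r hr hr' hr1 =>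
    h.two_mul_le hw (by linarith) hr1 hr' hw1
  have hp : 0 < δ y / y := by positivity
  have right : ∀ s t t', |s - u| ≤ q * y → |t - (u + w)| ≤ q * y → |t' - (u + w)| ≤ q * y →
      t ≤ 1 → t' ≤ 1 → |‖x t - x s‖ ^ 2 - ‖x t' - x s‖ ^ 2| ≤ 8 * q * δ y * δ w := by
    intro s t t' hs ht ht' ht1 ht1'
    wlog htt : t' ≤ t generalizing t t'
    · rw [abs_sub_comm]
      exact this t' t ht' ht ht1' ht1 (le_of_not_ge htt)
    rw [abs_le] at hs ht ht'
    have h0 : w / 2 ≤ t' - s := by linarith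
    have h1 := hG (t' - s) (by linarith) (by linarith)
    have h2 := hD (t' - s) h0 (by linarith) (by linarith)
    have h3 := h.pos (t' - s) (by linarith) (by linarith)
    refine (h.incr_right (s := s) (by linarith) (by linarith) htt ht1).trans ?_
    calc (t - t') * (δ (t' - s) / (t' - s) * δ (t' - s))
        ≤ (2 * q * y) * (2 * (δ y / y) * (2 * δ w)) := by
          refine mul_le_mul (by linarith) (mul_le_mul h1 h2 h3.le (by positivity)) ?_
            (by positivity)
          have : 0 < t' - s := by linarith
          positivity
      _ = _ := by field_simp; ring
  have left : ∀ s s' t, |s - u| ≤ q * y → |s' - u| ≤ q * y → |t - (u + w)| ≤ q * y →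
      t ≤ 1 → |‖x t - x s‖ ^ 2 - ‖x t - x s'‖ ^ 2| ≤ 24 * q * δ y * δ w := by
    intro s s' t hs hs' ht ht1
    wlog hss : s ≤ s' generalizing s s'
    · rw [abs_sub_comm]
      exact this s' s hs' hs (le_of_not_ge hss)
    rw [abs_le] at hs hs' ht
    have h0 : w / 2 ≤ t - s := by linarith
    have hm : y / 2 ≤ min s (t - s) := le_min (by linarith) (by linarith)
    have hm1 : min s (t - s) ≤ 1 := (min_le_right _ _).trans (by linarith)
    have h1 := hG (min s (t - s)) hm hm1
    have h2 := hD (t - s) h0 (by linarith) (by linarith)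
    have h3 := h.pos (t - s) (by linarith) (by linarith)
    rw [abs_sub_comm]
    refine (h.incr_left (s := s) (s' := s') (by linarith) hss (by linarith) (by linarith)
      ht1 rfl).trans ?_
    calc 3 * (s' - s) * (δ (min s (t - s)) / min s (t - s) * δ (t - s))
        ≤ (6 * q * y) * (2 * (δ y / y) * (2 * δ w)) := by
          refine mul_le_mul (by linarith) (mul_le_mul h1 h2 h3.le (by positivity)) ?_
            (by positivity)
          have h4 : 0 < min s (t - s) := by linarith
          have := h.pos _ h4 hm1
          positivity
      _ = _ := by field_simp; ring
  calc _ ≤ |‖x t - x s‖ ^ 2 - ‖x t' - x s‖ ^ 2| + |‖x t' - x s‖ ^ 2 - ‖x t' - x s'‖ ^ 2| :=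
        abs_sub_le _ _ _
    _ ≤ 8 * q * δ y * δ w + 24 * q * δ y * δ w :=
        add_le_add (right s t t' hs ht ht' ht1 ht1') (left s s' t' hs hs' ht' ht1')
    _ = _ := by ring

/-- The squared metric across a short interval near `u` is almost dominated by the squared metric
between two points to the left of `u`. -/
lemma window_diag (h : ConcaveCurve x δ κ) {u y q ε θ θ' : ℝ} (hθ : 0 < θ) (hε : 0 < ε)
    (hq2 : q ≤ 1 / 2) (hθu : θ ≤ u) (hθy : θ ≤ y) (hy1 : y ≤ 1)
    (hεθ : ε ≤ θ') (hθθ : θ' ≤ q * θ) (hu1 : u + ε ≤ 1) :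
    ‖x (u + ε) - x u‖ ^ 2 - ‖x (u - θ') - x (u - θ)‖ ^ 2 ≤ 4 * q * δ y ^ 2 := by
  have hq : 0 < q := by
    by_contra hcon
    nlinarith
  have hθ' : θ' ≤ θ / 2 := by nlinarith
  -- Moving the left endpoint from u back to u-θ can only increase the metric. What remains is a
  -- change of the right endpoint by ε+θ' ≤ 2qθ at distance at least θ/2, which concavity controls.
  have h1 := h.anti_left (u + ε) ⟨by linarith, hu1⟩ (a := u - θ) (b := u)
    ⟨by linarith, by linarith⟩ ⟨by linarith, by linarith⟩ (by linarith)
  simp only [neg_le_neg_iff] at h1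
  have h2 := h.incr_right (s := u - θ) (t := u - θ') (t' := u + ε) (by linarith) (by linarith)
    (by linarith) hu1
  have h3 := (le_abs_self _).trans h2
  have e : u - θ' - (u - θ) = θ - θ' := by ring
  rw [e] at h3
  have hd := h.pos (θ - θ') (by linarith) (by linarith)
  have h4 := h.mono (r := θ - θ') (s := y) (by linarith) (by linarith) hy1
  have h5 : (u + ε - (u - θ')) * (δ (θ - θ') / (θ - θ') * δ (θ - θ')) ≤ 4 * q * δ y ^ 2 := by
    calc _ ≤ (2 * q * θ) * (δ y ^ 2 / (θ / 2)) := by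
          have hpos : 0 < θ - θ' := by linarith
          refine mul_le_mul (by linarith) ?_ (by positivity) (by positivity)
          rw [div_mul_eq_mul_div, ← sq]
          gcongr
          linarith
      _ = _ := by field_simp; ring
  linarith

/-- Polarization into quantities controlled by the curve. The short-range terms ‖p'-p‖² and ‖r'-r‖²
have nonpositive coefficients, so a one-sided comparison suffices for them. -/
lemma two_mul_inner_combination (p p' r r' : H) (a b : ℝ) :
    2 * inner ℝ (a • p + b • (r - p)) (a • p' + b • (r' - p')) =
      a * (a - b) * (‖p‖ ^ 2 + ‖p'‖ ^ 2) + a * b * (‖r‖ ^ 2 + ‖r'‖ ^ 2)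
        - (a - b) ^ 2 * ‖p' - p‖ ^ 2 - b ^ 2 * ‖r' - r‖ ^ 2
        - (a - b) * b * (‖r' - p‖ ^ 2 + ‖r - p'‖ ^ 2) := by
  simp only [norm_sub_sq_real, inner_add_left, inner_add_right, inner_smul_left, inner_smul_right,
    inner_sub_left, inner_sub_right, conj_trivial]
  rw [real_inner_comm p' p, real_inner_comm r' r, real_inner_comm p r', real_inner_comm p' r]
  ring

/-- The combination `a X_{u+τ} + b (X_{u+w+τ} - X_{u+τ})`. -/
def shifted (x : ℝ → H) (a b u w τ : ℝ) : H :=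
  a • x (u + τ) + b • (x (u + w + τ) - x (u + τ))

/-- All shifts are at most qy, so the long-range terms of the polarization identity move by O(qN²);
the short-range terms are compared one-sidedly by `window_diag`. A strongly negative correlation
between shifts 0 and ε would thus be inherited by the earlier shifts. -/
lemma inner_shifted_le (h : ConcaveCurve x δ κ) {u w y q ε θ θ' a b N : ℝ} (hu : 0 < u)
    (hw : 0 < w) (hy : y = min u w) (hq : 0 < q) (hq8 : q ≤ 1 / 8) (hε : 0 < ε) (hθ : 0 < θ)
    (hθy : θ ≤ q * y) (hεθ : ε ≤ θ') (hθθ : θ' ≤ q * θ) (hu1 : u + w + ε ≤ 1)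
    (hN : N = |a| * δ u + |b| * δ w) :
    inner ℝ (shifted x a b u w (-θ)) (shifted x a b u w (-θ')) ≤
      inner ℝ (shifted x a b u w 0) (shifted x a b u w ε) + 36 * q * N ^ 2 := by
  have hy0 : 0 < y := by rw [hy]; exact lt_min hu hw
  have hyu : y ≤ u := hy ▸ min_le_left _ _
  have hyw : y ≤ w := hy ▸ min_le_right _ _
  have hqy : q * y ≤ y / 8 := by nlinarith
  have hqθ : q * θ ≤ θ / 8 := by nlinarith
  have hδy := h.pos y hy0 (by linarith)
  have hδw := h.pos w hw (by linarith)
  have hδu := h.pos u hu (by linarith)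
  have hδyu : δ y ≤ δ u := h.mono hy0.le hyu (by linarith)
  have hδyw : δ y ≤ δ w := h.mono hy0.le hyw (by linarith)
  have A1 := h.window_norm (v := u) (s := u + -θ) (s' := u + 0) hu hw hy hq hq8 (by linarith)
    le_rfl (by linarith) (by linarith) (by linarith) (by linarith) (by linarith) (by linarith)
  have A2 := h.window_norm (v := u) (s := u + -θ') (s' := u + ε) hu hw hy hq hq8 (by linarith)
    le_rfl (by linarith) (by linarith) (by linarith) (by linarith) (by linarith) (by linarith)
  have B1 := h.window_norm (v := u + w) (s := u + w + -θ) (s' := u + w + 0) hu hw hy hq hq8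
    (by linarith) (by linarith) (by linarith) (by linarith) (by linarith) (by linarith)
    (by linarith) (by linarith)
  have B2 := h.window_norm (v := u + w) (s := u + w + -θ') (s' := u + w + ε) hu hw hy hq hq8
    (by linarith) (by linarith) (by linarith) (by linarith) (by linarith) (by linarith)
    (by linarith) (by linarith)
  have C1 := h.window_metric (s := u + -θ) (s' := u + 0) (t := u + w + -θ') (t' := u + w + ε)
    hu hw hy hq hq8 (by linarith) (by rw [abs_le]; constructor <;> linarith)
    (by rw [abs_le]; constructor <;> linarith) (by rw [abs_le]; constructor <;> linarith)
    (by rw [abs_le]; constructor <;> linarith) (by linarith) (by linarith)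
  have C2 := h.window_metric (s := u + -θ') (s' := u + ε) (t := u + w + -θ) (t' := u + w + 0)
    hu hw hy hq hq8 (by linarith) (by rw [abs_le]; constructor <;> linarith)
    (by rw [abs_le]; constructor <;> linarith) (by rw [abs_le]; constructor <;> linarith)
    (by rw [abs_le]; constructor <;> linarith) (by linarith) (by linarith)
  have D1 := h.window_diag (u := u) (y := y) (q := q) hθ hε (by linarith) (by linarith)
    (by linarith) (by linarith) hεθ hθθ (by linarith)
  have D2 := h.window_diag (u := u + w) (y := y) (q := q) hθ hε (by linarith) (by linarith)
    (by linarith) (by linarith) hεθ hθθ (by linarith)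
  have E1 := two_mul_inner_combination (x (u + -θ)) (x (u + -θ')) (x (u + w + -θ))
    (x (u + w + -θ')) a b
  have E2 := two_mul_inner_combination (x (u + 0)) (x (u + ε)) (x (u + w + 0))
    (x (u + w + ε)) a b
  simp only [← sub_eq_add_neg, add_zero] at A1 A2 B1 B2 C1 C2 E1 E2
  set p := |a| * δ u with hp
  set r := |b| * δ w with hr
  have hp0 : 0 ≤ p := by positivity
  have hr0 : 0 ≤ r := by positivity
  have hN1 : |a - b| * δ y ≤ N := by
    calc |a - b| * δ y ≤ (|a| + |b|) * δ y := by gcongr; exact abs_sub _ _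
      _ = |a| * δ y + |b| * δ y := by ring
      _ ≤ N := by rw [hN, hp, hr]; gcongr
  have hN2 : |b| * δ y ≤ N := by
    calc |b| * δ y ≤ |b| * δ w := by gcongr
      _ ≤ N := by linarith
  -- Applied with c = a-b and c = b, the square roots of the coefficients of the short-range terms;
  -- y ≤ u, w makes |c|δ(y) ≤ N.
  have F : ∀ c D : ℝ, |c| * δ y ≤ N → D ≤ 4 * q * δ y ^ 2 → c ^ 2 * D ≤ 4 * q * N ^ 2 := by
    intro c D hc hD
    calc c ^ 2 * D ≤ c ^ 2 * (4 * q * δ y ^ 2) := by gcongr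
      _ = 4 * q * (|c| * δ y) ^ 2 := by rw [mul_pow, sq_abs]; ring
      _ ≤ _ := by gcongr
  have F1 := F _ _ hN1 D1
  have F2 := F _ _ hN2 D2
  set dQu := ‖x (u - θ)‖ ^ 2 - ‖x u‖ ^ 2 + (‖x (u - θ')‖ ^ 2 - ‖x (u + ε)‖ ^ 2) with hdQu
  set dQv := ‖x (u + w - θ)‖ ^ 2 - ‖x (u + w)‖ ^ 2 +
    (‖x (u + w - θ')‖ ^ 2 - ‖x (u + w + ε)‖ ^ 2) with hdQv
  set dF := ‖x (u + w - θ') - x (u - θ)‖ ^ 2 - ‖x (u + w + ε) - x u‖ ^ 2 +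
    (‖x (u + w - θ) - x (u - θ')‖ ^ 2 - ‖x (u + w) - x (u + ε)‖ ^ 2) with hdF
  have hQu : |dQu| ≤ 8 * q * δ u * δ y := (abs_add_le _ _).trans (by linarith)
  have hQvu : |dQv - dQu| ≤ 16 * q * δ u * δ y :=
    (abs_sub _ _).trans (by
      have : |dQv| ≤ 8 * q * δ u * δ y := (abs_add_le _ _).trans (by linarith)
      linarith)
  have hFF : |dF| ≤ 64 * q * δ y * δ w := (abs_add_le _ _).trans (by linarith)
  have G1 : a ^ 2 * dQu ≤ 8 * q * p ^ 2 := by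
    calc a ^ 2 * dQu ≤ a ^ 2 * (8 * q * δ u * δ u) := by
          gcongr
          exact (le_abs_self _).trans (hQu.trans (by gcongr))
      _ = _ := by rw [hp, mul_pow, sq_abs]; ring
  have G2 : a * b * (dQv - dQu) ≤ 16 * q * p * r := by
    calc a * b * (dQv - dQu) ≤ |a * b * (dQv - dQu)| := le_abs_self _
      _ = |a| * |b| * |dQv - dQu| := by rw [abs_mul, abs_mul]
      _ ≤ |a| * |b| * (16 * q * δ u * δ w) := by
          gcongr
          exact hQvu.trans (by gcongr)
      _ = _ := by rw [hp, hr]; ring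
  have G3 : -(a * b * dF) ≤ 64 * q * p * r := by
    calc -(a * b * dF) ≤ |a * b * dF| := neg_le_abs _
      _ = |a| * |b| * |dF| := by rw [abs_mul, abs_mul]
      _ ≤ |a| * |b| * (64 * q * δ u * δ w) := by
          gcongr
          exact hFF.trans (by gcongr)
      _ = _ := by rw [hp, hr]; ring
  have G4 : b ^ 2 * dF ≤ 64 * q * r ^ 2 := by
    calc b ^ 2 * dF ≤ b ^ 2 * (64 * q * δ w * δ w) := by
          gcongr
          exact (le_abs_self _).trans (hFF.trans (by gcongr))
      _ = _ := by rw [hr, mul_pow, sq_abs]; ring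
  have G5 : 8 * q * p ^ 2 + 16 * q * p * r + 64 * q * p * r + 64 * q * r ^ 2 ≤ 64 * q * N ^ 2 := by
    rw [hN]
    have : 0 ≤ q * p ^ 2 := by positivity
    have : 0 ≤ q * p * r := by positivity
    linarith
  -- The errors add up to (64+4+4)qN² for the doubled inner products, hence the constant 36.
  have key : 2 * inner ℝ (shifted x a b u w (-θ)) (shifted x a b u w (-θ')) -
      2 * inner ℝ (shifted x a b u w 0) (shifted x a b u w ε) =
      a ^ 2 * dQu + a * b * (dQv - dQu) + -(a * b * dF) + b ^ 2 * dF +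
      (a - b) ^ 2 * (‖x (u + ε) - x u‖ ^ 2 - ‖x (u - θ') - x (u - θ)‖ ^ 2) +
      b ^ 2 * (‖x (u + w + ε) - x (u + w)‖ ^ 2 - ‖x (u + w - θ') - x (u + w - θ)‖ ^ 2) := by
    simp only [shifted, ← sub_eq_add_neg, add_zero]
    rw [E1, E2, hdQu, hdQv, hdF]
    ring
  linarith

end ConcaveCurve

/-! ### Gram determinants, negative correlations and projections in Hilbert space -/

section Hilbert

variable {H : Type*} [NormedAddCommGroup H] [InnerProductSpace ℝ H]

/-- Multiplied by ‖d‖², the squared norm of a•p + b•d is a² times the Gram determinant plus a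
square; exchanging the roles of p and d controls b. The bounds ‖p‖ ≤ α and ‖d‖ ≤ β then cancel. -/
lemma le_norm_combination_sq {p d : H} {α β κ : ℝ} (hα : 0 < α) (hβ : 0 < β) (hκ : 0 < κ)
    (hp : ‖p‖ ≤ α) (hd : ‖d‖ ≤ β)
    (hdet : κ * α ^ 2 * β ^ 2 ≤ ‖p‖ ^ 2 * ‖d‖ ^ 2 - (inner ℝ p d) ^ 2) (a b : ℝ) :
    κ / 4 * (|a| * α + |b| * β) ^ 2 ≤ ‖a • p + b • d‖ ^ 2 := by
  have e : ‖a • p + b • d‖ ^ 2 =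
      a ^ 2 * ‖p‖ ^ 2 + 2 * a * b * inner ℝ p d + b ^ 2 * ‖d‖ ^ 2 := by
    rw [norm_add_sq_real, norm_smul, norm_smul, mul_pow, mul_pow, inner_smul_left, inner_smul_right]
    simp only [Real.norm_eq_abs, sq_abs, conj_trivial]
    ring
  have h0 : 0 ≤ ‖a • p + b • d‖ ^ 2 := by positivity
  have hp2 : ‖p‖ ^ 2 ≤ α ^ 2 := by gcongr
  have hd2 : ‖d‖ ^ 2 ≤ β ^ 2 := by gcongr
  have h1 : κ * (a ^ 2 * α ^ 2) ≤ ‖a • p + b • d‖ ^ 2 := by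
    have : (κ * (a ^ 2 * α ^ 2)) * β ^ 2 ≤ ‖a • p + b • d‖ ^ 2 * β ^ 2 := by
      calc _ = a ^ 2 * (κ * α ^ 2 * β ^ 2) := by ring
        _ ≤ a ^ 2 * (‖p‖ ^ 2 * ‖d‖ ^ 2 - (inner ℝ p d) ^ 2) := by gcongr
        _ ≤ a ^ 2 * (‖p‖ ^ 2 * ‖d‖ ^ 2 - (inner ℝ p d) ^ 2) +
            (a * inner ℝ p d + b * ‖d‖ ^ 2) ^ 2 := by
              have := sq_nonneg (a * inner ℝ p d + b * ‖d‖ ^ 2)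
              linarith
        _ = ‖a • p + b • d‖ ^ 2 * ‖d‖ ^ 2 := by rw [e]; ring
        _ ≤ _ := by gcongr
    exact le_of_mul_le_mul_right this (by positivity)
  have h2 : κ * (b ^ 2 * β ^ 2) ≤ ‖a • p + b • d‖ ^ 2 := by
    have : (κ * (b ^ 2 * β ^ 2)) * α ^ 2 ≤ ‖a • p + b • d‖ ^ 2 * α ^ 2 := by
      calc _ = b ^ 2 * (κ * α ^ 2 * β ^ 2) := by ring
        _ ≤ b ^ 2 * (‖p‖ ^ 2 * ‖d‖ ^ 2 - (inner ℝ p d) ^ 2) := by gcongr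
        _ ≤ b ^ 2 * (‖p‖ ^ 2 * ‖d‖ ^ 2 - (inner ℝ p d) ^ 2) +
            (b * inner ℝ p d + a * ‖p‖ ^ 2) ^ 2 := by
              have := sq_nonneg (b * inner ℝ p d + a * ‖p‖ ^ 2)
              linarith
        _ = ‖a • p + b • d‖ ^ 2 * ‖p‖ ^ 2 := by rw [e]; ring
        _ ≤ _ := by gcongr
    exact le_of_mul_le_mul_right this (by positivity)
  have h3 : (|a| * α + |b| * β) ^ 2 ≤ 2 * (a ^ 2 * α ^ 2) + 2 * (b ^ 2 * β ^ 2) := by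
    have := sq_nonneg (|a| * α - |b| * β)
    have e1 : (|a| * α) ^ 2 = a ^ 2 * α ^ 2 := by rw [mul_pow, sq_abs]
    have e2 : (|b| * β) ^ 2 = b ^ 2 * β ^ 2 := by rw [mul_pow, sq_abs]
    nlinarith
  calc _ ≤ κ / 4 * (2 * (a ^ 2 * α ^ 2) + 2 * (b ^ 2 * β ^ 2)) := by gcongr
    _ ≤ _ := by linarith

/-- A family of vectors of norm at most `N` cannot have pairwise inner products below
`-N ^ 2 / M`, where `M + 1` is the number of vectors. -/
lemma neg_sq_le_of_inner_le (M : ℕ) (S : Fin (M + 1) → H) {N B : ℝ} (hS : ∀ k, ‖S k‖ ≤ N)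
    (hB : ∀ i k, i < k → inner ℝ (S i) (S k) ≤ B) : -N ^ 2 ≤ M * B := by
  -- This double sum is ‖∑ S i‖². Its M+1 diagonal terms are at most N², its M(M+1) other terms at
  -- most B.
  have h0 : 0 ≤ ∑ i, ∑ k, inner ℝ (S i) (S k) := by
    have : ∑ i, ∑ k, inner ℝ (S i) (S k) = ‖∑ i, S i‖ ^ 2 := by
      rw [← real_inner_self_eq_norm_sq, sum_inner]
      simp_rw [inner_sum]
    rw [this]
    positivity
  have h1 : ∑ i, ∑ k, inner ℝ (S i) (S k) ≤
      ∑ i : Fin (M + 1), ∑ k : Fin (M + 1), ((if i = k then N ^ 2 - B else 0) + B) := by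
    refine Finset.sum_le_sum fun i _ => Finset.sum_le_sum fun k _ => ?_
    rcases lt_trichotomy i k with hik | rfl | hik
    · simpa [hik.ne] using hB i k hik
    · simp only [if_true, sub_add_cancel, real_inner_self_eq_norm_sq]
      have := hS i
      gcongr
    · rw [real_inner_comm]
      simpa [hik.ne'] using hB k i hik
  simp only [Finset.sum_add_distrib, Finset.sum_ite_eq, Finset.mem_univ, if_true,
    Finset.sum_const, Finset.card_univ, Fintype.card_fin, nsmul_eq_mul, Nat.cast_add,
    Nat.cast_one] at h1
  have h2 : 0 ≤ ((M : ℝ) + 1) * (N ^ 2 + M * B) := by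
    calc (0 : ℝ) ≤ _ := h0
      _ ≤ _ := h1
      _ = _ := by ring
  have h3 : 0 ≤ N ^ 2 + M * B := nonneg_of_mul_nonneg_right h2 (by positivity)
  linarith

/-- Let A be the orthogonal projection of d onto the span of p and e. Then ‖A‖² = ⟨d, A⟩ ≤
E(|a|α+|b|β) ≤ E‖A‖/c, and one factor ‖A‖ cancels. -/
lemma exists_orthogonal_combination (d p e : H) {α β E c : ℝ} (hc : 0 < c) (hE : 0 ≤ E)
    (hlow : ∀ a b : ℝ, (c * (|a| * α + |b| * β)) ^ 2 ≤ ‖a • p + b • e‖ ^ 2)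
    (hdp : |inner ℝ d p| ≤ E * α) (hde : |inner ℝ d e| ≤ E * β) :
    ∃ a b : ℝ, inner ℝ (d - (a • p + b • e)) p = 0 ∧ inner ℝ (d - (a • p + b • e)) e = 0 ∧
      ‖a • p + b • e‖ ≤ E / c := by
  let V : Submodule ℝ H := Submodule.span ℝ {p, e}
  have hV : FiniteDimensional ℝ V := FiniteDimensional.span_of_finite ℝ (by simp)
  obtain ⟨a, b, hab⟩ := Submodule.mem_span_pair.1 (V.starProjection_apply_mem d)
  have horth : ∀ v ∈ V, inner ℝ (d - (a • p + b • e)) v = 0 := by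
    intro v hv
    rw [hab]
    exact V.starProjection_inner_eq_zero d v hv
  have hp := horth p (Submodule.subset_span (by simp))
  have he := horth e (Submodule.subset_span (by simp))
  refine ⟨a, b, hp, he, ?_⟩
  have hA := horth (a • p + b • e) (hab ▸ V.starProjection_apply_mem d)
  rw [inner_sub_left, real_inner_self_eq_norm_sq, sub_eq_zero, inner_add_right, inner_smul_right,
    inner_smul_right] at hA
  have h1 : ‖a • p + b • e‖ ^ 2 ≤ (|a| * α + |b| * β) * E := by
    rw [← hA]
    calc a * inner ℝ d p + b * inner ℝ d e ≤ |a| * |inner ℝ d p| + |b| * |inner ℝ d e| := by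
          rw [← abs_mul, ← abs_mul]
          exact add_le_add (le_abs_self _) (le_abs_self _)
      _ ≤ |a| * (E * α) + |b| * (E * β) := by gcongr
      _ = _ := by ring
  have h2 : c * (|a| * α + |b| * β) ≤ ‖a • p + b • e‖ :=
    (abs_le_of_sq_le_sq' (hlow a b) (norm_nonneg _)).2
  rw [le_div_iff₀ hc]
  rcases (norm_nonneg (a • p + b • e)).eq_or_lt with h0 | h0
  · rw [← h0]; simpa using hE
  · refine le_of_mul_le_mul_right ?_ h0
    calc _ = c * ‖a • p + b • e‖ ^ 2 := by ring
      _ ≤ c * ((|a| * α + |b| * β) * E) := by gcongr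
      _ = E * (c * (|a| * α + |b| * β)) := by ring
      _ ≤ _ := by gcongr

end Hilbert

/-! ### Nondegeneracy of the midpoints -/

namespace ConcaveCurve

variable {H : Type*} [NormedAddCommGroup H] [InnerProductSpace ℝ H]
  {x : ℝ → H} {δ : ℝ → ℝ} {κ : ℝ}

lemma norm_shifted_le (h : ConcaveCurve x δ κ) {u w θ : ℝ} (a b : ℝ) (hw : 0 < w)
    (hθ : 0 ≤ θ) (hθu : θ ≤ u) (hu1 : u + w ≤ 1) :
    ‖shifted x a b u w (-θ)‖ ≤ |a| * δ u + |b| * δ w := by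
  have h1 : ‖x (u + -θ)‖ ≤ δ u :=
    (h.norm_le (by linarith) (by linarith)).trans (h.mono (by linarith) (by linarith) (by linarith))
  have h2 : ‖x (u + w + -θ) - x (u + -θ)‖ ≤ δ w := by
    have := h.norm_sub_le (s := u + -θ) (t := u + w + -θ) (by linarith) (by linarith) (by linarith)
    convert this using 2
    ring
  refine (norm_add_le _ _).trans ?_
  rw [norm_smul, norm_smul, Real.norm_eq_abs, Real.norm_eq_abs]
  gcongr

lemma le_norm_shifted (h : ConcaveCurve x δ κ) {u w : ℝ} (a b : ℝ) (hu : 0 < u) (hw : 0 < w)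
    (hu1 : u + w ≤ 1) :
    κ / 4 * (|a| * δ u + |b| * δ w) ^ 2 ≤ ‖shifted x a b u w 0‖ ^ 2 := by
  have hd := h.norm_sub_le (s := u) (t := u + w) (by linarith) (by linarith) (by linarith)
  rw [add_sub_cancel_left] at hd
  have hdet := h.det u (u + w) hu (by linarith) hu1
  rw [add_sub_cancel_left] at hdet
  simp only [shifted, add_zero]
  refine le_norm_combination_sq (h.pos u hu (by linarith)) (h.pos w hw (by linarith)) h.det_pos
    (h.norm_le hu.le (by linarith)) hd (hdet.trans (le_of_eq ?_)) a b
  -- The Gram determinant is unchanged when x(u+w) is replaced by x(u+w) - x(u).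
  rw [norm_sub_sq_real, inner_sub_right, real_inner_self_eq_norm_sq, real_inner_comm]
  ring

/-- Nondegeneracy of the two midpoints, at all scales that are large with respect to `ε`. -/
theorem exists_le_norm_midpoints (h : ConcaveCurve x δ κ) :
    ∃ K : ℝ, 8 ≤ K ∧ ∀ u w ε a b : ℝ, 0 < ε → K * ε ≤ u → K * ε ≤ w → u + w + ε ≤ 1 →
      κ / 32 * (|a| * δ u + |b| * δ w) ^ 2 ≤
        ‖(1 / 2 : ℝ) • (shifted x a b u w 0 + shifted x a b u w ε)‖ ^ 2 := by
  have hκ := h.det_pos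
  -- M ≥ 32/κ makes N²/M at most κN²/32, and q ≤ κ/(36·32) makes the error 36qN² at most κN²/32;
  -- together the inner product I is at least -κN²/16.
  obtain ⟨M, hM⟩ := exists_nat_ge (32 / κ)
  have hM0 : (0 : ℝ) < M := lt_of_lt_of_le (by positivity) hM
  set q : ℝ := min (1 / 8) (κ / 1152) with hqdef
  have hq : 0 < q := by rw [hqdef]; positivity
  have hq8 : q ≤ 1 / 8 := min_le_left _ _
  have hqκ : q ≤ κ / 1152 := min_le_right _ _
  refine ⟨(q ^ (M + 2))⁻¹, ?_, ?_⟩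
  · rw [le_inv_comm₀ (by norm_num) (by positivity)]
    calc q ^ (M + 2) ≤ q ^ 1 := pow_le_pow_of_le_one hq.le (by linarith) (by omega)
      _ ≤ 8⁻¹ := by linarith
  intro u w ε a b hε hKu hKw hu1
  have hKε : 0 < (q ^ (M + 2))⁻¹ * ε := by positivity
  set y := min u w with hy
  set N := |a| * δ u + |b| * δ w with hN
  have hy0 : 0 < y := lt_min (by linarith) (by linarith)
  have hu : 0 < u := by linarith
  have hw : 0 < w := by linarith
  have hεy : ε ≤ q ^ (M + 2) * y := by
    have : (q ^ (M + 2))⁻¹ * ε ≤ y := le_min hKu hKw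
    rwa [inv_mul_le_iff₀ (by positivity)] at this
  set I := inner ℝ (shifted x a b u w 0) (shifted x a b u w ε) with hI
  have hq1 : q ≤ 1 := by linarith
  -- The shifts q^(k+1)·y, 0 ≤ k ≤ M, are geometric, so any later one is at most q times an earlier
  -- one. The choice K = q^(-(M+2)) keeps ε below all of them.
  have key := neg_sq_le_of_inner_le M
    (fun k : Fin (M + 1) => shifted x a b u w (-(q ^ ((k : ℕ) + 1) * y))) (N := N)
    (B := I + 36 * q * N ^ 2)
    (fun k => h.norm_shifted_le a b hw (by positivity) (by
        have : q ^ ((k : ℕ) + 1) ≤ 1 := pow_le_one₀ hq.le hq1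
        have : y ≤ u := min_le_left _ _
        nlinarith) (by linarith))
    (fun i k hik => h.inner_shifted_le hu hw hy hq hq8 hε (by positivity) (by
          have : q ^ ((i : ℕ) + 1) ≤ q ^ 1 := pow_le_pow_of_le_one hq.le hq1 (by omega)
          rw [pow_one] at this
          gcongr) (hεy.trans (by
          gcongr ?_ * _
          exact pow_le_pow_of_le_one hq.le hq1 (by omega))) (by
          rw [← mul_assoc, ← pow_succ']
          gcongr ?_ * _
          exact pow_le_pow_of_le_one hq.le hq1 (by have : (i : ℕ) < k := hik; omega)) hu1 hN)
  have hlow := h.le_norm_shifted a b hu hw (by linarith)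
  rw [← hN] at hlow
  have hN2 : 0 ≤ N ^ 2 := by positivity
  have hIlow : -(κ / 16) * N ^ 2 ≤ I := by
    have h1 : -N ^ 2 ≤ M * (I + κ / 32 * N ^ 2) := by
      refine key.trans ?_
      gcongr
      linarith
    by_contra hcon
    push Not at hcon
    have h2 : M * (I + κ / 32 * N ^ 2) < M * (-(κ / 32) * N ^ 2) := by
      gcongr
      linarith
    have h3 : N ^ 2 * 1 ≤ N ^ 2 * (M * (κ / 32)) := by
      gcongr
      rw [div_le_iff₀ hκ] at hM
      linarith
    linarith
  -- The constant is (1/4)(κ/4 - 2κ/16) = κ/32; the squared norm at shift ε is only used to be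
  -- nonnegative.
  rw [norm_smul, mul_pow, norm_add_sq_real, ← hI]
  have : 0 ≤ ‖shifted x a b u w ε‖ ^ 2 := by positivity
  norm_num
  linarith

end ConcaveCurve

/-! ### Regression of increments on midpoints -/

section Midpoints

variable {H : Type*} [NormedAddCommGroup H] [InnerProductSpace ℝ H]

/-- The midpoint `(x (u + ε) + x u) / 2`. -/
noncomputable def midpt (x : ℝ → H) (ε u : ℝ) : H := (1 / 2 : ℝ) • (x (u + ε) + x u)

/-- The increment `x (u + ε) - x u`. -/
def incr (x : ℝ → H) (ε u : ℝ) : H := x (u + ε) - x u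

/-- Centering at the midpoint removes the quadratic terms in p and p'. Covariances of increments
with midpoints thereby become differences of squared metrics, to which concavity applies. -/
lemma inner_sub_midpoint (p p' r : H) :
    inner ℝ (p' - p) (r - (1 / 2 : ℝ) • (p' + p)) = (‖r - p‖ ^ 2 - ‖r - p'‖ ^ 2) / 2 := by
  simp only [norm_sub_sq_real, inner_sub_left, inner_sub_right, inner_smul_right, inner_add_right,
    real_inner_self_eq_norm_sq]
  rw [real_inner_comm p p', real_inner_comm p r, real_inner_comm p' r]
  ring

lemma inner_incr_midpt (x : ℝ → H) (ε u : ℝ) :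
    inner ℝ (incr x ε u) (midpt x ε u) = (‖x (u + ε)‖ ^ 2 - ‖x u‖ ^ 2) / 2 := by
  have := inner_sub_midpoint (x u) (x (u + ε)) 0
  rw [zero_sub, inner_neg_right, zero_sub, zero_sub, norm_neg, norm_neg] at this
  rw [incr, midpt]
  linarith

lemma inner_incr_midpt_sub (x : ℝ → H) (ε u v : ℝ) :
    inner ℝ (incr x ε u) (midpt x ε v - midpt x ε u) =
      (‖x v - x u‖ ^ 2 - ‖x v - x (u + ε)‖ ^ 2) / 4 +
        (‖x (v + ε) - x u‖ ^ 2 - ‖x (v + ε) - x (u + ε)‖ ^ 2) / 4 := by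
  have e : midpt x ε v - midpt x ε u =
      (1 / 2 : ℝ) • ((x v - midpt x ε u) + (x (v + ε) - midpt x ε u)) := by
    simp only [midpt]
    module
  rw [e, inner_smul_right, inner_add_right, incr, midpt, inner_sub_midpoint, inner_sub_midpoint]
  ring

lemma half_shifted_add (x : ℝ → H) (a b u w ε : ℝ) :
    (1 / 2 : ℝ) •
        (ConcaveCurve.shifted x a b u w 0 + ConcaveCurve.shifted x a b u w ε) =
      a • midpt x ε u + b • (midpt x ε (u + w) - midpt x ε u) := by
  simp only [ConcaveCurve.shifted, midpt, add_zero]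
  module

end Midpoints

namespace ConcaveCurve

variable {H : Type*} [NormedAddCommGroup H] [InnerProductSpace ℝ H]
  {x : ℝ → H} {δ : ℝ → ℝ} {κ : ℝ}

lemma abs_inner_incr_midpt_le (h : ConcaveCurve x δ κ) {u v y ε : ℝ} (hy : 0 < y) (hyu : y ≤ u)
    (huv : u ≤ v) (hε : 0 < ε) (hv : v + ε ≤ 1) :
    |inner ℝ (incr x ε v) (midpt x ε v)| ≤ ε * (δ y / y) * δ u := by
  rw [inner_incr_midpt, abs_div, abs_two]
  have h1 := h.incr_norm (t := v) (t' := v + ε) (by linarith) (by linarith) hv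
  have h2 := h.sq_div_anti (r := u) (s := v) (by linarith) huv (by linarith)
  have h3 := h.div_anti hy hyu (by linarith)
  have h4 := h.pos u (by linarith) (by linarith)
  have h5 : δ v / v * δ v ≤ δ y / y * δ u := h2.trans (by gcongr)
  have h6 : 0 < δ y / y * δ u := by have := h.pos y hy (by linarith); positivity
  rw [add_sub_cancel_left] at h1
  have h7 : ε * (δ v / v * δ v) ≤ ε * (δ y / y * δ u) := by gcongr
  have h8 : 0 < ε * (δ y / y * δ u) := by positivity
  linarith

/-- Here the left time moves from u to u+ε with the right time fixed at u+w or u+w+ε, so `incr_left`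
applies twice; w ≥ 2ε is its half-distance condition. -/
lemma abs_inner_incr_left_le (h : ConcaveCurve x δ κ) {u w y ε : ℝ} (hu : 0 < u) (hw : 0 < w)
    (hy : y = min u w) (hε : 0 < ε) (hεw : 2 * ε ≤ w) (hv : u + w + ε ≤ 1) :
    |inner ℝ (incr x ε u) (midpt x ε (u + w) - midpt x ε u)| ≤ 3 * ε * (δ y / y) * δ w := by
  have hy0 : 0 < y := by rw [hy]; exact lt_min hu hw
  have hyu : y ≤ u := hy ▸ min_le_left _ _
  have hyw : y ≤ w := hy ▸ min_le_right _ _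
  have hδw := h.pos w hw (by linarith)
  have hδy := h.pos y hy0 (by linarith)
  have aux : ∀ t, u + w ≤ t → t ≤ u + w + ε →
      |‖x t - x u‖ ^ 2 - ‖x t - x (u + ε)‖ ^ 2| ≤ 6 * ε * (δ y / y) * δ w := by
    intro t ht ht'
    rw [abs_sub_comm]
    refine (h.incr_left (s := u) (s' := u + ε) (t := t) hu (by linarith) (by linarith)
      (by linarith) (by linarith) rfl).trans ?_
    have hym : y ≤ min u (t - u) := le_min hyu (by linarith)
    have hm1 : min u (t - u) ≤ 1 := (min_le_left _ _).trans (by linarith)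
    have h1 := h.div_anti hy0 hym hm1
    have h2 : δ (t - u) ≤ 2 * δ w := h.two_mul_le hw (by linarith) (by linarith) (by linarith)
      (by linarith)
    have h3 := h.pos (t - u) (by linarith) (by linarith)
    rw [add_sub_cancel_left]
    calc _ ≤ 3 * ε * (δ y / y * (2 * δ w)) := by gcongr
      _ = _ := by ring
  have h1 := aux (u + w) le_rfl (by linarith)
  have h2 := aux (u + w + ε) (by linarith) le_rfl
  rw [inner_incr_midpt_sub]
  refine (abs_add_le _ _).trans ?_
  rw [abs_div, abs_div, abs_of_pos (by norm_num : (0 : ℝ) < 4)]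
  linarith

/-- Here only the right time moves, so `incr_right` applies at a distance of at least w/2. -/
lemma abs_inner_incr_right_le (h : ConcaveCurve x δ κ) {u w y ε : ℝ} (hu : 0 < u) (hw : 0 < w)
    (hε : 0 < ε) (hεw : 2 * ε ≤ w) (hv : u + w + ε ≤ 1) (hy : 0 < y) (hyw : y ≤ w) :
    |inner ℝ (incr x ε (u + w)) (midpt x ε (u + w) - midpt x ε u)| ≤ ε * (δ y / y) * δ y := by
  have hδw := h.pos w hw (by linarith)
  have hδy := h.pos y hy (by linarith)
  have aux : ∀ s, u ≤ s → s ≤ u + ε →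
      |‖x s - x (u + w)‖ ^ 2 - ‖x s - x (u + w + ε)‖ ^ 2| ≤ 2 * (ε * (δ y / y) * δ y) := by
    intro s hs hs'
    rw [abs_sub_comm, norm_sub_rev (x s), norm_sub_rev (x s)]
    refine (h.incr_right (s := s) (t := u + w) (t' := u + w + ε) (by linarith) (by linarith)
      (by linarith) hv).trans ?_
    rw [add_sub_cancel_left]
    have h1 := h.sq_div_anti (r := w / 2) (s := u + w - s) (by linarith) (by linarith)
      (by linarith)
    have h2 := h.sq_div_anti (r := y) (s := w) hy hyw (by linarith)
    have h3 := h.mono (r := w / 2) (s := w) (by linarith) (by linarith) (by linarith)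
    have h4 := h.pos (w / 2) (by linarith) (by linarith)
    calc ε * (δ (u + w - s) / (u + w - s) * δ (u + w - s))
        ≤ ε * (δ (w / 2) / (w / 2) * δ (w / 2)) := by gcongr
      _ ≤ ε * (δ w / (w / 2) * δ w) := by gcongr
      _ = 2 * (ε * (δ w / w * δ w)) := by field_simp
      _ ≤ 2 * (ε * (δ y / y * δ y)) := by gcongr
      _ = _ := by ring
  have h1 := aux u le_rfl (by linarith)
  have h2 := aux (u + ε) (by linarith) le_rfl
  rw [← neg_sub, inner_neg_right, abs_neg, inner_incr_midpt_sub]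
  refine (abs_add_le _ _).trans ?_
  rw [abs_div, abs_div, abs_of_pos (by norm_num : (0 : ℝ) < 4)]
  have : 0 < ε * (δ y / y) * δ y := by positivity
  linarith

/-- The regressions of the increments at `u` and `u + w` on the midpoints at `u` and `u + w`. -/
theorem exists_regression (h : ConcaveCurve x δ κ) :
    ∃ K C : ℝ, 8 ≤ K ∧ 0 < C ∧ ∀ u w ε : ℝ, 0 < ε → K * ε ≤ u → K * ε ≤ w → u + w + ε ≤ 1 →
      ∀ d, d = incr x ε u ∨ d = incr x ε (u + w) → ∃ a b : ℝ,
        inner ℝ (d - (a • midpt x ε u + b • midpt x ε (u + w))) (midpt x ε u) = 0 ∧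
        inner ℝ (d - (a • midpt x ε u + b • midpt x ε (u + w))) (midpt x ε (u + w)) = 0 ∧
        ‖a • midpt x ε u + b • midpt x ε (u + w)‖ ≤ C * ε * (δ (min u w) / min u w) := by
  obtain ⟨K, hK, hlow⟩ := h.exists_le_norm_midpoints
  have hκ := h.det_pos
  have hc : 0 < √(κ / 32) := by positivity
  refine ⟨K, 3 / √(κ / 32), hK, by positivity, ?_⟩
  intro u w ε hε hKu hKw hv d hd
  have h8 : 8 * ε ≤ K * ε := by gcongr
  have hu : 0 < u := by linarith
  have hw : 0 < w := by linarith
  set y := min u w with hy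
  have hy0 : 0 < y := lt_min hu hw
  have hyu : y ≤ u := min_le_left _ _
  have hyw : y ≤ w := min_le_right _ _
  have hδw := h.pos w hw (by linarith)
  have hδu := h.pos u hu (by linarith)
  have hδy := h.pos y hy0 (by linarith)
  have hδyu := h.mono hy0.le hyu (by linarith)
  have hδyw := h.mono hy0.le hyw (by linarith)
  -- The bounds are scaled by δ(u) and δ(w), the same weights as in the nondegeneracy estimate, so
  -- that they cancel in the projection bound.
  have hE : |inner ℝ d (midpt x ε u)| ≤ 3 * ε * (δ y / y) * δ u ∧
      |inner ℝ d (midpt x ε (u + w) - midpt x ε u)| ≤ 3 * ε * (δ y / y) * δ w := by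
    have hp : 0 < ε * (δ y / y) * δ u := by positivity
    rcases hd with rfl | rfl
    · refine ⟨?_, h.abs_inner_incr_left_le hu hw hy hε (by linarith) hv⟩
      have := h.abs_inner_incr_midpt_le (u := u) (v := u) hy0 hyu le_rfl hε (by linarith)
      linarith
    · have h1 := h.abs_inner_incr_midpt_le (u := u) (v := u + w) hy0 hyu (by linarith) hε hv
      have h2 := h.abs_inner_incr_right_le hu hw hε (by linarith) hv hy0 hyw
      have h3 : ε * (δ y / y) * δ y ≤ ε * (δ y / y) * δ u := by gcongr
      have h4 : ε * (δ y / y) * δ y ≤ ε * (δ y / y) * δ w := by gcongr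
      have hp' : 0 < ε * (δ y / y) * δ w := by positivity
      refine ⟨?_, by linarith⟩
      have e : midpt x ε u = midpt x ε (u + w) - (midpt x ε (u + w) - midpt x ε u) := by abel
      rw [e, inner_sub_right]
      refine (abs_sub _ _).trans ?_
      linarith
  obtain ⟨a, b, h1, h2, h3⟩ := exists_orthogonal_combination d (midpt x ε u)
    (midpt x ε (u + w) - midpt x ε u) (α := δ u) (β := δ w) (E := 3 * ε * (δ y / y)) hc
    (by positivity) (fun a b => by
      rw [mul_pow, Real.sq_sqrt (by positivity), ← half_shifted_add]
      exact hlow u w ε a b hε hKu hKw hv) hE.1 hE.2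
  have e : a • midpt x ε u + b • (midpt x ε (u + w) - midpt x ε u) =
      (a - b) • midpt x ε u + b • midpt x ε (u + w) := by module
  rw [e] at h1 h2 h3
  refine ⟨a - b, b, h1, ?_, h3.trans (le_of_eq (by ring))⟩
  rw [inner_sub_right, h1, sub_zero] at h2
  exact h2

end ConcaveCurve

/-! ### Moments of centered Gaussian variables -/

section Moments

variable {Ω : Type*} [MeasurableSpace Ω] {P : Measure Ω}

/-- Membership in `L^p` for all finite `p`. -/
def AllMoments (P : Measure Ω) (f : Ω → ℝ) : Prop := ∀ p : ENNReal, p ≠ ⊤ → MemLp f p P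

namespace AllMoments

lemma mul {f g : Ω → ℝ} (hf : AllMoments P f) (hg : AllMoments P g) :
    AllMoments P (fun ω => f ω * g ω) := by
  intro p hp
  have : ENNReal.HolderTriple (2 * p) (2 * p) p := ⟨by
    rw [ENNReal.mul_inv (Or.inl (by norm_num)) (Or.inl (by norm_num)), ← add_mul,
      ENNReal.inv_two_add_inv_two, one_mul]⟩
  have h2 : 2 * p ≠ ⊤ := ENNReal.mul_ne_top (by norm_num) hp
  exact MemLp.mul (hg (2 * p) h2) (hf (2 * p) h2)

lemma const [IsFiniteMeasure P] (c : ℝ) : AllMoments P (fun _ => c) := fun _ _ => memLp_const c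

lemma pow [IsFiniteMeasure P] {f : Ω → ℝ} (hf : AllMoments P f) (n : ℕ) :
    AllMoments P (fun ω => f ω ^ n) := by
  induction n with
  | zero => simpa using AllMoments.const (P := P) 1
  | succ n ih => simpa [pow_succ] using ih.mul hf

lemma abs {f : Ω → ℝ} (hf : AllMoments P f) : AllMoments P (fun ω => |f ω|) :=
  fun p hp => (hf p hp).abs

lemma integrable {f : Ω → ℝ} (hf : AllMoments P f) : Integrable f P :=
  memLp_one_iff_integrable.1 (hf 1 (by norm_num))

lemma of_bound [IsFiniteMeasure P] {f : Ω → ℝ} (hf : AEStronglyMeasurable f P) {C : ℝ}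
    (h : ∀ ω, |f ω| ≤ C) : AllMoments P f :=
  fun _ _ => MemLp.of_bound hf C (ae_of_all _ h)

lemma integral_abs_mul_le {f g : Ω → ℝ} (hf : AllMoments P f) (hg : AllMoments P g) :
    ∫ ω, |f ω| * |g ω| ∂P ≤ √(∫ ω, f ω ^ 2 ∂P) * √(∫ ω, g ω ^ 2 ∂P) := by
  have h := integral_mul_norm_le_Lp_mul_Lq (μ := P) (f := f) (g := g) (p := 2) (q := 2)
    (by constructor <;> norm_num) (hf _ (by simp)) (hg _ (by simp))
  simpa [Real.sqrt_eq_rpow] using h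

end AllMoments

/-- The absolute moments of the standard Gaussian law. -/
noncomputable def gaussMoment (p : ℕ) : ℝ := ∫ x, |x| ^ p ∂(gaussianReal 0 1)

lemma gaussMoment_nonneg (p : ℕ) : 0 ≤ gaussMoment p := integral_nonneg fun _ => by positivity

variable [IsProbabilityMeasure P] {Z : Ω → ℝ}

lemma _root_.ProbabilityTheory.HasGaussianLaw.allMoments (hZ : HasGaussianLaw Z P) :
    AllMoments P Z := fun _ hp => hZ.memLp hp

lemma map_eq_of_centered (hZ : HasGaussianLaw Z P) (h0 : ∫ ω, Z ω ∂P = 0) :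
    P.map Z = (gaussianReal 0 1).map (fun x => √(∫ ω, Z ω ^ 2 ∂P) * x) := by
  rw [hZ.map_eq_gaussianReal, h0, variance_of_integral_eq_zero hZ.aemeasurable h0,
    gaussianReal_map_const_mul, mul_zero, mul_one]
  congr 1
  ext
  have : 0 ≤ ∫ ω, Z ω ^ 2 ∂P := integral_nonneg fun _ => by positivity
  rw [Real.coe_toNNReal _ this]
  exact (Real.sq_sqrt this).symm

lemma integral_abs_pow (hZ : HasGaussianLaw Z P) (h0 : ∫ ω, Z ω ∂P = 0) (p : ℕ) :
    ∫ ω, |Z ω| ^ p ∂P = gaussMoment p * √(∫ ω, Z ω ^ 2 ∂P) ^ p := by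
  have h1 : ∫ ω, |Z ω| ^ p ∂P = ∫ x, |x| ^ p ∂(P.map Z) :=
    (integral_map (f := fun x : ℝ => |x| ^ p) hZ.aemeasurable
      (by fun_prop)).symm
  rw [h1, map_eq_of_centered hZ h0, integral_map (by fun_prop) (by fun_prop), gaussMoment,
    ← integral_mul_const]
  congr 1
  ext x
  rw [abs_mul, mul_pow, abs_of_nonneg (Real.sqrt_nonneg _)]
  ring

lemma integral_abs_pow_le (hZ : HasGaussianLaw Z P) (h0 : ∫ ω, Z ω ∂P = 0) (p : ℕ) {s : ℝ}
    (hs : 0 ≤ s) (hZs : ∫ ω, Z ω ^ 2 ∂P ≤ s ^ 2) :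
    ∫ ω, |Z ω| ^ p ∂P ≤ gaussMoment p * s ^ p := by
  rw [integral_abs_pow hZ h0]
  have := gaussMoment_nonneg p
  gcongr
  exact Real.sqrt_le_iff.2 ⟨hs, hZs⟩

lemma abs_integral_pow_le (hZ : HasGaussianLaw Z P) (h0 : ∫ ω, Z ω ∂P = 0) (p : ℕ) {s : ℝ}
    (hs : 0 ≤ s) (hZs : ∫ ω, Z ω ^ 2 ∂P ≤ s ^ 2) :
    |∫ ω, Z ω ^ p ∂P| ≤ gaussMoment p * s ^ p := by
  refine abs_integral_le_integral_abs.trans ?_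
  simp_rw [abs_pow]
  exact integral_abs_pow_le hZ h0 p hs hZs

lemma integral_odd_pow (hZ : HasGaussianLaw Z P) (h0 : ∫ ω, Z ω ∂P = 0) {p : ℕ} (hp : Odd p) :
    ∫ ω, Z ω ^ p ∂P = 0 := by
  have h1 : ∫ ω, Z ω ^ p ∂P = ∫ x, x ^ p ∂(P.map Z) :=
    (integral_map (f := fun x : ℝ => x ^ p) hZ.aemeasurable (by fun_prop)).symm
  have h2 : (P.map Z).map (fun x => -x) = P.map Z := by
    rw [hZ.map_eq_gaussianReal, h0, gaussianReal_map_neg, neg_zero]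
  have h3 : ∫ x, x ^ p ∂(P.map Z) = -∫ x, x ^ p ∂(P.map Z) := by
    conv_lhs => rw [← h2]
    rw [integral_map (by fun_prop) (by fun_prop), ← integral_neg]
    simp_rw [hp.neg_pow]
  rw [h1]
  linarith

/-- Cauchy–Schwarz decouples the two variables, so joint Gaussianity is not needed. -/
lemma integral_abs_pow_mul_abs_pow_le {W : Ω → ℝ} (hZ : HasGaussianLaw Z P)
    (h0 : ∫ ω, Z ω ∂P = 0) (hW : HasGaussianLaw W P) (h0' : ∫ ω, W ω ∂P = 0) (p q : ℕ) {s t : ℝ}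
    (hs : 0 ≤ s) (hZs : ∫ ω, Z ω ^ 2 ∂P ≤ s ^ 2) (ht : 0 ≤ t) (hWt : ∫ ω, W ω ^ 2 ∂P ≤ t ^ 2) :
    ∫ ω, |Z ω| ^ p * |W ω| ^ q ∂P ≤
      √(gaussMoment (2 * p)) * √(gaussMoment (2 * q)) * (s ^ p * t ^ q) := by
  have aux : ∀ {U : Ω → ℝ} {r : ℝ} (n : ℕ), HasGaussianLaw U P → ∫ ω, U ω ∂P = 0 → 0 ≤ r →
      ∫ ω, U ω ^ 2 ∂P ≤ r ^ 2 →
      √(∫ ω, (U ω ^ n) ^ 2 ∂P) ≤ √(gaussMoment (2 * n)) * r ^ n := by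
    intro U r n hU hU0 hr hUr
    rw [Real.sqrt_le_iff]
    refine ⟨by positivity, ?_⟩
    rw [mul_pow, Real.sq_sqrt (gaussMoment_nonneg _), ← pow_mul, mul_comm n 2]
    refine le_trans (le_of_eq ?_) (integral_abs_pow_le hU hU0 (2 * n) hr hUr)
    congr 1
    ext ω
    rw [← abs_pow, ← pow_mul, mul_comm n 2, pow_mul, abs_of_nonneg (by positivity)]
  have h := (hZ.allMoments.pow p).integral_abs_mul_le (hW.allMoments.pow q)
  simp only [abs_pow] at h
  refine h.trans ?_
  calc _ ≤ (√(gaussMoment (2 * p)) * s ^ p) * (√(gaussMoment (2 * q)) * t ^ q) := by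
        gcongr
        · exact aux p hZ h0 hs hZs
        · exact aux q hW h0' ht hWt
    _ = _ := by ring

end Moments

/-! ### Jointly Gaussian linear families and parity of their moments -/

section LinearFamily

variable {Ω : Type*} [MeasurableSpace Ω] {P : Measure Ω} [IsProbabilityMeasure P]
  {V : Type*} [AddCommGroup V] [Module ℝ V]

/-- A linear family of jointly Gaussian centered random variables. -/
structure CenteredGaussianFamily (P : Measure Ω) (Y : V →ₗ[ℝ] (Ω → ℝ)) : Prop where
  gauss : IsGaussianProcess (fun v => Y v) P
  centered : ∀ v, ∫ ω, Y v ω ∂P = 0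

/-- The covariance of two members of a centered Gaussian family. -/
noncomputable def famCov (P : Measure Ω) (Y : V →ₗ[ℝ] (Ω → ℝ)) (v w : V) : ℝ :=
  ∫ ω, Y v ω * Y w ω ∂P

namespace CenteredGaussianFamily

variable {Y : V →ₗ[ℝ] (Ω → ℝ)}

lemma law (hY : CenteredGaussianFamily P Y) (v : V) : HasGaussianLaw (Y v) P :=
  hY.gauss.hasGaussianLaw_eval v

lemma allMoments (hY : CenteredGaussianFamily P Y) (v : V) : AllMoments P (Y v) :=
  (hY.law v).allMoments

lemma covariance_eq (hY : CenteredGaussianFamily P Y) (v w : V) :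
    cov[Y v, Y w; P] = famCov P Y v w := by
  rw [covariance_eq_sub (hY.law v).memLp_two (hY.law w).memLp_two, hY.centered, zero_mul, sub_zero]
  rfl

lemma famCov_comm (v w : V) : famCov P Y v w = famCov P Y w v := by
  simp only [famCov, mul_comm]

lemma famCov_self (v : V) : famCov P Y v v = ∫ ω, Y v ω ^ 2 ∂P := by
  simp only [famCov, sq]

lemma famCov_sub_smul (hY : CenteredGaussianFamily P Y) (u v w : V) (c : ℝ) :
    famCov P Y (u - c • v) w = famCov P Y u w - c * famCov P Y v w := by
  have h1 := ((hY.allMoments u).mul (hY.allMoments w)).integrable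
  have h2 := ((hY.allMoments v).mul (hY.allMoments w)).integrable
  simp only [famCov, map_sub, map_smul, Pi.sub_apply, Pi.smul_apply, smul_eq_mul]
  rw [← integral_const_mul, ← integral_sub h1 (h2.const_mul c)]
  congr 1
  ext ω
  ring

lemma abs_famCov_le (hY : CenteredGaussianFamily P Y) (v w : V) :
    |famCov P Y v w| ≤ √(famCov P Y v v) * √(famCov P Y w w) := by
  rw [famCov_self, famCov_self]
  refine le_trans ?_ ((hY.allMoments v).integral_abs_mul_le (hY.allMoments w))
  refine abs_integral_le_integral_abs.trans (le_of_eq ?_)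
  simp_rw [abs_mul]

lemma indepFun_pair (hY : CenteredGaussianFamily P Y) {r s p q : V} (h1 : famCov P Y r p = 0)
    (h2 : famCov P Y r q = 0) (h3 : famCov P Y s p = 0) (h4 : famCov P Y s q = 0) :
    IndepFun (fun ω => (Y r ω, Y s ω)) (fun ω => (Y p ω, Y q ω)) P := by
  have h := IsGaussianProcess.indepFun_of_covariance_eq_zero (P := P)
    (X := fun i : Fin 2 => Y (![r, s] i)) (Y := fun i : Fin 2 => Y (![p, q] i)) (by
      have e : Sum.elim (fun i : Fin 2 => Y (![r, s] i)) (fun i : Fin 2 => Y (![p, q] i)) =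
          (fun v => Y v) ∘ Sum.elim ![r, s] ![p, q] := by
        funext i
        rcases i with i | i <;> rfl
      rw [e]
      exact hY.gauss.comp_right _)
    (fun i => (hY.law _).aemeasurable) (fun i => (hY.law _).aemeasurable) (fun i j => by
      rw [hY.covariance_eq]
      fin_cases i <;> fin_cases j <;> simpa)
  exact h.comp (φ := fun f : Fin 2 → ℝ => (f 0, f 1)) (ψ := fun f : Fin 2 → ℝ => (f 0, f 1))
    (by fun_prop) (by fun_prop)

lemma indepFun (hY : CenteredGaussianFamily P Y) {r s : V} (h : famCov P Y r s = 0) :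
    IndepFun (Y r) (Y s) P :=
  hY.gauss.hasGaussianLaw_prodMk.indepFun_of_covariance_eq_zero (by rw [hY.covariance_eq, h])

end CenteredGaussianFamily

end LinearFamily

namespace CenteredGaussianFamily

variable {Ω : Type*} [MeasurableSpace Ω] {P : Measure Ω} [IsProbabilityMeasure P]
  {V : Type*} [AddCommGroup V] [Module ℝ V] {Y : V →ₗ[ℝ] (Ω → ℝ)}

lemma famCov_nonneg (v : V) : 0 ≤ famCov P Y v v :=
  integral_nonneg fun _ => mul_self_nonneg _

/-- If r has variance zero, the quotient is 0 by convention, and the covariance vanishes by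
Cauchy–Schwarz. -/
lemma regression_orthogonal (hY : CenteredGaussianFamily P Y) (r s : V) :
    famCov P Y r (s - (famCov P Y r s / famCov P Y r r) • r) = 0 := by
  rw [famCov_comm, hY.famCov_sub_smul, famCov_comm s r]
  rcases eq_or_ne (famCov P Y r r) 0 with h | h
  · have := hY.abs_famCov_le r s
    rw [h, Real.sqrt_zero, zero_mul] at this
    rw [abs_nonpos_iff.1 this]
    simp
  · rw [div_mul_cancel₀ _ h, sub_self]

/-- Expand s = ρr + (s-ρr) by the binomial theorem; the remainder is independent of r. -/
lemma integral_pow_mul_pow_eq (hY : CenteredGaussianFamily P Y) (r s : V) (k l : ℕ) {ρ : ℝ}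
    (hρ : famCov P Y r (s - ρ • r) = 0) :
    ∫ ω, Y r ω ^ k * Y s ω ^ l ∂P = ∑ j ∈ Finset.range (l + 1),
      l.choose j * ρ ^ j * ((∫ ω, Y r ω ^ (k + j) ∂P) * ∫ ω, Y (s - ρ • r) ω ^ (l - j) ∂P) := by
  have hind := hY.indepFun hρ
  have e : ∀ ω, Y r ω ^ k * Y s ω ^ l = ∑ j ∈ Finset.range (l + 1),
      l.choose j * ρ ^ j * (Y r ω ^ (k + j) * Y (s - ρ • r) ω ^ (l - j)) := by
    intro ω
    have : Y s ω = ρ * Y r ω + Y (s - ρ • r) ω := by simp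
    rw [this, add_pow, Finset.mul_sum]
    refine Finset.sum_congr rfl fun j _ => ?_
    ring
  simp_rw [e]
  rw [integral_finsetSum]
  · refine Finset.sum_congr rfl fun j _ => ?_
    rw [integral_const_mul]
    congr 1
    exact (hind.comp (measurable_id.pow_const (k + j))
      (measurable_id.pow_const (l - j))).integral_fun_mul_eq_mul_integral
      ((hY.allMoments r).pow _).integrable.aestronglyMeasurable
      ((hY.allMoments _).pow _).integrable.aestronglyMeasurable
  · intro j _
    exact (((hY.allMoments _).pow _).mul ((hY.allMoments _).pow _)).integrable.const_mul _

/-- In every term of the expansion one of the exponents k+j and l-j is odd. -/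
lemma integral_pow_mul_pow_eq_zero (hY : CenteredGaussianFamily P Y) (r s : V) {k l : ℕ}
    (hkl : Odd (k + l)) : ∫ ω, Y r ω ^ k * Y s ω ^ l ∂P = 0 := by
  rw [hY.integral_pow_mul_pow_eq r s k l (hY.regression_orthogonal r s)]
  refine Finset.sum_eq_zero fun j hj => ?_
  have hj' : j ≤ l := by simpa [Nat.lt_succ_iff] using hj
  rcases Nat.even_or_odd (k + j) with h | h
  · have : Odd (l - j) := by
      by_contra hcon
      rw [Nat.not_odd_iff_even] at hcon
      have h2 := h.add hcon
      rw [show k + j + (l - j) = k + l by omega] at h2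
      exact (Nat.not_even_iff_odd.2 hkl) h2
    rw [integral_odd_pow (hY.law _) (hY.centered _) this]
    ring
  · rw [integral_odd_pow (hY.law _) (hY.centered _) h]
    ring

/-- The constant in the bound for joint odd moments of two Gaussian variables. -/
noncomputable def oddMomentConst (k l : ℕ) : ℝ :=
  ∑ j ∈ Finset.range (l + 1), l.choose j * gaussMoment (k + j) * gaussMoment (l - j)

lemma oddMomentConst_nonneg (k l : ℕ) : 0 ≤ oddMomentConst k l :=
  Finset.sum_nonneg fun _ _ => by
    have := gaussMoment_nonneg
    exact mul_nonneg (mul_nonneg (by positivity) (this _)) (this _)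

/-- In the expansion along r, the term j = 0 vanishes because k is odd. Every other term contains
|ρ| and at least two factors σ, and |ρ|σ² is at most the absolute covariance; the remaining |ρ|σ and
σ are at most t. -/
lemma abs_integral_pow_mul_pow_le_of_odd (hY : CenteredGaussianFamily P Y) (r s : V) {k : ℕ}
    (hk : Odd k) (l : ℕ) {t : ℝ} (ht : 0 ≤ t) (hr : famCov P Y r r ≤ t ^ 2)
    (hs : famCov P Y s s ≤ t ^ 2) :
    |∫ ω, Y r ω ^ k * Y s ω ^ l ∂P| ≤ oddMomentConst k l * |famCov P Y r s| * t ^ (k + l - 2) := by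
  set ρ := famCov P Y r s / famCov P Y r r with hρ
  have horth := hY.regression_orthogonal r s
  rw [← hρ] at horth
  set σ := √(famCov P Y r r) with hσ
  have hσ0 : 0 ≤ σ := Real.sqrt_nonneg _
  have hσ2 : σ ^ 2 = famCov P Y r r := Real.sq_sqrt (famCov_nonneg r)
  have hσt : σ ≤ t := Real.sqrt_le_iff.2 ⟨ht, hr⟩
  have hcs := hY.abs_famCov_le r s
  have hst : √(famCov P Y s s) ≤ t := Real.sqrt_le_iff.2 ⟨ht, hs⟩
  have h1 : |ρ| * σ ^ 2 ≤ |famCov P Y r s| := by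
    rw [hσ2, hρ, abs_div, abs_of_nonneg (famCov_nonneg r)]
    rcases eq_or_ne (famCov P Y r r) 0 with h | h
    · simp [h]
    · rw [div_mul_cancel₀ _ h]
  have h2 : |ρ| * σ ≤ t := by
    rw [hρ, abs_div, abs_of_nonneg (famCov_nonneg r), ← hσ2, div_mul_eq_mul_div]
    refine div_le_of_le_mul₀ (by positivity) ht ?_
    calc |famCov P Y r s| * σ ≤ (σ * √(famCov P Y s s)) * σ := by gcongr
      _ ≤ (σ * t) * σ := by gcongr
      _ = _ := by ring
  have hT : famCov P Y (s - ρ • r) (s - ρ • r) ≤ t ^ 2 := by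
    have e : famCov P Y (s - ρ • r) (s - ρ • r) = famCov P Y s s - ρ ^ 2 * σ ^ 2 := by
      have e1 := hY.famCov_sub_smul s r (s - ρ • r) ρ
      rw [horth, mul_zero, sub_zero] at e1
      rw [e1, famCov_comm, hY.famCov_sub_smul, hσ2]
      have e2 := horth
      rw [famCov_comm, hY.famCov_sub_smul, famCov_comm s r, sub_eq_zero] at e2
      rw [e2]
      ring
    rw [e]
    have : 0 ≤ ρ ^ 2 * σ ^ 2 := by positivity
    linarith
  rw [hY.integral_pow_mul_pow_eq r s k l horth, oddMomentConst, Finset.sum_mul, Finset.sum_mul]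
  refine (Finset.abs_sum_le_sum_abs _ _).trans (Finset.sum_le_sum fun j hj => ?_)
  have hj' : j ≤ l := by simpa [Nat.lt_succ_iff] using hj
  have hgk := gaussMoment_nonneg (k + j)
  have hgl := gaussMoment_nonneg (l - j)
  rcases Nat.eq_zero_or_pos j with rfl | hj0
  · rw [Nat.add_zero, integral_odd_pow (hY.law _) (hY.centered _) hk]
    simp only [zero_mul, mul_zero, abs_zero]
    positivity
  have hk0 : 1 ≤ k := hk.pos
  have m1 := abs_integral_pow_le (hY.law r) (hY.centered r) (k + j) hσ0
    (by rw [hσ2, famCov_self])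
  have m2 := abs_integral_pow_le (hY.law (s - ρ • r)) (hY.centered _) (l - j) ht
    (by rw [← famCov_self]; exact hT)
  rw [abs_mul, abs_mul, abs_mul, abs_pow, Nat.abs_cast]
  calc _ ≤ l.choose j * |ρ| ^ j * ((gaussMoment (k + j) * σ ^ (k + j)) *
        (gaussMoment (l - j) * t ^ (l - j))) := by gcongr
    _ = l.choose j * gaussMoment (k + j) * gaussMoment (l - j) *
        ((|ρ| * σ ^ 2) * (|ρ| * σ) ^ (j - 1) * σ ^ (k - 1) * t ^ (l - j)) := by
          obtain ⟨j, rfl⟩ := Nat.exists_eq_add_of_le' hj0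
          obtain ⟨k, rfl⟩ := Nat.exists_eq_add_of_le' hk0
          simp only [Nat.add_sub_cancel]
          ring
    _ ≤ l.choose j * gaussMoment (k + j) * gaussMoment (l - j) *
        (|famCov P Y r s| * t ^ (j - 1) * t ^ (k - 1) * t ^ (l - j)) := by gcongr
    _ = _ := by
        rw [show k + l - 2 = (j - 1) + (k - 1) + (l - j) by omega, pow_add, pow_add]
        ring

lemma abs_integral_pow_mul_pow_le (hY : CenteredGaussianFamily P Y) (r s : V) (k l : ℕ)
    {t t' : ℝ} (ht : 0 ≤ t) (hr : famCov P Y r r ≤ t ^ 2) (ht' : 0 ≤ t')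
    (hs : famCov P Y s s ≤ t' ^ 2) :
    ∫ ω, |Y r ω| ^ k * |Y s ω| ^ l ∂P ≤
      √(gaussMoment (2 * k)) * √(gaussMoment (2 * l)) * (t ^ k * t' ^ l) :=
  integral_abs_pow_mul_abs_pow_le (hY.law r) (hY.centered r) (hY.law s) (hY.centered s) k l ht
    (by rwa [← famCov_self]) ht' (by rwa [← famCov_self])

/-- The constant in `abs_integral_weighted_le`. -/
noncomputable def weightedConst (m : ℕ) : ℝ :=
  ∑ k ∈ Finset.range (m + 1), ∑ l ∈ Finset.range (m + 1), m.choose k * m.choose l *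
    (√(gaussMoment (2 * (m - k))) * √(gaussMoment (2 * (m - l)))) *
      (oddMomentConst k l + √(gaussMoment (2 * k)) * √(gaussMoment (2 * l)))

lemma weightedConst_nonneg (m : ℕ) : 0 ≤ weightedConst m :=
  Finset.sum_nonneg fun k _ => Finset.sum_nonneg fun l _ => by
    have := oddMomentConst_nonneg k l
    positivity

/-- If `r`, `s` are uncorrelated with `p`, `q`, and `α`, `β` are combinations of `p` and `q`,
then the weighted moment of order `(m, m)` of `α + r` and `β + s` is of second order. -/
theorem abs_integral_weighted_le (hY : CenteredGaussianFamily P Y) {m : ℕ} (hm : Odd m)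
    {r s p q α β : V} (h1 : famCov P Y r p = 0)
    (h2 : famCov P Y r q = 0) (h3 : famCov P Y s p = 0) (h4 : famCov P Y s q = 0)
    {a₁ b₁ a₂ b₂ : ℝ} (hα : α = a₁ • p + b₁ • q) (hβ : β = a₂ • p + b₂ • q)
    {t a b B : ℝ} (ht : 0 ≤ t) (ha : 0 ≤ a) (hb : 0 ≤ b) (hat : a ≤ t) (hbt : b ≤ t)
    (hr : famCov P Y r r ≤ t ^ 2) (hs : famCov P Y s s ≤ t ^ 2)
    (hαa : famCov P Y α α ≤ a ^ 2) (hβb : famCov P Y β β ≤ b ^ 2)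
    {G : ℝ × ℝ → ℝ} (hG : Measurable G) (hB : ∀ z, |G z| ≤ B) :
    |∫ ω, (Y α ω + Y r ω) ^ m * (Y β ω + Y s ω) ^ m * G (Y p ω, Y q ω) ∂P| ≤
      weightedConst m * B * (|famCov P Y r s| + a * b) * t ^ (2 * m - 2) := by
  have hB0 : 0 ≤ B := (abs_nonneg _).trans (hB 0)
  have hind := hY.indepFun_pair h1 h2 h3 h4
  have hYα : ∀ ω, Y α ω = a₁ * Y p ω + b₁ * Y q ω := fun ω => by simp [hα]
  have hYβ : ∀ ω, Y β ω = a₂ * Y p ω + b₂ * Y q ω := fun ω => by simp [hβ]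
  have hmY : ∀ v, AEMeasurable (Y v) P := fun v => (hY.law v).aemeasurable
  have hGM : AllMoments P (fun ω => G (Y p ω, Y q ω)) :=
    AllMoments.of_bound (hG.comp_aemeasurable ((hmY p).prodMk (hmY q))).aestronglyMeasurable
      (fun ω => hB _)
  have hM := hY.allMoments
  have hint : ∀ k l, AllMoments P (fun ω => Y α ω ^ (m - k) * Y β ω ^ (m - l) *
      G (Y p ω, Y q ω)) := fun k l => ((hM α).pow _).mul ((hM β).pow _) |>.mul hGM
  have hint' : ∀ k l, AllMoments P (fun ω => Y r ω ^ k * Y s ω ^ l) := fun k l =>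
    ((hM r).pow _).mul ((hM s).pow _)
  have e : ∀ ω, (Y α ω + Y r ω) ^ m * (Y β ω + Y s ω) ^ m * G (Y p ω, Y q ω) =
      ∑ k ∈ Finset.range (m + 1), ∑ l ∈ Finset.range (m + 1), m.choose k * m.choose l *
        ((Y r ω ^ k * Y s ω ^ l) * (Y α ω ^ (m - k) * Y β ω ^ (m - l) * G (Y p ω, Y q ω))) := by
    intro ω
    rw [add_comm (Y α ω), add_comm (Y β ω), add_pow, add_pow, Finset.sum_mul_sum, Finset.sum_mul]
    refine Finset.sum_congr rfl fun k _ => ?_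
    rw [Finset.sum_mul]
    refine Finset.sum_congr rfl fun l _ => ?_
    ring
  simp_rw [e]
  rw [integral_finsetSum _ fun k _ => integrable_finsetSum _ fun l _ =>
    ((hint' k l).mul (hint k l)).integrable.const_mul _, weightedConst]
  simp only [Finset.sum_mul]
  refine (Finset.abs_sum_le_sum_abs _ _).trans (Finset.sum_le_sum fun k hk => ?_)
  rw [integral_finsetSum _ fun l _ => ((hint' k l).mul (hint k l)).integrable.const_mul _]
  refine (Finset.abs_sum_le_sum_abs _ _).trans (Finset.sum_le_sum fun l hl => ?_)
  have hk' : k ≤ m := by simpa [Nat.lt_succ_iff] using hk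
  have hl' : l ≤ m := by simpa [Nat.lt_succ_iff] using hl
  rw [integral_const_mul]
  have hprod : ∫ ω, (Y r ω ^ k * Y s ω ^ l) *
      (Y α ω ^ (m - k) * Y β ω ^ (m - l) * G (Y p ω, Y q ω)) ∂P =
      (∫ ω, Y r ω ^ k * Y s ω ^ l ∂P) *
        ∫ ω, Y α ω ^ (m - k) * Y β ω ^ (m - l) * G (Y p ω, Y q ω) ∂P := by
    -- α and β are functions of p and q, so the whole second factor is a function of the pair that
    -- is independent of the residuals.
    refine IndepFun.integral_fun_mul_eq_mul_integral ?_
      (hint' k l).integrable.aestronglyMeasurable (hint k l).integrable.aestronglyMeasurable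
    have := hind.comp (φ := fun z : ℝ × ℝ => z.1 ^ k * z.2 ^ l)
      (ψ := fun z : ℝ × ℝ => (a₁ * z.1 + b₁ * z.2) ^ (m - k) * (a₂ * z.1 + b₂ * z.2) ^ (m - l) *
        G (z.1, z.2)) (by fun_prop) (by fun_prop)
    simp only [hYα, hYβ]
    exact this
  rw [hprod, abs_mul, abs_mul, abs_mul, Nat.abs_cast, Nat.abs_cast]
  have hABint : ∀ i j, |∫ ω, Y α ω ^ i * Y β ω ^ j * G (Y p ω, Y q ω) ∂P| ≤
      √(gaussMoment (2 * i)) * √(gaussMoment (2 * j)) * (a ^ i * b ^ j) * B := by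
    intro i j
    refine abs_integral_le_integral_abs.trans ?_
    have h5 := hY.abs_integral_pow_mul_pow_le α β i j ha hαa hb hβb
    calc _ ≤ ∫ ω, |Y α ω| ^ i * |Y β ω| ^ j * B ∂P := by
          refine integral_mono ((((hM α).pow i).mul ((hM β).pow j)).mul hGM).abs.integrable
            ((((hM α).abs.pow i).mul ((hM β).abs.pow j)).integrable.mul_const B) fun ω => ?_
          simp only [abs_mul, abs_pow]
          gcongr
          exact hB _
      _ = (∫ ω, |Y α ω| ^ i * |Y β ω| ^ j ∂P) * B := integral_mul_const _ _
      _ ≤ _ := by gcongr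
  have hABt : ∀ i j, a ^ i * b ^ j ≤ t ^ (i + j) := fun i j => by
    rw [pow_add]
    gcongr
  have hc := oddMomentConst_nonneg k l
  set c₁ := √(gaussMoment (2 * (m - k))) * √(gaussMoment (2 * (m - l))) with hc₁
  set c₂ := √(gaussMoment (2 * k)) * √(gaussMoment (2 * l)) with hc₂
  have hmain : |∫ ω, Y r ω ^ k * Y s ω ^ l ∂P| *
      |∫ ω, Y α ω ^ (m - k) * Y β ω ^ (m - l) * G (Y p ω, Y q ω) ∂P| ≤
      c₁ * (oddMomentConst k l + c₂) * B * (|famCov P Y r s| + a * b) * t ^ (2 * m - 2) := by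
    have hc₁0 : 0 ≤ c₁ := by positivity
    have hc₂0 : 0 ≤ c₂ := by positivity
    have hθ := abs_nonneg (famCov P Y r s)
    have hab : 0 ≤ a * b := by positivity
    -- If k and l are both even, m-k and m-l are odd, hence positive, and release a factor ab. If
    -- both are odd, the residual moment releases the covariance. If the parities differ, it
    -- vanishes.
    rcases Nat.even_or_odd (k + l) with hkl | hkl
    · rcases Nat.even_or_odd k with hke | hko
      · have hle : Even l := (Nat.even_add.1 hkl).1 hke
        have hmk : Odd (m - k) := by rw [Nat.odd_sub hk']; simp [hm, hke]
        have hml : Odd (m - l) := by rw [Nat.odd_sub hl']; simp [hm, hle]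
        have hRS : |∫ ω, Y r ω ^ k * Y s ω ^ l ∂P| ≤ c₂ * (t ^ k * t ^ l) := by
          refine (abs_integral_le_integral_abs.trans (le_of_eq ?_)).trans
            (hY.abs_integral_pow_mul_pow_le r s k l ht hr ht hs)
          simp_rw [abs_mul, abs_pow]
        have hAB := hABint (m - k) (m - l)
        have hAB2 : a ^ (m - k) * b ^ (m - l) ≤ a * b * t ^ ((m - k - 1) + (m - l - 1)) := by
          have e1 : a ^ (m - k) = a * a ^ (m - k - 1) := by
            rw [← pow_succ', Nat.sub_add_cancel hmk.pos]
          have e2 : b ^ (m - l) = b * b ^ (m - l - 1) := by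
            rw [← pow_succ', Nat.sub_add_cancel hml.pos]
          rw [e1, e2]
          calc _ = a * b * (a ^ (m - k - 1) * b ^ (m - l - 1)) := by ring
            _ ≤ _ := by gcongr; exact hABt _ _
        calc _ ≤ (c₂ * (t ^ k * t ^ l)) *
              (c₁ * (a * b * t ^ ((m - k - 1) + (m - l - 1))) * B) := by
              gcongr
              exact hAB.trans (by gcongr)
          _ = c₁ * c₂ * B * (a * b) * t ^ (2 * m - 2) := by
              have := hmk.pos
              have := hml.pos
              rw [show 2 * m - 2 = k + l + ((m - k - 1) + (m - l - 1)) by omega, pow_add _ (k + l),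
                pow_add _ k]
              ring
          _ ≤ _ := by
              gcongr
              · linarith
              · linarith
      · have hlo : Odd l := by
          rw [Nat.even_add] at hkl
          rw [← Nat.not_even_iff_odd] at hko ⊢
          tauto
        have hRS := hY.abs_integral_pow_mul_pow_le_of_odd r s hko l ht hr hs
        have hAB := hABint (m - k) (m - l)
        calc _ ≤ (oddMomentConst k l * |famCov P Y r s| * t ^ (k + l - 2)) *
              (c₁ * t ^ ((m - k) + (m - l)) * B) := by
              gcongr
              exact hAB.trans (by gcongr; exact hABt _ _)
          _ = c₁ * oddMomentConst k l * B * |famCov P Y r s| * t ^ (2 * m - 2) := by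
              have := hko.pos
              have := hlo.pos
              rw [show 2 * m - 2 = k + l - 2 + ((m - k) + (m - l)) by omega,
                pow_add _ (k + l - 2)]
              ring
          _ ≤ _ := by
              gcongr
              · linarith
              · linarith
    · rw [hY.integral_pow_mul_pow_eq_zero r s hkl, abs_zero, zero_mul]
      positivity
  calc _ ≤ (m.choose k : ℝ) * m.choose l * (c₁ * (oddMomentConst k l + c₂) * B *
        (|famCov P Y r s| + a * b) * t ^ (2 * m - 2)) := by gcongr
    _ = _ := by ring

end CenteredGaussianFamily

/-! ### Smooth test functions approximating indicators of intervals -/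

section Kernel

/-- A smooth probability density on `[0, η]`. -/
noncomputable def bumpDensity (η x : ℝ) : ℝ := η⁻¹ * deriv Real.smoothTransition (x / η)

lemma contDiff_smoothTransition : ContDiff ℝ ((⊤ : ℕ∞) : WithTop ℕ∞) Real.smoothTransition :=
  Real.smoothTransition.contDiff

lemma continuous_deriv_smoothTransition : Continuous (deriv Real.smoothTransition) :=
  contDiff_smoothTransition.continuous_deriv (by simp)

lemma hasDerivAt_smoothTransition (x : ℝ) :
    HasDerivAt Real.smoothTransition (deriv Real.smoothTransition x) x :=
  (contDiff_smoothTransition.differentiable (by simp) x).hasDerivAt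

lemma deriv_smoothTransition_eq_zero {x : ℝ} (hx : x ∉ Icc (0 : ℝ) 1) :
    deriv Real.smoothTransition x = 0 := by
  rcases lt_or_ge x 0 with h | h
  · have : Real.smoothTransition =ᶠ[𝓝 x] fun _ => 0 := by
      filter_upwards [Iio_mem_nhds h] with y hy
      exact Real.smoothTransition.zero_of_nonpos (le_of_lt hy)
    rw [this.deriv_eq, deriv_const]
  · have h1 : 1 < x := by
      by_contra hcon
      exact hx ⟨h, not_lt.1 hcon⟩
    have : Real.smoothTransition =ᶠ[𝓝 x] fun _ => 1 := by
      filter_upwards [Ioi_mem_nhds h1] with y hy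
      exact Real.smoothTransition.one_of_one_le (le_of_lt hy)
    rw [this.deriv_eq, deriv_const]

lemma integral_deriv_smoothTransition : ∫ x, deriv Real.smoothTransition x = 1 := by
  have h1 : ∫ x in (0 : ℝ)..1, deriv Real.smoothTransition x = 1 := by
    rw [intervalIntegral.integral_deriv_eq_sub
      (fun x _ => (hasDerivAt_smoothTransition x).differentiableAt)
      (continuous_deriv_smoothTransition.intervalIntegrable _ _)]
    simp
  rw [intervalIntegral.integral_of_le zero_le_one, ← integral_Icc_eq_integral_Ioc] at h1
  rw [← h1]
  exact (setIntegral_eq_integral_of_forall_compl_eq_zero fun x hx =>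
    deriv_smoothTransition_eq_zero hx).symm

lemma bumpDensity_nonneg {η : ℝ} (hη : 0 < η) (x : ℝ) : 0 ≤ bumpDensity η x :=
  mul_nonneg (by positivity) Real.smoothTransition.monotone.deriv_nonneg

lemma continuous_bumpDensity (η : ℝ) : Continuous (bumpDensity η) := by
  have := continuous_deriv_smoothTransition
  unfold bumpDensity
  fun_prop

lemma bumpDensity_eq_zero {η x : ℝ} (hη : 0 < η) (hx : x ∉ Icc 0 η) : bumpDensity η x = 0 := by
  rw [bumpDensity, deriv_smoothTransition_eq_zero, mul_zero]
  rintro ⟨h1, h2⟩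
  rw [div_le_one hη] at h2
  refine hx ⟨?_, h2⟩
  by_contra hcon
  have := div_neg_of_neg_of_pos (not_le.1 hcon) hη
  linarith

lemma integral_bumpDensity {η : ℝ} (hη : 0 < η) (a : ℝ) : ∫ x, bumpDensity η (x - a) = 1 := by
  rw [integral_sub_right_eq_self (bumpDensity η) a]
  unfold bumpDensity
  rw [integral_const_mul, Measure.integral_comp_div, integral_deriv_smoothTransition,
    abs_of_pos hη, smul_eq_mul, mul_one, inv_mul_cancel₀ hη.ne']

lemma integrable_mul_bumpDensity {F : ℝ × ℝ → ℝ} {η a b : ℝ} (hη : 0 < η)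
    (hF : ContinuousOn F (Icc a (a + η) ×ˢ Icc b (b + η))) :
    Integrable fun p : ℝ × ℝ => F p * (bumpDensity η (p.1 - a) * bumpDensity η (p.2 - b)) := by
  have hk := continuous_bumpDensity η
  rw [← integrableOn_iff_integrable_of_support_subset
    (s := Icc a (a + η) ×ˢ Icc b (b + η)) (by
      intro p hp
      by_contra hcon
      apply hp
      simp only
      rw [mem_prod, not_and_or] at hcon
      rcases hcon with h | h
      · rw [bumpDensity_eq_zero hη (x := p.1 - a), zero_mul, mul_zero]
        rintro ⟨h1, h2⟩
        exact h ⟨by linarith, by linarith⟩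
      · rw [bumpDensity_eq_zero hη (x := p.2 - b), mul_zero, mul_zero]
        rintro ⟨h1, h2⟩
        exact h ⟨by linarith, by linarith⟩)]
  exact ContinuousOn.integrableOn_compact (isCompact_Icc.prod isCompact_Icc)
    (hF.mul (by fun_prop))

lemma abs_integral_mul_bumpDensity_sub_le {F : ℝ × ℝ → ℝ} {η a b e : ℝ} (hη : 0 < η)
    (hF : ContinuousOn F (Icc a (a + η) ×ˢ Icc b (b + η)))
    (he : ∀ p ∈ Icc a (a + η) ×ˢ Icc b (b + η), |F p - F (a, b)| ≤ e) :
    |(∫ p : ℝ × ℝ, F p * (bumpDensity η (p.1 - a) * bumpDensity η (p.2 - b))) - F (a, b)| ≤ e := by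
  have h1 : ∀ c : ℝ, ∫ p : ℝ × ℝ, c * (bumpDensity η (p.1 - a) * bumpDensity η (p.2 - b)) = c := by
    intro c
    rw [integral_const_mul, Measure.volume_eq_prod,
      integral_prod_mul (fun x => bumpDensity η (x - a)) (fun x => bumpDensity η (x - b)),
      integral_bumpDensity hη, integral_bumpDensity hη]
    ring
  have hi : ∀ c : ℝ, Integrable fun p : ℝ × ℝ =>
      c * (bumpDensity η (p.1 - a) * bumpDensity η (p.2 - b)) := fun c =>
    integrable_mul_bumpDensity hη continuousOn_const
  conv_lhs => rw [← h1 (F (a, b))]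
  rw [← integral_sub (integrable_mul_bumpDensity hη hF) (hi _)]
  calc _ ≤ ∫ p : ℝ × ℝ, e * (bumpDensity η (p.1 - a) * bumpDensity η (p.2 - b)) := by
        refine abs_integral_le_integral_abs.trans
          (integral_mono ((integrable_mul_bumpDensity hη hF).sub (hi _)).abs (hi _) fun p => ?_)
        have h0 : 0 ≤ bumpDensity η (p.1 - a) * bumpDensity η (p.2 - b) :=
          mul_nonneg (bumpDensity_nonneg hη _) (bumpDensity_nonneg hη _)
        simp only [← sub_mul, abs_mul (F p - F (a, b)), abs_of_nonneg h0]
        by_cases hp : p ∈ Icc a (a + η) ×ˢ Icc b (b + η)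
        · exact mul_le_mul_of_nonneg_right (he p hp) h0
        · have : bumpDensity η (p.1 - a) * bumpDensity η (p.2 - b) = 0 := by
            rw [mem_prod, not_and_or] at hp
            rcases hp with h | h
            · rw [bumpDensity_eq_zero hη (x := p.1 - a), zero_mul]
              rintro ⟨h1, h2⟩
              exact h ⟨by linarith, by linarith⟩
            · rw [bumpDensity_eq_zero hη (x := p.2 - b), mul_zero]
              rintro ⟨h1, h2⟩
              exact h ⟨by linarith, by linarith⟩
          rw [this, mul_zero, mul_zero]
    _ = e := h1 e

/-- A smoothed indicator of `[u, u + ε]`. -/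
noncomputable def smoothStep (η ε u s : ℝ) : ℝ :=
  Real.smoothTransition ((s - u) / η) - Real.smoothTransition ((s - u - ε) / η)

lemma contDiff_smoothStep (η ε u : ℝ) :
    ContDiff ℝ ((⊤ : ℕ∞) : WithTop ℕ∞) (smoothStep η ε u) := by
  unfold smoothStep
  refine ContDiff.sub (contDiff_smoothTransition.comp ?_) (contDiff_smoothTransition.comp ?_) <;>
  fun_prop

lemma smoothStep_nonneg {η ε : ℝ} (hη : 0 < η) (hε : 0 < ε) (u s : ℝ) :
    0 ≤ smoothStep η ε u s :=
  sub_nonneg.2 (Real.smoothTransition.monotone (div_le_div_of_nonneg_right (by linarith) hη.le))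

lemma smoothStep_le_one (η ε u s : ℝ) : smoothStep η ε u s ≤ 1 := by
  have := Real.smoothTransition.le_one ((s - u) / η)
  have := Real.smoothTransition.nonneg ((s - u - ε) / η)
  unfold smoothStep
  linarith

/-- The smoothing reaches up to u+ε+η ≤ u+2ε; this is why rectangles of side 2ε appear later. -/
lemma smoothStep_eq_zero {η ε u s : ℝ} (hη : 0 < η) (hηε : η ≤ ε)
    (hs : s ∉ Icc u (u + 2 * ε)) : smoothStep η ε u s = 0 := by
  unfold smoothStep
  rw [mem_Icc, not_and_or, not_le, not_le] at hs
  rcases hs with h | h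
  · rw [Real.smoothTransition.zero_of_nonpos, Real.smoothTransition.zero_of_nonpos, sub_zero]
    · exact div_nonpos_of_nonpos_of_nonneg (by linarith) hη.le
    · exact div_nonpos_of_nonpos_of_nonneg (by linarith) hη.le
  · rw [Real.smoothTransition.one_of_one_le, Real.smoothTransition.one_of_one_le, sub_self]
    · rw [one_le_div hη]; linarith
    · rw [one_le_div hη]; linarith

/-- As η → 0 this approximates the difference of the unit masses at u and u+ε, so a product of two
steps tests the rectangular increment. -/
lemma deriv_smoothStep (η ε u s : ℝ) :
    deriv (smoothStep η ε u) s = bumpDensity η (s - u) - bumpDensity η (s - (u + ε)) := by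
  have h1 : HasDerivAt (fun s => (s - u) / η) (1 / η) s :=
    ((hasDerivAt_id s).sub_const u).div_const η
  have h2 : HasDerivAt (fun s => (s - u - ε) / η) (1 / η) s :=
    (((hasDerivAt_id s).sub_const u).sub_const ε).div_const η
  have h3 := ((hasDerivAt_smoothTransition _).comp s h1).sub
    ((hasDerivAt_smoothTransition _).comp s h2)
  have h4 : deriv (smoothStep η ε u) s = _ := h3.deriv
  rw [h4, bumpDensity, bumpDensity, ← sub_sub]
  ring

end Kernel

/-! ### Rectangular increments and the mixed derivative measure -/

section Rectangle

variable {F : ℝ → ℝ → ℝ} {μp μn : Measure (ℝ × ℝ)}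

lemma rect_subset {u v ε : ℝ} (hε : 0 < ε) (hu : 0 < u) (huv : u + 2 * ε < v)
    (hv : v + 2 * ε < 1) : Icc u (u + 2 * ε) ×ˢ Icc v (v + 2 * ε) ⊆ openOffDiagSquare := by
  rintro ⟨s, t⟩ ⟨⟨h1, h2⟩, h3, h4⟩
  simp only at h1 h2 h3 h4
  exact ⟨⟨by simp only; linarith, by simp only; linarith⟩,
    ⟨by simp only; linarith, by simp only; linarith⟩, by simp only; linarith⟩

lemma abs_integral_le_measure {ν : Measure (ℝ × ℝ)} {φ : ℝ × ℝ → ℝ} {R : Set (ℝ × ℝ)}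
    (hR : ν R < ⊤) (hφ0 : ∀ p, |φ p| ≤ 1) (hφ : ∀ p, p ∉ R → φ p = 0) :
    |∫ p, φ p ∂ν| ≤ ν.real R := by
  rw [← setIntegral_eq_integral_of_forall_compl_eq_zero hφ]
  have := norm_setIntegral_le_of_norm_le_const (μ := ν) (f := φ) (s := R) (C := 1) hR
    (fun p _ => hφ0 p)
  simpa using this

/-- The rectangular increments of `F` are dominated by the total variation of its mixed
derivative. -/
theorem HasMixedDerivMeasure.abs_rect_incr_le (hμ : HasMixedDerivMeasure F μp μn)
    (hF : ContinuousOn (fun p : ℝ × ℝ => F p.1 p.2) (Icc 0 1 ×ˢ Icc 0 1)) {u v ε : ℝ}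
    (hε : 0 < ε) (hu : 0 < u) (huv : u + 2 * ε < v) (hv : v + 2 * ε < 1) :
    ENNReal.ofReal |F u v - F u (v + ε) - F (u + ε) v + F (u + ε) (v + ε)| ≤
      (μp + μn) (Icc u (u + 2 * ε) ×ˢ Icc v (v + 2 * ε)) := by
  set R := Icc u (u + 2 * ε) ×ˢ Icc v (v + 2 * ε) with hRdef
  have hRc : IsCompact R := isCompact_Icc.prod isCompact_Icc
  have hRsub := rect_subset hε hu huv hv
  have hRoff : R ⊆ offDiagSquare := fun p hp => by
    obtain ⟨h1, h2, h3⟩ := hRsub hp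
    exact ⟨Ioo_subset_Icc_self h1, Ioo_subset_Icc_self h2, h3⟩
  have hp := hμ.pos_compact R hRc hRoff
  have hn := hμ.neg_compact R hRc hRoff
  have key : |F u v - F u (v + ε) - F (u + ε) v + F (u + ε) (v + ε)| ≤ μp.real R + μn.real R := by
    refine le_of_forall_pos_le_add fun e he => ?_
    have hUC := (isCompact_Icc.prod isCompact_Icc).uniformContinuousOn_of_continuous hF
    rw [Metric.uniformContinuousOn_iff] at hUC
    obtain ⟨d, hd, hdist⟩ := hUC (e / 4) (by positivity)
    -- η ≤ ε keeps the support inside R; η ≤ d/2 makes F vary by less than e/4 on squares of side η,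
    -- and the four corners contribute e in total.
    set η := min ε (d / 2) with hη
    have hη0 : 0 < η := by rw [hη]; positivity
    have hηε : η ≤ ε := min_le_left _ _
    have hηd : η ≤ d / 2 := min_le_right _ _
    set φ : ℝ × ℝ → ℝ := fun p => smoothStep η ε u p.1 * smoothStep η ε v p.2 with hφ
    have hφR : ∀ p, p ∉ R → φ p = 0 := by
      intro p hp
      rw [hRdef, mem_prod, not_and_or] at hp
      rcases hp with h | h
      · simp only [hφ, smoothStep_eq_zero hη0 hηε h, zero_mul]
      · simp only [hφ, smoothStep_eq_zero hη0 hηε h, mul_zero]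
    have hts : tsupport φ ⊆ R := closure_minimal (fun p hp => by
      by_contra hcon
      exact hp (hφR p hcon)) hRc.isClosed
    have hφ1 : ∀ p, |φ p| ≤ 1 := by
      intro p
      rw [abs_of_nonneg (mul_nonneg (smoothStep_nonneg hη0 hε _ _) (smoothStep_nonneg hη0 hε _ _))]
      exact mul_le_one₀ (smoothStep_le_one _ _ _ _) (smoothStep_nonneg hη0 hε _ _)
        (smoothStep_le_one _ _ _ _)
    have hint := hμ.integral_eq φ
      (((contDiff_smoothStep η ε u).comp contDiff_fst).mul
        ((contDiff_smoothStep η ε v).comp contDiff_snd))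
      (HasCompactSupport.of_support_subset_isCompact hRc (subset_tsupport φ |>.trans hts))
      (hts.trans hRsub)
    have hmix : ∀ p, mixedDeriv φ p =
        (bumpDensity η (p.1 - u) - bumpDensity η (p.1 - (u + ε))) *
          (bumpDensity η (p.2 - v) - bumpDensity η (p.2 - (v + ε))) := by
      intro p
      simp only [mixedDeriv, hφ, deriv_const_mul_field', deriv_mul_const_field',
        deriv_smoothStep]
    have hsq : ∀ a ∈ Icc u (u + ε), ∀ b ∈ Icc v (v + ε),
        Icc a (a + η) ×ˢ Icc b (b + η) ⊆ Icc (0 : ℝ) 1 ×ˢ Icc (0 : ℝ) 1 := by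
      rintro a ⟨ha1, ha2⟩ b ⟨hb1, hb2⟩ ⟨s, t⟩ ⟨⟨h1, h2⟩, h3, h4⟩
      simp only at h1 h2 h3 h4
      exact ⟨⟨by simp only; linarith, by simp only; linarith⟩,
        ⟨by simp only; linarith, by simp only; linarith⟩⟩
    have hI : ∀ a ∈ Icc u (u + ε), ∀ b ∈ Icc v (v + ε), Integrable fun p : ℝ × ℝ =>
        F p.1 p.2 * (bumpDensity η (p.1 - a) * bumpDensity η (p.2 - b)) := fun a ha b hb =>
      integrable_mul_bumpDensity (F := fun p => F p.1 p.2) hη0 (hF.mono (hsq a ha b hb))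
    have hclose : ∀ a ∈ Icc u (u + ε), ∀ b ∈ Icc v (v + ε),
        |(∫ p : ℝ × ℝ, F p.1 p.2 * (bumpDensity η (p.1 - a) * bumpDensity η (p.2 - b))) - F a b| ≤
          e / 4 := fun a ha b hb => by
      refine abs_integral_mul_bumpDensity_sub_le (F := fun p => F p.1 p.2) hη0
        (hF.mono (hsq a ha b hb)) fun p hp => ?_
      have hab : (a, b) ∈ Icc a (a + η) ×ˢ Icc b (b + η) :=
        ⟨⟨le_rfl, by simp only; linarith⟩, ⟨le_rfl, by simp only; linarith⟩⟩
      have := hdist p (hsq a ha b hb hp) (a, b) (hsq a ha b hb hab) (by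
        obtain ⟨⟨h1, h2⟩, h3, h4⟩ := hp
        rw [Prod.dist_eq, max_lt_iff, Real.dist_eq, Real.dist_eq, abs_of_nonneg (by linarith),
          abs_of_nonneg (by linarith)]
        constructor <;> linarith)
      rw [Real.dist_eq] at this
      exact this.le
    have mu : u ∈ Icc u (u + ε) := ⟨le_rfl, by linarith⟩
    have mu' : u + ε ∈ Icc u (u + ε) := ⟨by linarith, le_rfl⟩
    have mv : v ∈ Icc v (v + ε) := ⟨le_rfl, by linarith⟩
    have mv' : v + ε ∈ Icc v (v + ε) := ⟨by linarith, le_rfl⟩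
    have hsplit : ∫ p : ℝ × ℝ, F p.1 p.2 * mixedDeriv φ p =
        (∫ p : ℝ × ℝ, F p.1 p.2 * (bumpDensity η (p.1 - u) * bumpDensity η (p.2 - v))) -
        (∫ p : ℝ × ℝ, F p.1 p.2 * (bumpDensity η (p.1 - u) * bumpDensity η (p.2 - (v + ε)))) -
        (∫ p : ℝ × ℝ, F p.1 p.2 * (bumpDensity η (p.1 - (u + ε)) * bumpDensity η (p.2 - v))) +
        (∫ p : ℝ × ℝ, F p.1 p.2 *
          (bumpDensity η (p.1 - (u + ε)) * bumpDensity η (p.2 - (v + ε)))) := by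
      have e1 := integral_sub (hI u mu v mv) (hI u mu _ mv')
      have e2 := integral_sub ((hI u mu v mv).sub (hI u mu _ mv')) (hI _ mu' v mv)
      have e3 := integral_add (((hI u mu v mv).sub (hI u mu _ mv')).sub (hI _ mu' v mv))
        (hI _ mu' _ mv')
      simp only [Pi.sub_apply] at e2 e3
      rw [← e1, ← e2, ← e3]
      congr 1
      ext p
      rw [hmix]
      ring
    have c1 := abs_le.1 (hclose u mu v mv)
    have c2 := abs_le.1 (hclose u mu _ mv')
    have c3 := abs_le.1 (hclose _ mu' v mv)
    have c4 := abs_le.1 (hclose _ mu' _ mv')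
    have d1 := abs_le.1 (abs_integral_le_measure hp hφ1 hφR)
    have d2 := abs_le.1 (abs_integral_le_measure hn hφ1 hφR)
    rw [hsplit] at hint
    rw [abs_le]
    constructor <;> linarith
  rw [Measure.add_apply]
  refine (ENNReal.ofReal_le_ofReal key).trans ?_
  rw [ENNReal.ofReal_add measureReal_nonneg measureReal_nonneg, ofReal_measureReal hp.ne,
    ofReal_measureReal hn.ne]

/-- Tonelli: a fixed point lies in the square with lower left corner p exactly for p in a square of
side h. -/
lemma lintegral_measure_rect_le (ν : Measure (ℝ × ℝ)) [SFinite ν] {h : ℝ} :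
    ∫⁻ p : ℝ × ℝ, ν (Icc p.1 (p.1 + h) ×ˢ Icc p.2 (p.2 + h)) ≤
      ENNReal.ofReal h ^ 2 * ν univ := by
  set T : Set ((ℝ × ℝ) × (ℝ × ℝ)) := {z | z.1.1 ≤ z.2.1 ∧ z.2.1 ≤ z.1.1 + h ∧ z.1.2 ≤ z.2.2 ∧
    z.2.2 ≤ z.1.2 + h} with hT
  have hTm : MeasurableSet T := by
    refine IsClosed.measurableSet ?_
    simp only [hT, ofPred_and]
    refine (isClosed_le ?_ ?_).inter ((isClosed_le ?_ ?_).inter ((isClosed_le ?_ ?_).inter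
      (isClosed_le ?_ ?_))) <;> fun_prop
  have h1 : ∀ p : ℝ × ℝ, Icc p.1 (p.1 + h) ×ˢ Icc p.2 (p.2 + h) = Prod.mk p ⁻¹' T := by
    intro p
    ext q
    simp only [mem_prod, mem_Icc, hT, mem_preimage, mem_ofPred_eq]
    tauto
  have h2 : ∀ q : ℝ × ℝ, (fun p => (p, q)) ⁻¹' T = Icc (q.1 - h) q.1 ×ˢ Icc (q.2 - h) q.2 := by
    intro q
    ext p
    simp only [mem_prod, mem_Icc, hT, mem_preimage, mem_ofPred_eq, tsub_le_iff_right]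
    tauto
  simp_rw [h1]
  rw [← Measure.prod_apply hTm, Measure.prod_apply_symm hTm]
  simp_rw [h2, Measure.volume_eq_prod, Measure.prod_prod, Real.volume_Icc, sub_sub_cancel]
  rw [lintegral_const, ← sq]

end Rectangle

/-! ### The process as a concave curve in L² -/

namespace CenteredGaussianFamily

variable {Ω : Type*} [MeasurableSpace Ω] {P : Measure Ω} [IsProbabilityMeasure P]
  {V : Type*} [AddCommGroup V] [Module ℝ V] {Y : V →ₗ[ℝ] (Ω → ℝ)}

/-- The isometric embedding of a centered Gaussian family into `L²`. -/
noncomputable def toL2 (hY : CenteredGaussianFamily P Y) : V →ₗ[ℝ] Lp ℝ 2 P where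
  toFun v := (hY.law v).memLp_two.toLp (Y v)
  map_add' v w := by
    rw [← MemLp.toLp_add]
    congr 1
    simp
  map_smul' c v := by
    rw [RingHom.id_apply, ← MemLp.toLp_const_smul]
    congr 1
    simp

lemma inner_toL2 (hY : CenteredGaussianFamily P Y) (v w : V) :
    inner ℝ (hY.toL2 v) (hY.toL2 w) = famCov P Y v w := by
  rw [L2.inner_def, famCov]
  refine integral_congr_ae ?_
  filter_upwards [(hY.law v).memLp_two.coeFn_toLp, (hY.law w).memLp_two.coeFn_toLp] with ω h1 h2
  simp only [toL2, LinearMap.coe_mk, AddHom.coe_mk, h1, h2]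
  simp [mul_comm]

lemma norm_toL2_sq (hY : CenteredGaussianFamily P Y) (v : V) :
    ‖hY.toL2 v‖ ^ 2 = famCov P Y v v := by
  rw [← real_inner_self_eq_norm_sq, inner_toL2]

end CenteredGaussianFamily

section GaussianCurve

variable {Ω : Type*} [MeasurableSpace Ω] {P : Measure Ω} [IsProbabilityMeasure P] {X : ℝ → Ω → ℝ}

/-- The finite linear combinations of the values of a process at nonnegative times. -/
noncomputable def procFamily (X : ℝ → Ω → ℝ) : (ℝ →₀ ℝ) →ₗ[ℝ] (Ω → ℝ) :=
  Finsupp.linearCombination ℝ fun t => X (max t 0)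

lemma procFamily_single {t : ℝ} (ht : 0 ≤ t) : procFamily X (Finsupp.single t 1) = X t := by
  simp [procFamily, ht]

/-- Clipping times at 0 extends the Gaussian process on nonnegative times to one indexed by ℝ;
finite linear combinations of it remain jointly Gaussian. -/
lemma centeredGaussianFamily (hXgauss : IsGaussianProcess (fun t : Ici (0 : ℝ) => X t) P)
    (hXcent : ∀ t, 0 ≤ t → ∫ ω, X t ω ∂P = 0) : CenteredGaussianFamily P (procFamily X) := by
  have hgauss : IsGaussianProcess (fun t : ℝ => X (max t 0)) P :=
    hXgauss.comp_right fun t : ℝ => (⟨max t 0, le_max_right t 0⟩ : Ici (0 : ℝ))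
  have happ : ∀ (c : ℝ →₀ ℝ) ω,
      procFamily X c ω = ∑ i ∈ c.support, c i * X (max i 0) ω := fun c ω => by
    simp [procFamily, Finsupp.linearCombination_apply, Finsupp.sum, Finset.sum_apply]
  refine ⟨hgauss.of_isGaussianProcess fun c => ⟨c.support,
    ∑ i : c.support, c i • ContinuousLinearMap.proj (R := ℝ) (φ := fun _ : c.support => ℝ) i,
    fun ω => ?_⟩, fun c => ?_⟩
  · rw [happ, ← Finset.sum_coe_sort]
    simp
  · simp_rw [happ]
    rw [integral_finsetSum _ fun i _ => ((hgauss.hasGaussianLaw_eval i).integrable).const_mul _]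
    refine Finset.sum_eq_zero fun i _ => ?_
    rw [integral_const_mul, hXcent _ (le_max_right i 0), mul_zero]

/-- The process as a curve in `L²`. -/
noncomputable def l2Curve (hY : CenteredGaussianFamily P (procFamily X)) (t : ℝ) : Lp ℝ 2 P :=
  hY.toL2 (Finsupp.single t 1)

lemma inner_l2Curve (hY : CenteredGaussianFamily P (procFamily X)) {s t : ℝ} (hs : 0 ≤ s)
    (ht : 0 ≤ t) : inner ℝ (l2Curve hY s) (l2Curve hY t) = covFn P X s t := by
  rw [l2Curve, l2Curve, hY.inner_toL2, famCov, procFamily_single hs, procFamily_single ht, covFn]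

lemma norm_l2Curve_sq (hY : CenteredGaussianFamily P (procFamily X)) {s : ℝ} (hs : 0 ≤ s) :
    ‖l2Curve hY s‖ ^ 2 = covFn P X s s := by
  rw [← real_inner_self_eq_norm_sq, inner_l2Curve hY hs hs]

lemma norm_l2Curve_sub_sq (hY : CenteredGaussianFamily P (procFamily X)) {s t : ℝ} (hs : 0 ≤ s)
    (ht : 0 ≤ t) : ‖l2Curve hY t - l2Curve hY s‖ ^ 2 = canonMetricSq P X s t := by
  rw [l2Curve, l2Curve, ← map_sub, hY.norm_toL2_sq, CenteredGaussianFamily.famCov_self, map_sub,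
    procFamily_single hs, procFamily_single ht, canonMetricSq]
  rfl

theorem concaveCurve_l2Curve (hY : CenteredGaussianFamily P (procFamily X))
    (hXzero : ∀ᵐ ω ∂P, X 0 ω = 0)
    {δ : ℝ → ℝ} (hδnonneg : ∀ r ∈ Icc (0 : ℝ) 1, 0 ≤ δ r)
    (hδmono : MonotoneOn (fun r => δ r ^ 2) (Icc 0 1))
    (hδconc : ConcaveOn ℝ (Icc 0 1) (fun r => δ r ^ 2))
    (hδdom : ∀ s ∈ Icc (0 : ℝ) 1, ∀ r ∈ Icc (0 : ℝ) 1, canonMetricSq P X s (s + r) ≤ δ r ^ 2)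
    (hδv : ∀ u ∈ Icc (0 : ℝ) 1, MonotoneOn (fun v => canonMetricSq P X u v) (Icc u 1) ∧
      ConcaveOn ℝ (Icc u 1) (fun v => canonMetricSq P X u v))
    (hδu : ∀ v ∈ Icc (0 : ℝ) 1, MonotoneOn (fun u => -canonMetricSq P X u v) (Icc 0 v) ∧
      (ConcaveOn ℝ (Icc 0 v) (fun u => -canonMetricSq P X u v) ∨
        ConcaveOn ℝ (Icc 0 v) (fun u => canonMetricSq P X u v)))
    {a b c' : ℝ} (ha : 1 < a) (hc' : 0 < c')
    (hii : ∀ u v, 0 < u → u < v → v ≤ 1 →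
      c' * δ u ^ 2 * δ (v - u) ^ 2 ≤ covFn P X u u * covFn P X v v - covFn P X u v ^ 2)
    (hiii : ∀ u, 0 < u → a * u ≤ 1 → (δ (a * u) - δ u) / ((a - 1) * u) < b * (δ u / u)) :
    ConcaveCurve (l2Curve hY) δ c' := by
  -- The strict inequality (iii) forces positivity: δ(r) = 0 would make the nonnegative quotient
  -- δ(ar)/((a-1)r) negative. Monotonicity then covers r > 1/a.
  have hposa : ∀ r, 0 < r → a * r ≤ 1 → 0 < δ r := by
    intro r hr har
    have hr1 : r ≤ 1 := by nlinarith
    refine lt_of_le_of_ne (hδnonneg r ⟨hr.le, hr1⟩) fun h0 => ?_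
    have h1 := hiii r hr har
    rw [← h0, zero_div, mul_zero, sub_zero] at h1
    have h2 := hδnonneg (a * r) ⟨by nlinarith, har⟩
    have h3 : 0 < (a - 1) * r := mul_pos (by linarith) hr
    exact absurd h1 (not_lt.2 (by positivity))
  refine ⟨?_, hδnonneg, ?_, hδmono, hδconc, ?_, ?_, ?_, ?_, ?_, hc', ?_⟩
  · have : ‖l2Curve hY 0‖ ^ 2 = 0 := by
      rw [norm_l2Curve_sq hY le_rfl, covFn]
      refine integral_eq_zero_of_ae ?_
      filter_upwards [hXzero] with ω h
      simp [h]
    exact norm_eq_zero.1 (pow_eq_zero_iff two_ne_zero |>.1 this)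
  · intro r hr hr1
    have ha0 : 0 < a := by linarith
    have hm : 0 < min r (1 / a) := lt_min hr (by positivity)
    have h1 := hposa (min r (1 / a)) hm (by
      calc a * min r (1 / a) ≤ a * (1 / a) := by gcongr; exact min_le_right _ _
        _ = 1 := by field_simp)
    have h2 := hδmono (a := min r (1 / a)) (b := r) ⟨hm.le, (min_le_left _ _).trans hr1⟩
      ⟨hr.le, hr1⟩ (min_le_left _ _)
    have h3 : 0 < δ r ^ 2 := lt_of_lt_of_le (by positivity) h2
    refine lt_of_le_of_ne (hδnonneg r ⟨hr.le, hr1⟩) fun h0 => ?_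
    rw [← h0] at h3
    simp at h3
  · intro s hs r hr
    have h1 := hδdom s hs r hr
    rw [← norm_l2Curve_sub_sq hY hs.1 (add_nonneg hs.1 hr.1)] at h1
    exact (abs_le_of_sq_le_sq' h1 (hδnonneg r hr)).2
  · intro u hu
    refine (hδv u hu).1.congr fun v hv => ?_
    exact (norm_l2Curve_sub_sq hY hu.1 (hu.1.trans hv.1)).symm
  · intro u hu
    refine (hδv u hu).2.congr fun v hv => ?_
    exact (norm_l2Curve_sub_sq hY hu.1 (hu.1.trans hv.1)).symm
  · intro v hv
    refine (hδu v hv).1.congr fun u hu => ?_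
    simp only [norm_l2Curve_sub_sq hY hu.1 hv.1]
  · intro v hv
    rcases (hδu v hv).2 with h | h
    · refine Or.inl (h.congr fun u hu => ?_)
      simp only [norm_l2Curve_sub_sq hY hu.1 hv.1]
    · refine Or.inr (h.congr fun u hu => ?_)
      simp only [norm_l2Curve_sub_sq hY hu.1 hv.1]
  · intro u v hu huv hv
    have hv0 : 0 ≤ v := by linarith
    rw [norm_l2Curve_sq hY hu.le, norm_l2Curve_sq hY hv0, inner_l2Curve hY hu.le hv0]
    exact hii u v hu huv hv

/-- The metric of a curve dominated by a function that vanishes at `0` is continuous. -/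
lemma ConcaveCurve.continuousOn_metric {H : Type*} [NormedAddCommGroup H] [InnerProductSpace ℝ H]
    {x : ℝ → H} {δ : ℝ → ℝ} {κ : ℝ} (h : ConcaveCurve x δ κ)
    (hδ : Tendsto δ (𝓝[>] 0) (𝓝 0)) : ContinuousOn x (Icc 0 1) := by
  rw [Metric.continuousOn_iff]
  intro t ht e he
  have h1 : ∀ᶠ r in 𝓝[>] (0 : ℝ), δ r < e := hδ.eventually (gt_mem_nhds he)
  obtain ⟨r, hr, hr0⟩ := (h1.and (Ioo_mem_nhdsGT one_pos)).exists
  refine ⟨r, hr0.1, fun s hs hst => ?_⟩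
  have aux : ∀ p q, 0 ≤ p → p ≤ q → q ≤ 1 → q - p < r → ‖x q - x p‖ < e := by
    intro p q hp hpq hq hr'
    exact ((h.norm_sub_le hp hpq hq).trans (h.mono (by linarith) hr'.le hr0.2.le)).trans_lt hr
  rw [Real.dist_eq] at hst
  rcases le_total s t with hle | hle
  · rw [abs_sub_comm, abs_of_nonneg (by linarith)] at hst
    rw [dist_comm, dist_eq_norm]
    exact aux s t hs.1 hle ht.2 hst
  · rw [abs_of_nonneg (by linarith)] at hst
    rw [dist_eq_norm]
    exact aux t s ht.1 hle hs.2 hst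

end GaussianCurve

/-! ### Covariance of two weighted increments -/

section Pointwise

variable {Ω : Type*} [MeasurableSpace Ω] {P : Measure Ω} [IsProbabilityMeasure P] {X : ℝ → Ω → ℝ}

/-- The increment over `[u, u + ε]` as a formal combination. -/
noncomputable def incrVec (ε u : ℝ) : ℝ →₀ ℝ := Finsupp.single (u + ε) 1 - Finsupp.single u 1

/-- The midpoint over `[u, u + ε]` as a formal combination. -/
noncomputable def midVec (ε u : ℝ) : ℝ →₀ ℝ :=
  (1 / 2 : ℝ) • (Finsupp.single (u + ε) 1 + Finsupp.single u 1)

lemma toL2_incrVec (hY : CenteredGaussianFamily P (procFamily X)) (ε u : ℝ) :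
    hY.toL2 (incrVec ε u) = incr (l2Curve hY) ε u := by
  simp [incrVec, incr, l2Curve]

lemma toL2_midVec (hY : CenteredGaussianFamily P (procFamily X)) (ε u : ℝ) :
    hY.toL2 (midVec ε u) = midpt (l2Curve hY) ε u := by
  rw [midVec, map_smul, map_add, midpt, l2Curve, l2Curve]

lemma weightedIncr_eq {ε u : ℝ} (hu : 0 ≤ u) (hε : 0 ≤ ε) (m : ℕ) (g : ℝ → ℝ) (ω : Ω) :
    weightedIncr X m g ε ω u =
      procFamily X (incrVec ε u) ω ^ m * g (procFamily X (midVec ε u) ω) := by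
  rw [weightedIncr, incrVec, midVec, map_sub, map_smul, map_add, procFamily_single hu,
    procFamily_single (add_nonneg hu hε)]
  congr 2
  simp only [Pi.smul_apply, Pi.add_apply, smul_eq_mul]
  ring

variable {δ : ℝ → ℝ} {κ : ℝ} {m : ℕ} {g : ℝ → ℝ} {B : ℝ}

lemma famCov_incrVec_le (hY : CenteredGaussianFamily P (procFamily X))
    (h : ConcaveCurve (l2Curve hY) δ κ) {u ε : ℝ} (hu : u ∈ Icc (0 : ℝ) 1)
    (hε : ε ∈ Icc (0 : ℝ) 1) :
    famCov P (procFamily X) (incrVec ε u) (incrVec ε u) ≤ δ ε ^ 2 := by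
  rw [← hY.norm_toL2_sq, toL2_incrVec, incr]
  have := h.dom u hu ε hε
  gcongr

/-- This crude bound serves twice: it justifies Fubini, and it suffices near the diagonal and the
endpoints. -/
lemma integral_abs_weightedIncr_mul_le (hY : CenteredGaussianFamily P (procFamily X))
    (h : ConcaveCurve (l2Curve hY) δ κ) (hB : ∀ x, |g x| ≤ B) (hg : Measurable g)
    {u v ε : ℝ} (hu : u ∈ Icc (0 : ℝ) 1) (hv : v ∈ Icc (0 : ℝ) 1) (hε : ε ∈ Icc (0 : ℝ) 1) :
    Integrable (fun ω => weightedIncr X m g ε ω u * weightedIncr X m g ε ω v) P ∧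
    ∫ ω, |weightedIncr X m g ε ω u * weightedIncr X m g ε ω v| ∂P ≤
      B ^ 2 * gaussMoment (2 * m) * δ ε ^ (2 * m) := by
  have hδ := h.nonneg ε hε
  have hB0 : 0 ≤ B := (abs_nonneg _).trans (hB 0)
  have hG : ∀ v, AllMoments P (fun ω => g (procFamily X v ω)) := fun v =>
    AllMoments.of_bound (hg.comp_aemeasurable (hY.law v).aemeasurable).aestronglyMeasurable
      fun _ => hB _
  have hM : AllMoments P (fun ω => weightedIncr X m g ε ω u * weightedIncr X m g ε ω v) := by
    simp_rw [weightedIncr_eq hu.1 hε.1, weightedIncr_eq hv.1 hε.1]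
    exact (((hY.allMoments _).pow m).mul (hG _)).mul (((hY.allMoments _).pow m).mul (hG _))
  refine ⟨hM.integrable, ?_⟩
  have h1 := hY.abs_integral_pow_mul_pow_le (incrVec ε u) (incrVec ε v) m m hδ
    (famCov_incrVec_le hY h hu hε) hδ (famCov_incrVec_le hY h hv hε)
  rw [Real.mul_self_sqrt (gaussMoment_nonneg _), ← pow_add, ← two_mul] at h1
  calc _ ≤ ∫ ω, B ^ 2 * (|procFamily X (incrVec ε u) ω| ^ m *
          |procFamily X (incrVec ε v) ω| ^ m) ∂P := by
        refine integral_mono hM.abs.integrable ((((hY.allMoments _).abs.pow m).mul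
          ((hY.allMoments _).abs.pow m)).integrable.const_mul _) fun ω => ?_
        simp only [weightedIncr_eq hu.1 hε.1, weightedIncr_eq hv.1 hε.1, abs_mul, abs_pow]
        calc _ = (|g (procFamily X (midVec ε u) ω)| * |g (procFamily X (midVec ε v) ω)|) *
              (|procFamily X (incrVec ε u) ω| ^ m * |procFamily X (incrVec ε v) ω| ^ m) := by ring
          _ ≤ (B * B) *
              (|procFamily X (incrVec ε u) ω| ^ m * |procFamily X (incrVec ε v) ω| ^ m) := by
              gcongr <;> exact hB _
          _ = _ := by ring
    _ ≤ _ := by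
        rw [integral_const_mul, mul_assoc]
        gcongr

/-- The squared norms of single points cancel in the rectangular difference. -/
lemma inner_incr_incr {H : Type*} [NormedAddCommGroup H] [InnerProductSpace ℝ H] (x : ℝ → H)
    (ε u v : ℝ) : inner ℝ (incr x ε u) (incr x ε v) =
      -(‖x v - x u‖ ^ 2 - ‖x (v + ε) - x u‖ ^ 2 - ‖x v - x (u + ε)‖ ^ 2 +
        ‖x (v + ε) - x (u + ε)‖ ^ 2) / 2 := by
  simp only [incr, norm_sub_sq_real, inner_sub_left, inner_sub_right]
  rw [real_inner_comm (x (u + ε)) (x v), real_inner_comm (x u) (x v),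
    real_inner_comm (x (u + ε)) (x (v + ε)), real_inner_comm (x u) (x (v + ε))]
  ring

/-- Away from the diagonal and from the origin, the covariance of the weighted increments is of
second order. -/
theorem exists_abs_integral_weightedIncr_mul_le (hY : CenteredGaussianFamily P (procFamily X))
    (h : ConcaveCurve (l2Curve hY) δ κ) (hm : Odd m) (hB : ∀ x, |g x| ≤ B) (hg : Measurable g) :
    ∃ K C : ℝ, 8 ≤ K ∧ 0 < C ∧ ∀ u w ε : ℝ, 0 < ε → K * ε ≤ u → K * ε ≤ w → u + w + ε ≤ 1 →
      |∫ ω, weightedIncr X m g ε ω u * weightedIncr X m g ε ω (u + w) ∂P| ≤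
        CenteredGaussianFamily.weightedConst m * B ^ 2 * (|canonMetricSq P X u (u + w) - canonMetricSq P X u (u + w + ε) -
          canonMetricSq P X (u + ε) (u + w) + canonMetricSq P X (u + ε) (u + w + ε)| / 2 +
          2 * (C * ε * (δ (min u w) / min u w)) ^ 2) * δ ε ^ (2 * m - 2) := by
  obtain ⟨K, C, hK, hC, hreg⟩ := h.exists_regression
  refine ⟨K, C, hK, hC, fun u w ε hε hKu hKw hv => ?_⟩
  have h8 : 8 * ε ≤ K * ε := by gcongr
  have hu : u ∈ Icc (0 : ℝ) 1 := ⟨by linarith, by linarith⟩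
  have huw : u + w ∈ Icc (0 : ℝ) 1 := ⟨by linarith, by linarith⟩
  have hεm : ε ∈ Icc (0 : ℝ) 1 := ⟨hε.le, by linarith⟩
  obtain ⟨a₁, b₁, o1, o2, hα⟩ := hreg u w ε hε hKu hKw hv _ (Or.inl rfl)
  obtain ⟨a₂, b₂, o3, o4, hβ⟩ := hreg u w ε hε hKu hKw hv _ (Or.inr rfl)
  set p := midVec ε u with hp
  set q := midVec ε (u + w) with hq
  set d := incrVec ε u with hd
  set d' := incrVec ε (u + w) with hd'
  set α := a₁ • p + b₁ • q with hαdef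
  set β := a₂ • p + b₂ • q with hβdef
  set M := C * ε * (δ (min u w) / min u w) with hM
  simp only [← toL2_incrVec, ← toL2_midVec, ← map_smul, ← map_add, ← map_sub, ← hp, ← hq, ← hd,
    ← hd', ← hαdef, ← hβdef] at o1 o2 o3 o4 hα hβ
  have hδ := h.nonneg ε hεm
  have hcomb : ∀ (e : Lp ℝ 2 P) (a b : ℝ), inner ℝ e (hY.toL2 p) = 0 →
      inner ℝ e (hY.toL2 q) = 0 → inner ℝ e (hY.toL2 (a • p + b • q)) = 0 := by
    intro e a b h1 h2
    rw [map_add, map_smul, map_smul, inner_add_right, inner_smul_right, inner_smul_right, h1, h2]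
    simp
  have oα : inner ℝ (hY.toL2 (d - α)) (hY.toL2 α) = 0 := hcomb _ _ _ o1 o2
  have oβ : inner ℝ (hY.toL2 (d' - β)) (hY.toL2 β) = 0 := hcomb _ _ _ o3 o4
  have oαβ : inner ℝ (hY.toL2 (d - α)) (hY.toL2 β) = 0 := hcomb _ _ _ o1 o2
  have oβα : inner ℝ (hY.toL2 (d' - β)) (hY.toL2 α) = 0 := hcomb _ _ _ o3 o4
  -- Pythagoras bounds both the residual and the regression by δ(ε).
  have hpyth : ∀ e a : ℝ →₀ ℝ, inner ℝ (hY.toL2 (e - a)) (hY.toL2 a) = 0 →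
      ‖hY.toL2 e‖ ^ 2 = ‖hY.toL2 (e - a)‖ ^ 2 + ‖hY.toL2 a‖ ^ 2 := by
    intro e a ho
    have e1 : hY.toL2 e = hY.toL2 (e - a) + hY.toL2 a := by rw [← map_add, sub_add_cancel]
    rw [e1, norm_add_sq_real, ho]
    ring
  have hd1 : ‖hY.toL2 d‖ ^ 2 ≤ δ ε ^ 2 := by
    rw [hY.norm_toL2_sq]; exact famCov_incrVec_le hY h hu hεm
  have hd2 : ‖hY.toL2 d'‖ ^ 2 ≤ δ ε ^ 2 := by
    rw [hY.norm_toL2_sq]; exact famCov_incrVec_le hY h huw hεm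
  have hp1 := hpyth d α oα
  have hp2 := hpyth d' β oβ
  have hn1 := sq_nonneg ‖hY.toL2 (d - α)‖
  have hn2 := sq_nonneg ‖hY.toL2 (d' - β)‖
  have hn3 := sq_nonneg ‖hY.toL2 α‖
  have hn4 := sq_nonneg ‖hY.toL2 β‖
  have key := hY.abs_integral_weighted_le hm (r := d - α) (s := d' - β) (p := p) (q := q)
    (by rw [← hY.inner_toL2, o1]) (by rw [← hY.inner_toL2, o2]) (by rw [← hY.inner_toL2, o3])
    (by rw [← hY.inner_toL2, o4]) hαdef hβdef (t := δ ε) (a := ‖hY.toL2 α‖) (b := ‖hY.toL2 β‖)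
    (B := B * B)
    hδ (norm_nonneg _) (norm_nonneg _)
    (abs_le_of_sq_le_sq' (by linarith) hδ).2 (abs_le_of_sq_le_sq' (by linarith) hδ).2
    (by rw [← hY.norm_toL2_sq]; linarith) (by rw [← hY.norm_toL2_sq]; linarith)
    (hY.norm_toL2_sq α).ge (hY.norm_toL2_sq β).ge
    (G := fun z => g z.1 * g z.2) (by fun_prop) (fun z => by
      rw [abs_mul]
      exact mul_le_mul (hB _) (hB _) (abs_nonneg _) ((abs_nonneg _).trans (hB 0)))
  have e1 : ∀ ω, weightedIncr X m g ε ω u * weightedIncr X m g ε ω (u + w) =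
      (procFamily X α ω + procFamily X (d - α) ω) ^ m *
        (procFamily X β ω + procFamily X (d' - β) ω) ^ m *
        (g (procFamily X p ω) * g (procFamily X q ω)) := by
    intro ω
    rw [weightedIncr_eq hu.1 hε.le, weightedIncr_eq huw.1 hε.le, map_sub, map_sub, Pi.sub_apply,
      Pi.sub_apply, add_sub_cancel, add_sub_cancel]
    ring
  simp_rw [e1]
  refine key.trans ?_
  -- The residual covariance is that of the increments minus ⟨α, β⟩. This extra term, together with
  -- the ‖α‖‖β‖ already in `key`, gives the factor 2 in front of M².
  have hcov : |famCov P (procFamily X) (d - α) (d' - β)| ≤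
      |canonMetricSq P X u (u + w) - canonMetricSq P X u (u + w + ε) -
          canonMetricSq P X (u + ε) (u + w) + canonMetricSq P X (u + ε) (u + w + ε)| / 2 +
        ‖hY.toL2 α‖ * ‖hY.toL2 β‖ := by
    have h1 : inner ℝ (hY.toL2 d) (hY.toL2 d') =
        inner ℝ (hY.toL2 (d - α)) (hY.toL2 (d' - β)) + inner ℝ (hY.toL2 α) (hY.toL2 β) := by
      have e1 : hY.toL2 d = hY.toL2 (d - α) + hY.toL2 α := by rw [← map_add, sub_add_cancel]
      have e2 : hY.toL2 d' = hY.toL2 (d' - β) + hY.toL2 β := by rw [← map_add, sub_add_cancel]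
      rw [e1, e2, inner_add_left, inner_add_right, inner_add_right, oαβ,
        real_inner_comm (hY.toL2 (d' - β)) (hY.toL2 α), oβα]
      ring
    have h2 : |inner ℝ (hY.toL2 d) (hY.toL2 d')| =
        |canonMetricSq P X u (u + w) - canonMetricSq P X u (u + w + ε) -
          canonMetricSq P X (u + ε) (u + w) + canonMetricSq P X (u + ε) (u + w + ε)| / 2 := by
      rw [hd, hd', toL2_incrVec, toL2_incrVec, inner_incr_incr,
        norm_l2Curve_sub_sq hY hu.1 huw.1, norm_l2Curve_sub_sq hY hu.1 (by linarith [huw.1]),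
        norm_l2Curve_sub_sq hY (by linarith [hu.1]) huw.1,
        norm_l2Curve_sub_sq hY (by linarith [hu.1]) (by linarith [huw.1]), abs_div, abs_neg,
        abs_two]
    rw [← hY.inner_toL2, eq_sub_of_add_eq h1.symm]
    exact (abs_sub _ _).trans (add_le_add h2.le (abs_real_inner_le_norm _ _))
  have hMM : ‖hY.toL2 α‖ * ‖hY.toL2 β‖ ≤ M ^ 2 := by
    rw [sq]
    exact mul_le_mul hα hβ (norm_nonneg _) ((norm_nonneg _).trans hα)
  have hW := CenteredGaussianFamily.weightedConst_nonneg m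
  rw [← sq B]
  refine mul_le_mul_of_nonneg_right (mul_le_mul_of_nonneg_left ?_ (by positivity)) (by positivity)
  linarith

end Pointwise

/-! ### Fubini for the second moment -/

section SecondMoment

variable {Ω : Type*} [MeasurableSpace Ω] {P : Measure Ω} [IsProbabilityMeasure P]

/-- Fubini's theorem for the second moment of the integral of a process with bounded second
moments. -/
theorem second_moment_integral {f : Ω → ℝ → ℝ} (hf : Measurable (Function.uncurry f)) {M : ℝ}
    (hM : ∀ u ∈ Icc (0 : ℝ) 1, ∀ v ∈ Icc (0 : ℝ) 1, Integrable (fun ω => f ω u * f ω v) P ∧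
      ∫ ω, |f ω u * f ω v| ∂P ≤ M) :
    (∀ᵐ ω ∂P, IntervalIntegrable (f ω) volume 0 1) ∧
    MemLp (fun ω => ∫ u in (0 : ℝ)..1, f ω u) 2 P ∧
    ENNReal.ofReal (∫ ω, (∫ u in (0 : ℝ)..1, f ω u) ^ 2 ∂P) ≤
      ∫⁻ p in Ioc (0 : ℝ) 1 ×ˢ Ioc (0 : ℝ) 1, ENNReal.ofReal |∫ ω, f ω p.1 * f ω p.2 ∂P| := by
  set I : Measure ℝ := volume.restrict (Ioc (0 : ℝ) 1) with hI
  have hIfin : IsFiniteMeasure I := ⟨by simp [hI]⟩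
  have hII : I.prod I = volume.restrict (Ioc (0 : ℝ) 1 ×ˢ Ioc (0 : ℝ) 1) := by
    rw [hI, Measure.prod_restrict, Measure.volume_eq_prod]
  have hmem : ∀ᵐ p ∂(I.prod I), p ∈ Ioc (0 : ℝ) 1 ×ˢ Ioc (0 : ℝ) 1 := by
    rw [hII]
    exact ae_restrict_mem (measurableSet_Ioc.prod measurableSet_Ioc)
  have hG : Measurable fun z : Ω × ℝ × ℝ => f z.1 z.2.1 * f z.1 z.2.2 :=
    (hf.comp (measurable_fst.prodMk (measurable_fst.comp measurable_snd))).mul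
      (hf.comp (measurable_fst.prodMk (measurable_snd.comp measurable_snd)))
  have hGint : Integrable (fun z : Ω × ℝ × ℝ => f z.1 z.2.1 * f z.1 z.2.2) (P.prod (I.prod I)) := by
    rw [integrable_prod_iff' hG.aestronglyMeasurable]
    refine ⟨?_, ?_⟩
    · filter_upwards [hmem] with p hp
      exact (hM p.1 (Ioc_subset_Icc_self hp.1) p.2 (Ioc_subset_Icc_self hp.2)).1
    · refine Integrable.of_bound (C := M) ?_ ?_
      · exact (hG.norm.stronglyMeasurable.integral_prod_left'
          (μ := P)).aestronglyMeasurable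
      · filter_upwards [hmem] with p hp
        have := (hM p.1 (Ioc_subset_Icc_self hp.1) p.2 (Ioc_subset_Icc_self hp.2)).2
        rw [Real.norm_of_nonneg (integral_nonneg fun _ => norm_nonneg _)]
        exact this
  have hf2 : MemLp (fun z : Ω × ℝ => f z.1 z.2) 2 (P.prod I) := by
    have hfm : AEStronglyMeasurable (fun z : Ω × ℝ => f z.1 z.2) (P.prod I) :=
      hf.aestronglyMeasurable
    have hfm2 : AEStronglyMeasurable (fun z : Ω × ℝ => f z.1 z.2 ^ 2) (P.prod I) := hfm.pow 2
    rw [memLp_two_iff_integrable_sq hfm, integrable_prod_iff' hfm2]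
    have hmem1 : ∀ᵐ u ∂I, u ∈ Ioc (0 : ℝ) 1 := ae_restrict_mem measurableSet_Ioc
    refine ⟨?_, ?_⟩
    · filter_upwards [hmem1] with u hu
      simpa only [sq] using (hM u (Ioc_subset_Icc_self hu) u (Ioc_subset_Icc_self hu)).1
    · refine Integrable.of_bound (C := M) ?_ ?_
      · exact ((hf.pow_const 2).norm.stronglyMeasurable.integral_prod_left'
          (μ := P)).aestronglyMeasurable
      · filter_upwards [hmem1] with u hu
        have := (hM u (Ioc_subset_Icc_self hu) u (Ioc_subset_Icc_self hu)).2
        rw [Real.norm_of_nonneg (integral_nonneg fun _ => norm_nonneg _)]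
        simpa only [sq, Real.norm_eq_abs] using this
  -- This holds for every ω, integrable or not, by the conventions for the Bochner integral.
  have hsq : ∀ ω, (∫ u in (0 : ℝ)..1, f ω u) ^ 2 = ∫ p, f ω p.1 * f ω p.2 ∂(I.prod I) := by
    intro ω
    rw [integral_prod_mul, intervalIntegral.integral_of_le zero_le_one, sq]
  refine ⟨?_, ?_, ?_⟩
  · filter_upwards [(hf2.integrable one_le_two).prod_right_ae] with ω hω
    rw [intervalIntegrable_iff_integrableOn_Ioc_of_le zero_le_one]
    exact hω
  · have hmeas : AEStronglyMeasurable (fun ω => ∫ u in (0 : ℝ)..1, f ω u) P := by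
      simp_rw [intervalIntegral.integral_of_le (zero_le_one (α := ℝ))]
      exact (hf.stronglyMeasurable.integral_prod_right (ν := I)).aestronglyMeasurable
    rw [memLp_two_iff_integrable_sq hmeas]
    simp_rw [hsq]
    exact hGint.integral_prod_left
  · simp_rw [hsq]
    rw [integral_integral_swap hGint, ← hII]
    calc _ ≤ ‖∫ p, ∫ ω, f ω p.1 * f ω p.2 ∂P ∂(I.prod I)‖ₑ := by
          rw [Real.enorm_eq_ofReal_abs]
          exact ENNReal.ofReal_le_ofReal (le_abs_self _)
      _ ≤ ∫⁻ p, ‖∫ ω, f ω p.1 * f ω p.2 ∂P‖ₑ ∂(I.prod I) := enorm_integral_le_lintegral_enorm _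
      _ = _ := by simp_rw [Real.enorm_eq_ofReal_abs]

end SecondMoment

/-! ### Integration over the unit square -/

section Square

/-- The unit square. -/
abbrev unitSq : Set (ℝ × ℝ) := Ioc (0 : ℝ) 1 ×ˢ Ioc (0 : ℝ) 1

lemma measurableSet_unitSq : MeasurableSet unitSq := measurableSet_Ioc.prod measurableSet_Ioc

lemma lintegral_unitSq_le_of_sections {k : ℝ × ℝ → ENNReal} (hk : Measurable k) {J : ENNReal}
    (h : ∀ u, ∫⁻ v in Ioc (0 : ℝ) 1, k (u, v) ≤ J) : ∫⁻ p in unitSq, k p ≤ J := by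
  rw [Measure.volume_eq_prod, ← Measure.prod_restrict, lintegral_prod _ hk.aemeasurable]
  calc _ ≤ ∫⁻ _u in Ioc (0 : ℝ) 1, J := lintegral_mono fun u => h u
    _ = J := by simp

lemma lintegral_unitSq_fst_le {h : ℝ → ENNReal} (hh : Measurable h) :
    ∫⁻ p in unitSq, h p.1 ≤ ∫⁻ r, h r := by
  rw [Measure.volume_eq_prod, ← Measure.prod_restrict,
    lintegral_prod (fun p : ℝ × ℝ => h p.1) (by fun_prop)]
  simp only [lintegral_const, Measure.restrict_apply_univ, Real.volume_Ioc, sub_zero,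
    ENNReal.ofReal_one, mul_one]
  exact setLIntegral_le_lintegral _ _

lemma lintegral_unitSq_sub_le {h : ℝ → ENNReal} (hh : Measurable h) :
    ∫⁻ p in unitSq, h (p.2 - p.1) ≤ ∫⁻ r, h r :=
  lintegral_unitSq_le_of_sections (k := fun p => h (p.2 - p.1)) (by fun_prop) fun u =>
    (setLIntegral_le_lintegral _ _).trans (lintegral_sub_right_eq_self h u).le

lemma lintegral_unitSq_one_sub_le {h : ℝ → ENNReal} (hh : Measurable h) :
    ∫⁻ p in unitSq, h (1 - p.2) ≤ ∫⁻ r, h r :=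
  lintegral_unitSq_le_of_sections (k := fun p => h (1 - p.2)) (by fun_prop) fun _ =>
    (setLIntegral_le_lintegral _ _).trans (lintegral_sub_left_eq_self h 1).le

lemma lintegral_unitSq_le_two_mul {E : ℝ × ℝ → ENNReal} (hE : Measurable E)
    (hsymm : ∀ p, E p.swap = E p) :
    ∫⁻ p in unitSq, E p ≤ 2 * ∫⁻ p in unitSq ∩ {p | p.1 ≤ p.2}, E p := by
  set T := unitSq ∩ {p : ℝ × ℝ | p.1 ≤ p.2} with hT
  have hTm : MeasurableSet T :=
    measurableSet_unitSq.inter (measurableSet_le measurable_fst measurable_snd)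
  have hsub : unitSq ⊆ T ∪ Prod.swap ⁻¹' T := by
    intro p hp
    rcases le_total p.1 p.2 with h | h
    · exact Or.inl ⟨hp, h⟩
    · exact Or.inr ⟨⟨hp.2, hp.1⟩, h⟩
  have hswap : ∫⁻ p in Prod.swap ⁻¹' T, E p = ∫⁻ p in T, E p := by
    have hmp : MeasurePreserving (Prod.swap : ℝ × ℝ → ℝ × ℝ) volume volume := by
      rw [Measure.volume_eq_prod]
      exact Measure.measurePreserving_swap
    rw [← hmp.setLIntegral_comp_preimage hTm hE]
    simp_rw [hsymm]
  calc _ ≤ ∫⁻ p in T ∪ Prod.swap ⁻¹' T, E p := lintegral_mono_set hsub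
    _ ≤ _ := lintegral_union_le _ _ _
    _ = _ := by rw [hswap, two_mul]

/-- The integral over the unit square of a symmetric function that is bounded, on one side of the
diagonal, by functions of `u`, `v - u`, `1 - v` and by the mass of small squares. -/
theorem lintegral_unitSq_le {E : ℝ × ℝ → ENNReal} (hE : Measurable E)
    (hsymm : ∀ p, E p.swap = E p) {ψ φ : ℝ → ENNReal} (hψ : Measurable ψ) (hφ : Measurable φ)
    (ν : Measure (ℝ × ℝ)) [SFinite ν] {h : ℝ} {c₁ c₂ c₃ : ENNReal} (hc₂ : c₂ ≠ ⊤)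
    (hbound : ∀ p ∈ unitSq, p.1 ≤ p.2 → E p ≤
      c₁ * (ψ p.1 + ψ (p.2 - p.1) + ψ (1 - p.2)) + (c₃ * (φ p.1 + φ (p.2 - p.1)) +
        c₂ * ν (Icc p.1 (p.1 + h) ×ˢ Icc p.2 (p.2 + h)))) :
    ∫⁻ p in unitSq, E p ≤ 2 * (c₁ * (3 * ∫⁻ r, ψ r) + (c₃ * (2 * ∫⁻ r, φ r) +
      c₂ * (ENNReal.ofReal h ^ 2 * ν univ))) := by
  refine (lintegral_unitSq_le_two_mul hE hsymm).trans ?_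
  gcongr
  have hTm : MeasurableSet (unitSq ∩ {p : ℝ × ℝ | p.1 ≤ p.2}) :=
    measurableSet_unitSq.inter (measurableSet_le measurable_fst measurable_snd)
  calc _ ≤ ∫⁻ p in unitSq ∩ {p | p.1 ≤ p.2},
        (c₁ * (ψ p.1 + ψ (p.2 - p.1) + ψ (1 - p.2)) + (c₃ * (φ p.1 + φ (p.2 - p.1)) +
        c₂ * ν (Icc p.1 (p.1 + h) ×ˢ Icc p.2 (p.2 + h)))) :=
        setLIntegral_mono' hTm fun p hp => hbound p hp.1 hp.2
    _ ≤ ∫⁻ p in unitSq, (c₁ * (ψ p.1 + ψ (p.2 - p.1) + ψ (1 - p.2)) +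
        (c₃ * (φ p.1 + φ (p.2 - p.1)) +
        c₂ * ν (Icc p.1 (p.1 + h) ×ˢ Icc p.2 (p.2 + h)))) :=
        lintegral_mono_set inter_subset_left
    _ = c₁ * ((∫⁻ p in unitSq, ψ p.1) + (∫⁻ p in unitSq, ψ (p.2 - p.1)) +
          ∫⁻ p in unitSq, ψ (1 - p.2)) +
        (c₃ * ((∫⁻ p in unitSq, φ p.1) + ∫⁻ p in unitSq, φ (p.2 - p.1)) +
          c₂ * ∫⁻ p in unitSq, ν (Icc p.1 (p.1 + h) ×ˢ Icc p.2 (p.2 + h))) := by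
        -- The mass of small squares is kept as the last summand and its constant is finite, so its
        -- measurability in p is never needed.
        rw [lintegral_add_left (by fun_prop), lintegral_add_left (by fun_prop),
          lintegral_const_mul _ (by fun_prop), lintegral_const_mul _ (by fun_prop),
          lintegral_const_mul' _ _ hc₂, lintegral_add_left (by fun_prop),
          lintegral_add_left (by fun_prop), lintegral_add_left (by fun_prop)]
    _ ≤ c₁ * ((∫⁻ r, ψ r) + (∫⁻ r, ψ r) + ∫⁻ r, ψ r) + (c₃ * ((∫⁻ r, φ r) + ∫⁻ r, φ r) +
          c₂ * (ENNReal.ofReal h ^ 2 * ν univ)) := by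
        gcongr
        · exact lintegral_unitSq_fst_le hψ
        · exact lintegral_unitSq_sub_le hψ
        · exact lintegral_unitSq_one_sub_le hψ
        · exact lintegral_unitSq_fst_le hφ
        · exact lintegral_unitSq_sub_le hφ
        · exact (setLIntegral_le_lintegral _ _).trans (lintegral_measure_rect_le ν)
    _ = _ := by ring

end Square

/-! ### The second moment at a fixed scale -/

section MainBound

variable {Ω : Type*} [MeasurableSpace Ω] {P : Measure Ω} [IsProbabilityMeasure P] {X : ℝ → Ω → ℝ}

lemma measurable_uncurry_weightedIncr (hX : Measurable (Function.uncurry X)) {g : ℝ → ℝ}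
    (hg : Measurable g) (m : ℕ) (ε : ℝ) :
    Measurable (Function.uncurry (weightedIncr X m g ε)) := by
  have h0 : Measurable fun z : Ω × ℝ => X z.2 z.1 :=
    hX.comp (measurable_snd.prodMk measurable_fst)
  have h1 : Measurable fun z : Ω × ℝ => X (z.2 + ε) z.1 :=
    hX.comp ((measurable_snd.add_const ε).prodMk measurable_fst)
  exact ((h1.sub h0).pow_const m).mul (hg.comp ((h1.add h0).div_const 2))

lemma lintegral_indicator_Icc_zero (t : ℝ) :
    ∫⁻ r, (Icc (0 : ℝ) t).indicator (fun _ => 1) r = ENNReal.ofReal t := by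
  rw [lintegral_indicator measurableSet_Icc]
  simp

lemma lintegral_indicator_Ioi_rpow {p ε : ℝ} (hp : p < -1) (hε : 0 < ε) :
    ∫⁻ r, (Ioi ε).indicator (fun r => ENNReal.ofReal (r ^ p)) r =
      ENNReal.ofReal (-ε ^ (p + 1) / (p + 1)) := by
  rw [lintegral_indicator measurableSet_Ioi, ← integral_Ioi_rpow_of_lt hp hε,
    ofReal_integral_eq_lintegral_ofReal (integrableOn_Ioi_rpow_of_lt hp hε)]
  filter_upwards [ae_restrict_mem measurableSet_Ioi] with r hr
  exact Real.rpow_nonneg (hε.le.trans (le_of_lt hr)) _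

/-- A concave curve whose dominating function is `O(r ^ q)` at `0` satisfies this bound on the
whole unit interval. -/
lemma ConcaveCurve.exists_sq_le {H : Type*} [NormedAddCommGroup H] [InnerProductSpace ℝ H]
    {x : ℝ → H} {δ : ℝ → ℝ} {κ : ℝ} (h : ConcaveCurve x δ κ) {q : ℝ} (hq : 0 ≤ q)
    (hδ : δ =o[𝓝[>] (0 : ℝ)] fun r => r ^ q) :
    ∃ D : ℝ, 0 ≤ D ∧ ∀ y, 0 < y → y ≤ 1 → δ y ^ 2 ≤ D * y ^ (2 * q) := by
  have h1 := hδ.bound one_pos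
  rw [eventually_nhdsWithin_iff, Metric.eventually_nhds_iff] at h1
  obtain ⟨r, hr, h1⟩ := h1
  have hrq : 0 < r ^ (2 * q) := Real.rpow_pos_of_pos hr _
  refine ⟨1 + δ 1 ^ 2 / r ^ (2 * q), by positivity, fun y hy hy1 => ?_⟩
  have hyq : 0 < y ^ (2 * q) := Real.rpow_pos_of_pos hy _
  have hδy := h.nonneg y ⟨hy.le, hy1⟩
  rcases lt_or_ge y r with hlt | hge
  · have h2 := h1 (y := y) (by rwa [Real.dist_eq, sub_zero, abs_of_pos hy]) hy
    have hyq' : 0 ≤ y ^ q := Real.rpow_nonneg hy.le _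
    rw [one_mul, Real.norm_of_nonneg hδy, Real.norm_of_nonneg hyq'] at h2
    have h3 : y ^ (2 * q) = (y ^ q) ^ 2 := by
      rw [mul_comm, Real.rpow_mul hy.le]
      norm_cast
    have h4 : δ y ^ 2 ≤ y ^ (2 * q) := by
      rw [h3]
      gcongr
    refine h4.trans (le_mul_of_one_le_left hyq.le ?_)
    have : 0 ≤ δ 1 ^ 2 / r ^ (2 * q) := by positivity
    linarith
  · have h2 : r ^ (2 * q) ≤ y ^ (2 * q) := Real.rpow_le_rpow hr.le hge (by positivity)
    have h3 : δ y ^ 2 ≤ δ 1 ^ 2 := by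
      have := h.mono hy.le hy1 le_rfl
      gcongr
    calc δ y ^ 2 ≤ δ 1 ^ 2 := h3
      _ = δ 1 ^ 2 / r ^ (2 * q) * r ^ (2 * q) := by field_simp
      _ ≤ δ 1 ^ 2 / r ^ (2 * q) * y ^ (2 * q) := by gcongr
      _ ≤ _ := by
        rw [one_add_mul]
        linarith

variable {δ : ℝ → ℝ} {κ : ℝ} {m : ℕ} {g : ℝ → ℝ} {B : ℝ} {μp μn : Measure (ℝ × ℝ)}

lemma weightedIncr_swap (ε : ℝ) (u v : ℝ) :
    ∫ ω, weightedIncr X m g ε ω u * weightedIncr X m g ε ω v ∂P =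
      ∫ ω, weightedIncr X m g ε ω v * weightedIncr X m g ε ω u ∂P := by
  simp_rw [mul_comm]

/-- The second moment of the weighted sum of odd powers, at a fixed scale `ε`. -/
theorem lintegral_unitSq_weightedIncr_le (hX : Measurable (Function.uncurry X))
    (hY : CenteredGaussianFamily P (procFamily X))
    (h : ConcaveCurve (l2Curve hY) δ κ) (hm : 3 ≤ m) (hB : ∀ x, |g x| ≤ B) (hg : Measurable g)
    {K C D : ℝ} (hK : 8 ≤ K) (hD0 : 0 ≤ D)
    (hKC : ∀ u w ε : ℝ, 0 < ε → K * ε ≤ u → K * ε ≤ w → u + w + ε ≤ 1 →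
      |∫ ω, weightedIncr X m g ε ω u * weightedIncr X m g ε ω (u + w) ∂P| ≤
        CenteredGaussianFamily.weightedConst m * B ^ 2 * (|canonMetricSq P X u (u + w) -
          canonMetricSq P X u (u + w + ε) - canonMetricSq P X (u + ε) (u + w) +
          canonMetricSq P X (u + ε) (u + w + ε)| / 2 +
          2 * (C * ε * (δ (min u w) / min u w)) ^ 2) * δ ε ^ (2 * m - 2))
    (hD : ∀ y, 0 < y → y ≤ 1 → δ y ^ 2 ≤ D * y ^ (1 / (m : ℝ)))
    (hμ : HasMixedDerivMeasure (canonMetricSq P X) μp μn)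
    (hF : ContinuousOn (fun p : ℝ × ℝ => canonMetricSq P X p.1 p.2) (Icc 0 1 ×ˢ Icc 0 1))
    {ε : ℝ} (hε : 0 < ε) (hε1 : ε ≤ 1) (hfin : (μp + μn) (offDiagSimplex ε) < ⊤) :
    ∫⁻ p in unitSq, ENNReal.ofReal
        |∫ ω, weightedIncr X m g ε ω p.1 * weightedIncr X m g ε ω p.2 ∂P| ≤
      2 * (ENNReal.ofReal (B ^ 2 * gaussMoment (2 * m) * δ ε ^ (2 * m)) *
          (3 * ENNReal.ofReal (K * ε)) +
        (ENNReal.ofReal (2 * CenteredGaussianFamily.weightedConst m * B ^ 2 * C ^ 2 * D * ε ^ 2 *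
            δ ε ^ (2 * m - 2)) *
          (2 * ENNReal.ofReal (ε ^ (-((m : ℝ) - 1) / m) * (m / (m - 1)))) +
        ENNReal.ofReal (CenteredGaussianFamily.weightedConst m * B ^ 2 * δ ε ^ (2 * m - 2) / 2) *
          (ENNReal.ofReal (2 * ε) ^ 2 * (μp + μn) (offDiagSimplex ε)))) := by
  have hm0 : (3 : ℝ) ≤ m := by exact_mod_cast hm
  have hW := CenteredGaussianFamily.weightedConst_nonneg m
  have hδε := h.nonneg ε ⟨hε.le, hε1⟩
  set W := CenteredGaussianFamily.weightedConst m with hWdef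
  have hGm := gaussMoment_nonneg (2 * m)
  set f : Ω → ℝ → ℝ := weightedIncr X m g ε with hf
  have hfm : Measurable (Function.uncurry f) := measurable_uncurry_weightedIncr hX hg m ε
  have hprod : Measurable fun z : Ω × ℝ × ℝ => f z.1 z.2.1 * f z.1 z.2.2 :=
    (hfm.comp (measurable_fst.prodMk (measurable_fst.comp measurable_snd))).mul
      (hfm.comp (measurable_fst.prodMk (measurable_snd.comp measurable_snd)))
  have hE : Measurable fun p : ℝ × ℝ => ENNReal.ofReal |∫ ω, f ω p.1 * f ω p.2 ∂P| :=
    (hprod.stronglyMeasurable.integral_prod_left' (μ := P)).measurable.norm.ennreal_ofReal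
  have hpm : (1 / (m : ℝ) - 2) < -1 := by
    have : 1 / (m : ℝ) < 1 := by
      rw [div_lt_one (by linarith)]
      linarith
    linarith
  have hφint := lintegral_indicator_Ioi_rpow hpm hε
  have hval : -ε ^ (1 / (m : ℝ) - 2 + 1) / (1 / (m : ℝ) - 2 + 1) =
      ε ^ (-((m : ℝ) - 1) / m) * (m / (m - 1)) := by
    have hm1 : (m : ℝ) - 1 ≠ 0 := by linarith
    have hm2 : (m : ℝ) ≠ 0 := by linarith
    have h1 : 1 / (m : ℝ) - 2 + 1 = -((m : ℝ) - 1) / m := by field_simp; ring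
    rw [h1]
    field_simp
  rw [hval] at hφint
  -- The restriction to the simplex is finite, so Tonelli applies although |μ| may have infinite
  -- mass near the diagonal.
  set ν : Measure (ℝ × ℝ) := (μp + μn).restrict (offDiagSimplex ε) with hν
  have hνfin : IsFiniteMeasure ν := ⟨by rwa [hν, Measure.restrict_apply_univ]⟩
  have hνu : ν univ = (μp + μn) (offDiagSimplex ε) := by rw [hν, Measure.restrict_apply_univ]
  rw [← hφint, ← lintegral_indicator_Icc_zero (K * ε), ← hνu]
  have hKε : 0 < K * ε := by positivity
  refine lintegral_unitSq_le hE (fun p => ?_) (measurable_const.indicator measurableSet_Icc)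
    (Measurable.indicator (by fun_prop) measurableSet_Ioi) ν ENNReal.ofReal_ne_top ?_
  · change ENNReal.ofReal |∫ ω, f ω p.2 * f ω p.1 ∂P| = _
    rw [hf, weightedIncr_swap]
  rintro ⟨u, v⟩ ⟨⟨hu0, hu1⟩, hv0, hv1⟩ huv
  simp only at hu0 hu1 hv0 hv1 huv ⊢
  -- In the first case the sum of indicators is at least 1 and the crude bound is enough; otherwise
  -- there is room for the regression and for the enlarged rectangle.
  by_cases hbad : u ≤ K * ε ∨ v - u ≤ K * ε ∨ 1 - v ≤ K * ε
  · refine le_trans ?_ (le_add_right le_rfl)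
    have hsum : 1 ≤ (Icc 0 (K * ε)).indicator (fun _ => (1 : ENNReal)) u +
        (Icc 0 (K * ε)).indicator (fun _ => (1 : ENNReal)) (v - u) +
        (Icc 0 (K * ε)).indicator (fun _ => (1 : ENNReal)) (1 - v) := by
      rcases hbad with hb | hb | hb
      · rw [indicator_of_mem (show u ∈ Icc 0 (K * ε) from ⟨hu0.le, hb⟩), add_assoc]
        exact le_self_add
      · rw [indicator_of_mem (show v - u ∈ Icc 0 (K * ε) from ⟨by linarith, hb⟩),
          add_right_comm]
        exact le_add_self
      · rw [indicator_of_mem (show 1 - v ∈ Icc 0 (K * ε) from ⟨by linarith, hb⟩)]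
        exact le_add_self
    refine le_trans ?_ (le_mul_of_one_le_right' hsum)
    refine ENNReal.ofReal_le_ofReal ?_
    refine (abs_integral_le_integral_abs).trans ?_
    exact (integral_abs_weightedIncr_mul_le hY h hB hg ⟨hu0.le, hu1⟩ ⟨hv0.le, hv1⟩
      ⟨hε.le, hε1⟩).2
  · push Not at hbad
    obtain ⟨hb1, hb2, hb3⟩ := hbad
    refine le_trans ?_ (le_add_left le_rfl)
    have h8 : 8 * ε ≤ K * ε := by gcongr
    have hmain := hKC u (v - u) ε hε hb1.le hb2.le (by linarith)
    rw [add_sub_cancel] at hmain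
    set y := min u (v - u) with hy
    have hyε : ε < y := lt_min (by linarith) (by linarith)
    have hy0 : 0 < y := hε.trans hyε
    have hy1 : y ≤ 1 := (min_le_left _ _).trans hu1
    set Δ := |canonMetricSq P X u v - canonMetricSq P X u (v + ε) -
      canonMetricSq P X (u + ε) v + canonMetricSq P X (u + ε) (v + ε)| with hΔ
    have hquad : (C * ε * (δ y / y)) ^ 2 ≤ C ^ 2 * D * ε ^ 2 * y ^ (1 / (m : ℝ) - 2) := by
      have h1 : y ^ (1 / (m : ℝ) - 2) = y ^ (1 / (m : ℝ)) / y ^ 2 := by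
        rw [Real.rpow_sub hy0]
        norm_cast
      rw [h1]
      calc _ = C ^ 2 * ε ^ 2 * (δ y ^ 2 / y ^ 2) := by ring
        _ ≤ C ^ 2 * ε ^ 2 * (D * y ^ (1 / (m : ℝ)) / y ^ 2) := by
          have := hD y hy0 hy1
          gcongr
        _ = _ := by ring
    have hypow : 0 ≤ y ^ (1 / (m : ℝ) - 2) := Real.rpow_nonneg hy0.le _
    have hreal : |∫ ω, f ω u * f ω v ∂P| ≤
        2 * W * B ^ 2 * C ^ 2 * D * ε ^ 2 * δ ε ^ (2 * m - 2) * y ^ (1 / (m : ℝ) - 2) +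
        W * B ^ 2 * δ ε ^ (2 * m - 2) / 2 * Δ := by
      refine hmain.trans ?_
      calc _ ≤ W * B ^ 2 * (Δ / 2 + 2 * (C ^ 2 * D * ε ^ 2 * y ^ (1 / (m : ℝ) - 2))) *
            δ ε ^ (2 * m - 2) := by gcongr
        _ = _ := by ring
    refine (ENNReal.ofReal_le_ofReal hreal).trans ?_
    rw [ENNReal.ofReal_add (by positivity) (by positivity), ENNReal.ofReal_mul (by positivity),
      ENNReal.ofReal_mul (p := W * B ^ 2 * δ ε ^ (2 * m - 2) / 2) (by positivity)]
    gcongr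
    -- The minimum is one of u and v-u, so its power is one of the two summands.
    · rcases min_choice u (v - u) with hmin | hmin
      · rw [← hy] at hmin
        rw [hmin] at hyε ⊢
        rw [indicator_of_mem (show u ∈ Ioi ε from hyε)]
        exact le_self_add
      · rw [← hy] at hmin
        rw [hmin] at hyε ⊢
        rw [indicator_of_mem (show v - u ∈ Ioi ε from hyε)]
        exact le_add_self
    -- v-u and 1-v exceed 8ε, so the rectangle of side 2ε stays inside the square and at distance at
    -- least ε from the diagonal.
    · have hrect := hμ.abs_rect_incr_le hF hε hu0 (v := v) (by linarith) (by linarith)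
      refine hrect.trans ?_
      rw [hν, Measure.restrict_apply (measurableSet_Icc.prod measurableSet_Icc),
        inter_eq_left.2]
      rintro ⟨s, t⟩ ⟨⟨h1, h2⟩, h3, h4⟩
      simp only at h1 h2 h3 h4
      exact ⟨by simp only; linarith, by simp only; linarith, by simp only; linarith⟩

end MainBound

/-! ### Conclusion -/

lemma ofReal_second_moment_bound {a k c p d h n : ℝ} (ha : 0 ≤ a) (hk : 0 ≤ k) (hc : 0 ≤ c)
    (hp : 0 ≤ p) (hd : 0 ≤ d) (hh : 0 ≤ h) (hn : 0 ≤ n) :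
    2 * (ENNReal.ofReal a * (3 * ENNReal.ofReal k) + (ENNReal.ofReal c * (2 * ENNReal.ofReal p) +
      ENNReal.ofReal d * (ENNReal.ofReal h ^ 2 * ENNReal.ofReal n))) =
    ENNReal.ofReal (2 * (a * (3 * k) + (c * (2 * p) + d * (h ^ 2 * n)))) := by
  rw [ENNReal.ofReal_mul (by positivity), ENNReal.ofReal_add (by positivity) (by positivity),
    ENNReal.ofReal_add (by positivity) (by positivity), ENNReal.ofReal_mul ha,
    ENNReal.ofReal_mul hc, ENNReal.ofReal_mul hd, ENNReal.ofReal_mul (by positivity),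
    ENNReal.ofReal_mul (by positivity), ENNReal.ofReal_mul (by positivity), ENNReal.ofReal_pow hh,
    ENNReal.ofReal_ofNat, ENNReal.ofReal_ofNat]

theorem mainTheorem4 {Ω : Type*} [MeasurableSpace Ω] (P : Measure Ω) [IsProbabilityMeasure P]
    (m : ℕ) (hm : 3 ≤ m) (hodd : Odd m)
    -- a measurable centered Gaussian process, started at zero; only times in `[0,2]` matter, and a
    -- process on `[0,1]` is covered through its constant extension `X_t = X_1` for `t ≥ 1`
    (X : ℝ → Ω → ℝ) (hXmeas : Measurable (Function.uncurry X))
    (hXgauss : IsGaussianProcess (fun t : Ici (0 : ℝ) => X t) P)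
    (hXcent : ∀ t, 0 ≤ t → ∫ ω, X t ω ∂P = 0)
    (hXzero : ∀ᵐ ω ∂P, X 0 ω = 0)
    -- the univariate function `δ`, with `δ²` increasing and concave, dominating the metric
    (δ : ℝ → ℝ) (hδnonneg : ∀ r ∈ Icc (0 : ℝ) 1, 0 ≤ δ r)
    (hδmono : MonotoneOn (fun r => δ r ^ 2) (Icc 0 1))
    (hδconc : ConcaveOn ℝ (Icc 0 1) (fun r => δ r ^ 2))
    (hδdom : ∀ s ∈ Icc (0 : ℝ) 1, ∀ r ∈ Icc (0 : ℝ) 1, canonMetricSq P X s (s + r) ≤ δ r ^ 2)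
    (hδo : δ =o[𝓝[>] (0 : ℝ)] fun r => r ^ (1 / (2 * (m : ℝ))))
    -- the mixed derivative of the squared canonical metric off the diagonal
    (μp μn : Measure (ℝ × ℝ)) (hμ : HasMixedDerivMeasure (canonMetricSq P X) μp μn)
    (hμOD : ∃ C : ℝ, ∀ᶠ ε in 𝓝[>] (0 : ℝ),
      (μp + μn) (offDiagSimplex ε) ≤ ENNReal.ofReal (C * ε ^ (-((m : ℝ) - 1) / (m : ℝ))))
    -- monotonicity and concavity of the variance and of the squared canonical metric
    (hQmono : MonotoneOn (fun u => covFn P X u u) (Icc 0 1))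
    (hQconc : ConcaveOn ℝ (Icc 0 1) (fun u => covFn P X u u))
    (hδv : ∀ u ∈ Icc (0 : ℝ) 1, MonotoneOn (fun v => canonMetricSq P X u v) (Icc u 1) ∧
      ConcaveOn ℝ (Icc u 1) (fun v => canonMetricSq P X u v))
    (hδu : ∀ v ∈ Icc (0 : ℝ) 1, MonotoneOn (fun u => -canonMetricSq P X u v) (Icc 0 v) ∧
      (ConcaveOn ℝ (Icc 0 v) (fun u => -canonMetricSq P X u v) ∨
        ConcaveOn ℝ (Icc 0 v) (fun u => canonMetricSq P X u v)))
    -- the constants and the conditions (i), (ii), (iii)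
    (a b c c' : ℝ) (ha : 1 < a) (hb0 : 0 < b) (hb : b < 1 / 2) (hc : 1 / 4 < c) (hc' : 0 < c')
    (hi : ∀ u, 0 < u → u < 1 → c * δ u ^ 2 ≤ covFn P X u u)
    (hii : ∀ u v, 0 < u → u < v → v ≤ 1 →
      c' * δ u ^ 2 * δ (v - u) ^ 2 ≤ covFn P X u u * covFn P X v v - covFn P X u v ^ 2)
    (hiii : ∀ u, 0 < u → a * u ≤ 1 → (δ (a * u) - δ u) / ((a - 1) * u) < b * (δ u / u))
    -- the bounded measurable weight
    (g : ℝ → ℝ) (hgmeas : Measurable g) (hgbdd : ∃ B : ℝ, ∀ x, |g x| ≤ B) :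
    (∀ ε : ℝ, 0 < ε → ε ≤ 1 →
      (∀ᵐ ω ∂P, IntervalIntegrable (weightedIncr X m g ε ω) volume 0 1) ∧
      MemLp (fun ω => ∫ u in (0 : ℝ)..1, weightedIncr X m g ε ω u) 2 P) ∧
    Tendsto
      (fun ε : ℝ => 1 / ε ^ 2 * ∫ ω, (∫ u in (0 : ℝ)..1, weightedIncr X m g ε ω u) ^ 2 ∂P)
      (𝓝[>] 0) (𝓝 0) := by
  obtain ⟨B, hB⟩ := hgbdd
  have hY := centeredGaussianFamily hXgauss hXcent
  have h := concaveCurve_l2Curve hY hXzero hδnonneg hδmono hδconc hδdom hδv hδu ha hc' hii hiii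
  have hm0 : (3 : ℝ) ≤ m := by exact_mod_cast hm
  have hfirst : ∀ ε : ℝ, 0 < ε → ε ≤ 1 → _ := fun ε hε hε1 =>
    second_moment_integral (P := P) (measurable_uncurry_weightedIncr hXmeas hgmeas m ε)
      fun u hu v hv => integral_abs_weightedIncr_mul_le hY h hB hgmeas hu hv ⟨hε.le, hε1⟩
  refine ⟨fun ε hε hε1 => ⟨(hfirst ε hε hε1).1, (hfirst ε hε hε1).2.1⟩, ?_⟩
  have hq : 0 < 1 / (2 * (m : ℝ)) := by positivity
  have hδ0 : Tendsto δ (𝓝[>] 0) (𝓝 0) := by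
    refine hδo.trans_tendsto ?_
    have h1 := (Real.continuous_rpow_const hq.le).tendsto 0
    rw [Real.zero_rpow hq.ne'] at h1
    exact h1.mono_left nhdsWithin_le_nhds
  have hx := h.continuousOn_metric hδ0
  have hF : ContinuousOn (fun p : ℝ × ℝ => canonMetricSq P X p.1 p.2) (Icc 0 1 ×ˢ Icc 0 1) := by
    have h1 : ContinuousOn (fun p : ℝ × ℝ => ‖l2Curve hY p.2 - l2Curve hY p.1‖ ^ 2)
        (Icc 0 1 ×ˢ Icc 0 1) :=
      ((hx.comp continuousOn_snd fun p hp => hp.2).sub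
        (hx.comp continuousOn_fst fun p hp => hp.1)).norm.pow 2
    exact h1.congr fun p hp => (norm_l2Curve_sub_sq hY hp.1.1 hp.2.1).symm
  obtain ⟨K, C, hK, hC, hKC⟩ := exists_abs_integral_weightedIncr_mul_le hY h hodd hB hgmeas
  obtain ⟨D, hD0, hD⟩ := h.exists_sq_le hq.le hδo
  have h2q : 2 * (1 / (2 * (m : ℝ))) = 1 / (m : ℝ) := by field_simp
  rw [h2q] at hD
  obtain ⟨Cμ, hCμ⟩ := hμOD
  have hW := CenteredGaussianFamily.weightedConst_nonneg m
  have hG := gaussMoment_nonneg (2 * m)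
  set W := CenteredGaussianFamily.weightedConst m
  set A₁ := 6 * K * B ^ 2 * gaussMoment (2 * m)
  set A₂ := 8 * W * B ^ 2 * C ^ 2 * D * (m / (m - 1)) + 4 * W * B ^ 2 * |Cμ|
  -- With δ(ε) = τ(ε)·ε^(1/(2m)) and τ → 0, the region near the diagonal and endpoints contributes
  -- A₁τ^(2m) after division by ε², the rest A₂τ^(2m-2).
  set τ : ℝ → ℝ := fun ε => δ ε / ε ^ (1 / (2 * (m : ℝ)))
  have hτ : Tendsto τ (𝓝[>] 0) (𝓝 0) := hδo.tendsto_div_nhds_zero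
  have hlim : Tendsto (fun ε => A₁ * τ ε ^ (2 * m) + A₂ * τ ε ^ (2 * m - 2)) (𝓝[>] 0) (𝓝 0) := by
    have := ((hτ.pow (2 * m)).const_mul A₁).add ((hτ.pow (2 * m - 2)).const_mul A₂)
    simpa [show 2 * m ≠ 0 by omega, show 2 * m - 2 ≠ 0 by omega] using this
  refine squeeze_zero' (Eventually.of_forall fun ε => ?_) ?_ hlim
  · exact mul_nonneg (by positivity) (integral_nonneg fun _ => sq_nonneg _)
  filter_upwards [hCμ, Ioo_mem_nhdsGT one_pos] with ε hμε ⟨hε, hε1⟩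
  have hm1 : 0 < (m : ℝ) - 1 := by linarith
  set e := ε ^ (-((m : ℝ) - 1) / (m : ℝ)) with he
  set s := ε ^ (1 / (2 * (m : ℝ))) with hs
  have he0 : 0 < e := Real.rpow_pos_of_pos hε _
  have hs0 : 0 < s := Real.rpow_pos_of_pos hε _
  have hδε : 0 ≤ δ ε := hδnonneg ε ⟨hε.le, hε1.le⟩
  have hδτ : δ ε = τ ε * s := (div_mul_cancel₀ _ hs0.ne').symm
  have hs1 : s ^ (2 * m) = ε := by
    rw [hs, ← Real.rpow_natCast, ← Real.rpow_mul hε.le]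
    push_cast
    rw [one_div_mul_cancel (by positivity), Real.rpow_one]
  -- Exact balance: δ(ε)^(2m-2) compensates the blow-up ε^(-(m-1)/m) of both the off-diagonal mass
  -- and the regression integral, leaving only powers of τ.
  have hs2 : s ^ (2 * m - 2) * e = 1 := by
    rw [hs, he, ← Real.rpow_natCast, ← Real.rpow_mul hε.le, ← Real.rpow_add hε,
      Nat.cast_sub (by omega)]
    push_cast
    rw [show 1 / (2 * (m : ℝ)) * (2 * m - 2) + -((m : ℝ) - 1) / m = 0 by field_simp; ring,
      Real.rpow_zero]
  have hμε' : (μp + μn) (offDiagSimplex ε) ≤ ENNReal.ofReal (|Cμ| * e) := by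
    refine hμε.trans (ENNReal.ofReal_le_ofReal ?_)
    have := le_abs_self Cμ
    gcongr
  have hbound := lintegral_unitSq_weightedIncr_le hXmeas hY h hm hB hgmeas hK hD0 hKC hD hμ hF hε
    hε1.le (hμε'.trans_lt ENNReal.ofReal_lt_top)
  have hfinal := (hfirst ε hε hε1.le).2.2.trans (hbound.trans
    (b := _) (c := ENNReal.ofReal (ε ^ 2 * (A₁ * τ ε ^ (2 * m) + A₂ * τ ε ^ (2 * m - 2)))) ?_)
  · have hτ0 : 0 ≤ τ ε := div_nonneg hδε hs0.le
    rw [ENNReal.ofReal_le_ofReal_iff (by positivity)] at hfinal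
    rw [one_div_mul_eq_div, div_le_iff₀ (by positivity)]
    linarith
  · refine (mul_le_mul_right (add_le_add_right (add_le_add_right (mul_le_mul_right
      (mul_le_mul_right hμε' _) _) _) _) _).trans ?_
    rw [ofReal_second_moment_bound (by positivity) (by positivity) (by positivity)
      (by positivity) (by positivity) (by positivity) (by positivity)]
    refine ENNReal.ofReal_le_ofReal (le_of_eq ?_)
    rw [hδτ, mul_pow, mul_pow, hs1]
    linear_combination (A₂ * ε ^ 2 * τ ε ^ (2 * m - 2)) * hs2
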